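/- **Setting.** Fix $d$. A *cube* is a set $\prod_{i=1}^d [y_i, y_i+n)\cap\mathbb Z^d$ with $y \in \mathbb Z^d$, $n\ge 1$. For $f:\mathbb Z^d\to\mathbb C$ let $M_{HL}f(x)=\sup_{Q\ni x}\frac1{|Q|}\sum_{m\in Q}|f(m)|$ (supremum over cubes). A positive function $w$ is an $A_p$ weight with constant $N$ if $\sum_n (M_{HL}f(n))^p w(n)\le N^p\sum_n|f(n)|^pw(n)$ for all $f$. *Rectangles.* For $k\ge0$, $1\le i\le d$ let $a_i(k)\in\mathbb N$ be nondecreasing in $k$, with $a_i(0)=0$, and such that for every $k$ some $i$ has $a_i(k)<a_i(k+1)$. Put $H_k=\prod_i[-2^{a_i(k)},2^{a_i(k)})$, let $\sigma_k$ be the partition of $\mathbb Z^d$ into the boxes $\prod_i 2^{a_i(k)}[m_i,m_i+1)$, $m\in\mathbb Z^d$, and let $\mathbb E_kf(x)$ be the average of $f$ over the box of $\sigma_k$ containing $x$. For finite $E,H\subset\mathbb Z^d$ let $\partial E$ be the set of points of $E$ having a nearest neighbour outside $E$, and $B(E,H)=|\{x:\partial E\cap(H-x)\ne\emptyset\}|$.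 *Regular families.* Let $c>0$ and let $(\iota(l))_{l\ge0},(\varepsilon(l))_{l\ge0}$ be summable. Collections $\mathcal A_k$ ($k\ge0$) of finite subsets of $\mathbb Z^d$ and sets $E_t$ ($t\ge1$) form a *regular family* with these data if: 1. $E\subset H_k$ and $|E|\ge c|H_k|$ for $E\in\mathcal A_k$; 2. $B(E,H_k)/|H_{k+l}|\le\iota(l)^2$ for $E\in\mathcal A_{k+l}$, $k,l\ge0$; 3. $B(H_{k+l},H_k)/|H_{k+l}|\le\varepsilon(l)^2$ for $k,l\ge0$; 4. $E_t\subset E_{t'}$ and $E_t,E_{t'}\in\mathcal A_k$ whenever $2^k\le t\le t'<2^{k+1}$. With $A_tf(x)=\frac1{|E_t|}\sum_{y\in E_t}f(x-y)$, the family is *cubic* with constant $K$ if $\sup_{t\ge1}|A_tf(x)|\le K\,M_{HL}f(x)$ for all $f$ and $x$. *Square functions.* Let $$\mathcal S^L_kf=\sup_{2^k\le t<2^{k+1}}|A_tf-\mathbb E_kf|,\qquad \mathcal S^S_kf=\sup_{2^k\le t_0<t_1<\dots<t_n<2^{k+1}}\Big(\sum_{j<n}|A_{t_j}f-A_{t_{j+1}}f|^2\Big)^{1/2},$$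 and for $*\in\{L,S\}$ let $\mathcal S^*f=\big(\sum_{k\ge0}|\mathcal S^*_kf|^2\big)^{1/2}$. Let also $\tilde{\mathcal S}^*_kf(x)=\sup_{v\in H_k}\mathcal S^*_kf(x+v)$ and $$\mathcal S^*_{D,k}f=\sum_{Q\in\sigma_k}\tilde{\mathcal S}^*_kf(x_Q)\,1_{3Q},\qquad \mathcal S^*_Df=\Big(\sum_{k\ge0}|\mathcal S^*_{D,k}f|^2\Big)^{1/2},$$ where $x_Q$ is the (lattice) centre of $Q$, namely its lower corner plus the integer part of half of each side length, and $3Q$ is the concentric triple of $Q$. **Theorem.** Let $1<p<\infty$. For all data $d$, $c>0$, summable $\iota,\varepsilon$, $K$ and $N$ there is a finite constant $C$, depending only on these and on $p$, such that for every regular family with data $c,\iota,\varepsilon$ that is cubic with constant $K$, every $A_p$ weight $w$ with constant $N$ and every $f:\mathbb Z^d\to\mathbb C$, $$\sum_{n\in\mathbb Z^d}|\mathcal S^*f(n)|^p\,w(n)\le C\sum_{n\in\mathbb Z^d}|f(n)|^p\,w(n)\quad\text{and}\quad \sum_{n\in\mathbb Z^d}|\mathcal S_D^*f(n)|^p\,w(n)\le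 C\sum_{n\in\mathbb Z^d}|f(n)|^p\,w(n),\qquad *=L,S .$$ -/

import Mathlib

open scoped NNReal ENNReal

noncomputable section

namespace LatticeSq

/-- The integer lattice `ℤ^d`. -/
abbrev Lat (d : ℕ) : Type := Fin d → ℤ

variable {d : ℕ}

/-! ### Averages and the cubic Hardy-Littlewood maximal function -/

/-- The convolution average `A_E f (x) = |E|⁻¹ ∑_{y ∈ E} f (x - y)`. -/
def avg (E : Finset (Lat d)) (f : Lat d → ℂ) (x : Lat d) : ℂ :=
  (E.card : ℂ)⁻¹ * ∑ y ∈ E, f (x - y)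

/-- The discrete cube with lower corner `y` and `n + 1` lattice points along each side. -/
def cube (y : Lat d) (n : ℕ) : Finset (Lat d) :=
  Finset.Icc y (fun i => y i + n)

/-- The uncentered cubic Hardy-Littlewood maximal function, with values in `[0, ∞]`. -/
def maxHL (f : Lat d → ℂ) (x : Lat d) : ℝ≥0∞ :=
  ⨆ (y : Lat d) (n : ℕ) (_ : x ∈ cube y n),
    (∑ m ∈ cube y n, ‖f m‖ₑ) / ((cube y n).card : ℝ≥0∞)

/-- `w` is a (strictly positive) discrete `A_p` weight with constant `N`: the maximal function
is bounded on `L^p(ℤ^d, w)` with norm at most `N`. -/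
structure IsApWeight (p : ℝ) (N : ℝ≥0) (w : Lat d → ℝ≥0) : Prop where
  pos : ∀ n, 0 < w n
  bound : ∀ f : Lat d → ℂ,
    ∑' n, maxHL f n ^ p * (w n : ℝ≥0∞) ≤
      (N : ℝ≥0∞) ^ p * ∑' n, ‖f n‖ₑ ^ p * (w n : ℝ≥0∞)

/-! ### Dyadic rectangles and regular families -/

/-- The symmetric rectangle `H = ∏_i [-2^{b_i}, 2^{b_i})`. -/
def symRect (b : Fin d → ℕ) : Finset (Lat d) :=
  Fintype.piFinset fun i => Finset.Ico (-(2 : ℤ) ^ b i) ((2 : ℤ) ^ b i)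

/-- The atom `∏_i 2^{b_i} [m_i, m_i + 1)`. -/
def atom (b : Fin d → ℕ) (m : Lat d) : Finset (Lat d) :=
  Fintype.piFinset fun i => Finset.Ico ((2 : ℤ) ^ b i * m i) ((2 : ℤ) ^ b i * (m i + 1))

/-- The index `m` of the atom that contains `x` (the division is the floor division of `ℤ`). -/
def atomIndex (b : Fin d → ℕ) (x : Lat d) : Lat d := fun i => x i / (2 : ℤ) ^ b i

/-- Conditional expectation on the `σ`-algebra generated by the atoms: the average of `f` over
the atom that contains `x`. -/
def condAvg (b : Fin d → ℕ) (f : Lat d → ℂ) (x : Lat d) : ℂ :=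
  ((atom b (atomIndex b x)).card : ℂ)⁻¹ * ∑ y ∈ atom b (atomIndex b x), f y

/-- Discrete boundary of `E`: the points of `E` with a nearest neighbour outside `E`. -/
def bdry (E : Finset (Lat d)) : Set (Lat d) :=
  {y | y ∈ E ∧ ∃ i, y + Pi.single i 1 ∉ E ∨ y - Pi.single i 1 ∉ E}

/-- `B(E, H)`, the number of `x` for which `∂E` meets the translate `H - x`. -/
def bdryCount (E H : Finset (Lat d)) : ℕ :=
  {x : Lat d | ∃ h ∈ H, h - x ∈ bdry E}.ncard

/-- The exponents `a k` describe a nested sequence `{0} = R_0 ⊂ R_1 ⊂ ⋯` of dyadic rectangles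
`R_k = ∏_i [0, 2^{a k i})`, strictly increasing at each step. -/
structure IsDyadicScale (a : ℕ → Fin d → ℕ) : Prop where
  zero : ∀ i, a 0 i = 0
  mono : ∀ k i, a k i ≤ a (k + 1) i
  strict : ∀ k, ∃ i, a k i < a (k + 1) i

/-- The four criteria (location, size, smoothness, eccentricity) on the collections `𝒜 k`, with
`H_k = symRect (a k)`, size constant `c`, smoothness sequence `ι`, eccentricity sequence `ε`. -/
structure IsJRW (a : ℕ → Fin d → ℕ) (𝒜 : ℕ → Set (Finset (Lat d)))
    (c : ℝ) (ι ε : ℕ → ℝ) : Prop where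
  location : ∀ k, ∀ E ∈ 𝒜 k, E ⊆ symRect (a k)
  size : ∀ k, ∀ E ∈ 𝒜 k, c * ((symRect (a k)).card : ℝ) ≤ (E.card : ℝ)
  smooth : ∀ k l, ∀ E ∈ 𝒜 (k + l),
    (bdryCount E (symRect (a k)) : ℝ) / ((symRect (a (k + l))).card : ℝ) ≤ ι l ^ 2
  eccentric : ∀ k l,
    (bdryCount (symRect (a (k + l))) (symRect (a k)) : ℝ) /
      ((symRect (a (k + l))).card : ℝ) ≤ ε l ^ 2

/-- The index block `2^k ≤ t < 2^(k+1)`. -/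
def block (k : ℕ) : Set ℕ := Set.Ico (2 ^ k) (2 ^ (k + 1))

/-- The sets `E t`, `t ≥ 1`, are regular with respect to `𝒜`: for `t ≤ t'` in the `k`-th block
`E t ⊆ E t'`, and both sets belong to `𝒜 k`. -/
structure IsRegularWrt (𝒜 : ℕ → Set (Finset (Lat d))) (E : ℕ → Finset (Lat d)) : Prop where
  mem : ∀ k, ∀ t ∈ block k, E t ∈ 𝒜 k
  nested : ∀ k, ∀ t ∈ block k, ∀ t' ∈ block k, t ≤ t' → E t ⊆ E t'

/-- The family is cubic with constant `K`: its maximal function `sup_t |A_t f|` is pointwise at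
most `K` times the cubic Hardy-Littlewood maximal function. -/
def IsCubic (E : ℕ → Finset (Lat d)) (K : ℝ≥0) : Prop :=
  ∀ (f : Lat d → ℂ) (x : Lat d),
    (⨆ (t : ℕ) (_ : 1 ≤ t), ‖avg (E t) f x‖ₑ) ≤ (K : ℝ≥0∞) * maxHL f x

/-! ### Square functions -/

/-- The `k`-th piece of the long square function. -/
def longPiece (a : ℕ → Fin d → ℕ) (E : ℕ → Finset (Lat d)) (f : Lat d → ℂ) (k : ℕ)
    (x : Lat d) : ℝ≥0∞ :=
  ⨆ t ∈ block k, ‖avg (E t) f x - condAvg (a k) f x‖ₑ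

/-- The `k`-th piece of the short square function; the supremum is over all finite strictly
increasing sequences `t_0 < ⋯ < t_n` in the `k`-th block. -/
def shortPiece (E : ℕ → Finset (Lat d)) (f : Lat d → ℂ) (k : ℕ) (x : Lat d) : ℝ≥0∞ :=
  (⨆ (n : ℕ) (t : Fin (n + 1) → ℕ) (_ : StrictMono t) (_ : ∀ j, t j ∈ block k),
    ∑ j : Fin n, ‖avg (E (t j.castSucc)) f x - avg (E (t j.succ)) f x‖ₑ ^ 2) ^ (1 / 2 : ℝ)

/-- The square function `(∑_k |S_k|^2)^{1/2}` with pieces `S_k`. -/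
def squareFn (S : ℕ → Lat d → ℝ≥0∞) (x : Lat d) : ℝ≥0∞ :=
  (∑' k, S k x ^ 2) ^ (1 / 2 : ℝ)

/-- The long square function. -/
def longSq (a : ℕ → Fin d → ℕ) (E : ℕ → Finset (Lat d)) (f : Lat d → ℂ) : Lat d → ℝ≥0∞ :=
  squareFn (longPiece a E f)

/-- The short square function. -/
def shortSq (E : ℕ → Finset (Lat d)) (f : Lat d → ℂ) : Lat d → ℝ≥0∞ :=
  squareFn (shortPiece E f)

/-- The shifted piece `x ↦ sup_{v ∈ H_k} S_k (x + v)`. -/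
def shiftedPiece (a : ℕ → Fin d → ℕ) (S : ℕ → Lat d → ℝ≥0∞) (k : ℕ) (x : Lat d) : ℝ≥0∞ :=
  ⨆ v ∈ symRect (a k), S k (x + v)

/-- The lattice centre of an atom: lower corner plus half of each side length (rounded down when
the side length is `1`). -/
def atomCenter (b : Fin d → ℕ) (m : Lat d) : Lat d :=
  fun i => (2 : ℤ) ^ b i * m i + (2 : ℤ) ^ b i / 2

/-- The concentric triple `3Q` of an atom `Q`. -/
def tripleAtom (b : Fin d → ℕ) (m : Lat d) : Finset (Lat d) :=
  Fintype.piFinset fun i =>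
    Finset.Ico ((2 : ℤ) ^ b i * (m i - 1)) ((2 : ℤ) ^ b i * (m i + 2))

/-- The discretized majorant `∑_Q (shifted S_k)(x_Q) 1_{3Q}`, over the atoms `Q` of level `k`. -/
def discPiece (a : ℕ → Fin d → ℕ) (S : ℕ → Lat d → ℝ≥0∞) (k : ℕ) (x : Lat d) : ℝ≥0∞ :=
  ∑' m : Lat d, Set.indicator (tripleAtom (a k) m : Set (Lat d))
    (fun _ => shiftedPiece a S k (atomCenter (a k) m)) x

/-- The discretized long square function `S_D^L`. -/
def discLongSq (a : ℕ → Fin d → ℕ) (E : ℕ → Finset (Lat d)) (f : Lat d → ℂ) :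
    Lat d → ℝ≥0∞ :=
  squareFn (discPiece a (longPiece a E f))

/-- The discretized short square function `S_D^S`. -/
def discShortSq (a : ℕ → Fin d → ℕ) (E : ℕ → Finset (Lat d)) (f : Lat d → ℂ) :
    Lat d → ℝ≥0∞ :=
  squareFn (discPiece a (shortPiece E f))

/-- `∑_n F(n)^p w(n)`, the `p`-th power of the norm of `F` in `L^p(ℤ^d, w)`. -/
def wInt (p : ℝ) (w : Lat d → ℝ≥0) (F : Lat d → ℝ≥0∞) : ℝ≥0∞ :=
  ∑' n, F n ^ p * (w n : ℝ≥0∞)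

end LatticeSq

end

/-!
The proof has three layers.

*Geometry.* Testing the cubic condition on a point mass shows that the rectangles `H_k` have
eccentricity bounded in terms of `K` and `c` (`eccentricity_le`). Hence `H_k` is comparable to a
dyadic cube of side `2 ^ s k`, where `s k` (`minScale`) is the exponent of its shortest side, and
everything may be measured on the dyadic cells of these sides, which form a filtration. The
boundary condition then says that a set of generation `k` is a union of cells of side `2 ^ s κ`, up
to a proportion of its points of order `ι (k - κ) ^ 2` (`hasThinBoundary_of_bdryCount`).

*Systems of pieces.* Only a few properties of the long and the short pieces matter
(`IsPieceSystem`): they are subadditive, dominated by an average over a window of side comparable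
to `2 ^ s k`, they vanish on functions that are constant on such a window, and they are
quadratically small, with factor `β (k - κ)`, on functions with mean zero over the cells of side
`2 ^ s κ`. For the short pieces the last estimate uses that the sets of one block increase, so that
the boundary contributions of successive differences can be summed. A piece is then replaced by its
supremum over a window about the cell (`hull`). The hull is constant on cells, and it dominates
both the piece and its discretization, so that one estimate for hulls gives all four inequalities.

*Estimates for hulls.* In `ℓ²`, the martingale differences of `f` and Schur's test apply because
the gains `β` are summable. The weak type `(1,1)` inequality (`weak_type`) follows by a
Calderón–Zygmund decomposition; the bad function is split according to the generation of the
stopping cells, and the quadratic estimate is used once more, so that summability of `ι` suffices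
and no regularity of the averages beyond it is required. For the weighted bound, let the tail
square function at `x` collect the generations from `k` on. Since the hulls are constant on cells,
the sets where a tail exceeds `λ` for a given last index are unions of cells, and on each such cell
the weak type inequality bounds the part where the full square function exceeds `ρ λ` while the
maximal function stays below `γ λ` (`card_large_le`). The boundedness of the maximal function on
`L^p(w)`, tested on indicators, turns small proportions of a cell into proportions of its weight
that are bounded away from one (`IsApWeight.sum_le_of_card_le`). This is a good-`λ` inequality in
which the measure is reduced by a fixed factor only, and choosing `ρ` close to one allows the left
side to be absorbed (`lintegral_rpow_le_of_good_lambda`). Absorption requires an a priori finite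
quantity; finitely many generations and finitely supported `f` provide it, and monotone limits
remove the restriction (`exists_wInt_hull_le`).
-/

noncomputable section

namespace LatticeSq

variable {d : ℕ}

/-! ### Sums of squares in `[0, ∞]` -/

/-- Cauchy–Schwarz in the form suited to weights that may vanish. -/
lemma sq_sum_le_sum_mul_sum {ι : Type*} (s : Finset ι) (r c e : ι → ℝ≥0∞)
    (h : ∀ i ∈ s, r i ^ 2 ≤ c i * e i) :
    (∑ i ∈ s, r i) ^ 2 ≤ (∑ i ∈ s, c i) * ∑ i ∈ s, e i := by
  have half (a : ℝ≥0∞) : (a ^ (1 / 2 : ℝ)) ^ (2 : ℝ) = a := by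
    rw [← ENNReal.rpow_mul]; norm_num
  have key : ∑ i ∈ s, r i ≤ ∑ i ∈ s, c i ^ (1 / 2 : ℝ) * e i ^ (1 / 2 : ℝ) := by
    refine Finset.sum_le_sum fun i hi => ?_
    rw [← ENNReal.mul_rpow_of_nonneg _ _ (by norm_num : (0 : ℝ) ≤ 1 / 2),
      one_div, ENNReal.le_rpow_inv_iff (by norm_num)]
    simpa using h i hi
  have := key.trans (ENNReal.inner_le_Lp_mul_Lq s _ _ Real.HolderConjugate.two_two)
  simp only [half] at this
  rw [← ENNReal.mul_rpow_of_nonneg _ _ (by norm_num : (0 : ℝ) ≤ 1 / 2),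
    one_div, ENNReal.le_rpow_inv_iff (by norm_num)] at this
  simpa using this

lemma sq_sum_le_card_mul {ι : Type*} (s : Finset ι) (r : ι → ℝ≥0∞) :
    (∑ i ∈ s, r i) ^ 2 ≤ (s.card : ℝ≥0∞) * ∑ i ∈ s, r i ^ 2 := by
  simpa using sq_sum_le_sum_mul_sum s r (fun _ => 1) (fun i => r i ^ 2) (by simp)

lemma sq_add_le_two_mul (a b : ℝ≥0∞) : (a + b) ^ 2 ≤ 2 * (a ^ 2 + b ^ 2) := by
  simpa [Fin.sum_univ_two] using sq_sum_le_card_mul (Finset.univ : Finset (Fin 2)) ![a, b]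

lemma sum_sq_le_sq_sum {ι : Type*} (s : Finset ι) (r : ι → ℝ≥0∞) :
    ∑ i ∈ s, r i ^ 2 ≤ (∑ i ∈ s, r i) ^ 2 := by
  classical
  induction s using Finset.induction_on with
  | empty => simp
  | insert a s ha ih =>
    rw [Finset.sum_insert ha, Finset.sum_insert ha, add_sq]
    calc _ ≤ r a ^ 2 + (∑ i ∈ s, r i) ^ 2 := by gcongr
      _ ≤ _ := by gcongr; exact le_self_add

/-! ### Windows and dyadic cells -/

/-- The centred cube `{u : |u_i| ≤ r}`, used as a window of translations. -/
def ball (r : ℕ) : Finset (Lat d) := Fintype.piFinset fun _ => Finset.Icc (-(r : ℤ)) r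

lemma mem_ball {r : ℕ} {u : Lat d} : u ∈ ball r ↔ ∀ i, |u i| ≤ r := by
  simp [ball, abs_le]

lemma card_ball (r : ℕ) : (ball r : Finset (Lat d)).card = (2 * r + 1) ^ d := by
  simp only [ball, Fintype.card_piFinset, Int.card_Icc, Finset.prod_const, Finset.card_univ,
    Fintype.card_fin]
  congr 1; omega

lemma zero_mem_ball (r : ℕ) : (0 : Lat d) ∈ ball r := by simp [mem_ball]

lemma neg_mem_ball {r : ℕ} {u : Lat d} (hu : u ∈ ball r) : -u ∈ ball r := by
  simpa [mem_ball] using hu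

lemma add_mem_ball {r t : ℕ} {u v : Lat d} (hu : u ∈ ball r) (hv : v ∈ ball t) :
    u + v ∈ ball (r + t) := by
  rw [mem_ball] at *
  intro i
  have := abs_add_le (u i) (v i)
  have := hu i
  have := hv i
  simp only [Pi.add_apply, Nat.cast_add]; linarith

lemma ball_mono {r t : ℕ} (h : r ≤ t) : (ball r : Finset (Lat d)) ⊆ ball t := by
  intro u hu
  rw [mem_ball] at *
  exact fun i => (hu i).trans (by exact_mod_cast h)

lemma card_ball_le (r n : ℕ) (h : 2 * r + 1 ≤ 2 ^ n) :
    ((ball r : Finset (Lat d)).card : ℝ≥0∞) ≤ 2 ^ (n * d) := by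
  rw [card_ball, pow_mul]
  exact_mod_cast Nat.pow_le_pow_left h d

lemma mem_atom {b : Fin d → ℕ} {m y : Lat d} : y ∈ atom b m ↔ atomIndex b y = m := by
  simp only [atom, Fintype.mem_piFinset, Finset.mem_Ico, atomIndex, funext_iff]
  refine forall_congr' fun i => ?_
  have : (0 : ℤ) < 2 ^ b i := by positivity
  rw [Int.ediv_eq_iff_of_pos this]
  constructor <;> rintro ⟨h1, h2⟩ <;> constructor <;> nlinarith

lemma card_atom (b : Fin d → ℕ) (m : Lat d) : (atom b m).card = ∏ i, 2 ^ b i := by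
  simp only [atom, Fintype.card_piFinset, Int.card_Ico]
  refine Finset.prod_congr rfl fun i _ => ?_
  rw [show (2 : ℤ) ^ b i * (m i + 1) - 2 ^ b i * m i = ((2 ^ b i : ℕ) : ℤ) by push_cast; ring, Int.toNat_natCast]

/-- The dyadic cube of side `2^j` that contains `x`. -/
def cell (j : ℕ) (x : Lat d) : Finset (Lat d) := atom (fun _ => j) (atomIndex (fun _ => j) x)

lemma mem_cell {j : ℕ} {x y : Lat d} : y ∈ cell j x ↔ ∀ i, y i / 2 ^ j = x i / 2 ^ j := by
  simp [cell, mem_atom, atomIndex, funext_iff]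

lemma self_mem_cell (j : ℕ) (x : Lat d) : x ∈ cell j x := by simp [mem_cell]

lemma mem_cell_comm {j : ℕ} {x y : Lat d} : y ∈ cell j x ↔ x ∈ cell j y := by
  simp only [mem_cell, eq_comm]

lemma cell_eq_of_mem {j : ℕ} {x y : Lat d} (h : y ∈ cell j x) : cell j y = cell j x := by
  ext z
  rw [mem_cell] at h
  simp [mem_cell, h]

lemma card_cell (j : ℕ) (x : Lat d) : (cell j x).card = 2 ^ (j * d) := by
  simp [cell, card_atom, pow_mul]

lemma ediv_two_pow_congr {j n : ℕ} (h : j ≤ n) {a b : ℤ} (hab : a / 2 ^ j = b / 2 ^ j) :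
    a / 2 ^ n = b / 2 ^ n := by
  obtain ⟨l, rfl⟩ := Nat.exists_eq_add_of_le h
  rw [pow_add, ← Int.ediv_ediv_of_nonneg (by positivity),
    ← Int.ediv_ediv_of_nonneg (by positivity), hab]

lemma cell_mono {j n : ℕ} (h : j ≤ n) {x y : Lat d} (hy : y ∈ cell j x) : y ∈ cell n x := by
  rw [mem_cell] at *
  exact fun i => ediv_two_pow_congr h (hy i)

lemma cell_subset {j n : ℕ} (h : j ≤ n) {x y : Lat d} (hy : y ∈ cell n x) :
    cell j y ⊆ cell n x := by
  intro z hz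
  rw [← cell_eq_of_mem hy]
  exact cell_mono h hz

lemma cell_zero (x : Lat d) : cell 0 x = {x} := by
  ext y; simp [mem_cell, funext_iff]

lemma abs_sub_lt_of_ediv_eq {j : ℕ} {a b : ℤ} (h : a / 2 ^ j = b / 2 ^ j) :
    |a - b| < 2 ^ j := by
  have hp : (0 : ℤ) < 2 ^ j := by positivity
  have h1 := Int.emod_nonneg a hp.ne'
  have h2 := Int.emod_lt_of_pos a hp
  have h3 := Int.emod_nonneg b hp.ne'
  have h4 := Int.emod_lt_of_pos b hp
  have h5 := Int.mul_ediv_add_emod a (2 ^ j)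
  have h6 := Int.mul_ediv_add_emod b (2 ^ j)
  rw [h] at h5
  rw [abs_lt]; constructor <;> linarith

lemma sub_mem_ball_of_mem_cell {j : ℕ} {x y : Lat d} (h : y ∈ cell j x) :
    y - x ∈ ball (2 ^ j) := by
  rw [mem_cell] at h
  rw [mem_ball]
  intro i
  have := abs_sub_lt_of_ediv_eq (h i)
  push_cast
  exact this.le

/-! ### Averages over dyadic cells -/

/-- The average over the dyadic cube of side `2^j` that contains `x`, of a function with values in
`[0, ∞]`. -/
def eavg (j : ℕ) (φ : Lat d → ℝ≥0∞) (x : Lat d) : ℝ≥0∞ :=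
  (2 ^ (j * d))⁻¹ * ∑ y ∈ cell j x, φ y

/-- The average of a complex function over the dyadic cube of side `2^j` that contains `x`. -/
abbrev cavg (j : ℕ) (f : Lat d → ℂ) : Lat d → ℂ := condAvg (fun _ => j) f

lemma cavg_eq (j : ℕ) (f : Lat d → ℂ) (x : Lat d) :
    cavg j f x = ((2 : ℂ) ^ (j * d))⁻¹ * ∑ y ∈ cell j x, f y := by
  rw [cavg, condAvg, ← cell, card_cell]; simp

lemma eavg_congr {j : ℕ} {φ : Lat d → ℝ≥0∞} {x y : Lat d} (h : y ∈ cell j x) :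
    eavg j φ y = eavg j φ x := by
  rw [eavg, eavg, cell_eq_of_mem h]

lemma cavg_congr {j : ℕ} {f : Lat d → ℂ} {x y : Lat d} (h : y ∈ cell j x) :
    cavg j f y = cavg j f x := by
  rw [cavg_eq, cavg_eq, cell_eq_of_mem h]

lemma eavg_mono {j : ℕ} {φ ψ : Lat d → ℝ≥0∞} (h : ∀ y, φ y ≤ ψ y) (x : Lat d) :
    eavg j φ x ≤ eavg j ψ x := by
  unfold eavg; gcongr; exact h _

lemma two_pow_inv_mul (n : ℕ) : ((2 : ℝ≥0∞) ^ n)⁻¹ * 2 ^ n = 1 :=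
  ENNReal.inv_mul_cancel (by simp) (by simp)

lemma eavg_eq_of_const {j : ℕ} {φ : Lat d → ℝ≥0∞} {x : Lat d}
    (h : ∀ y ∈ cell j x, φ y = φ x) : eavg j φ x = φ x := by
  rw [eavg, Finset.sum_congr rfl h, Finset.sum_const, card_cell, nsmul_eq_mul, ← mul_assoc]
  push_cast
  rw [two_pow_inv_mul, one_mul]

lemma cavg_eq_of_const {j : ℕ} {f : Lat d → ℂ} {x : Lat d}
    (h : ∀ y ∈ cell j x, f y = f x) : cavg j f x = f x := by
  rw [cavg_eq, Finset.sum_congr rfl h, Finset.sum_const, card_cell, nsmul_eq_mul, ← mul_assoc]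
  push_cast
  rw [inv_mul_cancel₀ (pow_ne_zero _ two_ne_zero), one_mul]

/-- A factor that is constant on the cells comes out of the average. -/
lemma eavg_mul_of_const {j : ℕ} {φ ψ : Lat d → ℝ≥0∞} {x : Lat d}
    (h : ∀ y ∈ cell j x, ψ y = ψ x) : eavg j (fun y => ψ y * φ y) x = ψ x * eavg j φ x := by
  rw [eavg, eavg, Finset.sum_congr rfl fun y hy => by rw [h y hy], ← Finset.mul_sum]
  ring

lemma eavg_add (j : ℕ) (φ ψ : Lat d → ℝ≥0∞) (x : Lat d) :
    eavg j (fun y => φ y + ψ y) x = eavg j φ x + eavg j ψ x := by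
  rw [eavg, eavg, eavg, Finset.sum_add_distrib, mul_add]

lemma eavg_eq_tsum (j : ℕ) (φ : Lat d → ℝ≥0∞) (x : Lat d) :
    eavg j φ x = ∑' y, (2 ^ (j * d))⁻¹ * (if y ∈ cell j x then φ y else 0) := by
  rw [eavg, ENNReal.tsum_mul_left, tsum_eq_sum (s := cell j x) (by simp +contextual)]
  congr 1
  exact Finset.sum_congr rfl fun y hy => by simp [hy]

/-- Averaging over cells is symmetric. -/
lemma tsum_eavg_mul (j : ℕ) (φ ψ : Lat d → ℝ≥0∞) :
    ∑' x, eavg j φ x * ψ x = ∑' x, φ x * eavg j ψ x := by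
  simp_rw [eavg_eq_tsum, ← ENNReal.tsum_mul_left, ← ENNReal.tsum_mul_right]
  rw [ENNReal.tsum_comm]
  refine tsum_congr fun y => tsum_congr fun x => ?_
  by_cases h : y ∈ cell j x
  · simp [h, mem_cell_comm.1 h]; ring
  · simp [h, mt mem_cell_comm.2 h]

lemma tsum_eavg (j : ℕ) (φ : Lat d → ℝ≥0∞) : ∑' x, eavg j φ x = ∑' x, φ x := by
  have := tsum_eavg_mul j φ fun _ => 1
  simpa [eavg_eq_of_const (φ := fun _ : Lat d => 1)] using this

/-- Integrating against a function that is constant on the cells does not see the averaging. -/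
lemma tsum_mul_eavg_of_const {j : ℕ} {φ ψ : Lat d → ℝ≥0∞}
    (h : ∀ x, ∀ y ∈ cell j x, ψ y = ψ x) : ∑' x, ψ x * eavg j φ x = ∑' x, ψ x * φ x := by
  rw [← tsum_eavg j fun x => ψ x * φ x]
  exact tsum_congr fun x => (eavg_mul_of_const (h x)).symm

lemma sq_eavg_le (j : ℕ) (φ : Lat d → ℝ≥0∞) (x : Lat d) :
    eavg j φ x ^ 2 ≤ eavg j (fun y => φ y ^ 2) x := by
  have h := sq_sum_le_card_mul (cell j x) φ
  rw [card_cell] at h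
  push_cast at h
  calc eavg j φ x ^ 2 = (2 ^ (j * d))⁻¹ ^ 2 * (∑ y ∈ cell j x, φ y) ^ 2 := by
        rw [eavg, mul_pow]
    _ ≤ (2 ^ (j * d))⁻¹ ^ 2 * (2 ^ (j * d) * ∑ y ∈ cell j x, φ y ^ 2) := by gcongr
    _ = ((2 ^ (j * d))⁻¹ * 2 ^ (j * d)) * ((2 ^ (j * d))⁻¹ * ∑ y ∈ cell j x, φ y ^ 2) := by
        ring
    _ = _ := by rw [two_pow_inv_mul, one_mul, eavg]

lemma tsum_sq_eavg_le (j : ℕ) (φ : Lat d → ℝ≥0∞) :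
    ∑' x, eavg j φ x ^ 2 ≤ ∑' x, φ x ^ 2 :=
  (ENNReal.tsum_le_tsum (sq_eavg_le j φ)).trans_eq (tsum_eavg j _)

/-- The sum over a finite union of cells does not change under averaging. -/
lemma sum_cavg_of_saturated {j : ℕ} {F : Finset (Lat d)} (hF : ∀ x ∈ F, cell j x ⊆ F)
    (f : Lat d → ℂ) : ∑ x ∈ F, cavg j f x = ∑ x ∈ F, f x := by
  have h1 : ∀ x ∈ F, cavg j f x
      = ∑ y ∈ F, ((2 : ℂ) ^ (j * d))⁻¹ * (if y ∈ cell j x then f y else 0) := by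
    intro x hx
    rw [cavg_eq, ← Finset.mul_sum, ← Finset.sum_filter]
    congr 2
    ext y
    simp only [Finset.mem_filter]
    exact ⟨fun h => ⟨hF x hx h, h⟩, fun h => h.2⟩
  rw [Finset.sum_congr rfl h1, Finset.sum_comm]
  refine Finset.sum_congr rfl fun y hy => ?_
  rw [← Finset.mul_sum, ← Finset.sum_filter]
  have : F.filter (fun x => y ∈ cell j x) = cell j y := by
    ext x
    simp only [Finset.mem_filter, mem_cell_comm (x := x)]
    exact ⟨fun h => h.2, fun h => ⟨hF y hy h, h⟩⟩
  rw [this, Finset.sum_const, card_cell, nsmul_eq_mul, ← mul_assoc]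
  push_cast
  rw [inv_mul_cancel₀ (pow_ne_zero _ two_ne_zero), one_mul]

lemma cavg_cavg {j n : ℕ} (h : j ≤ n) (f : Lat d → ℂ) (x : Lat d) :
    cavg n (cavg j f) x = cavg n f x := by
  rw [cavg_eq, cavg_eq, sum_cavg_of_saturated fun y hy => cell_subset h hy]

lemma cavg_sub (j : ℕ) (f g : Lat d → ℂ) (x : Lat d) :
    cavg j (fun y => f y - g y) x = cavg j f x - cavg j g x := by
  simp only [cavg_eq, Finset.sum_sub_distrib, mul_sub]

lemma enorm_two_pow_inv (n : ℕ) : ‖((2 : ℂ) ^ n)⁻¹‖ₑ = ((2 : ℝ≥0∞) ^ n)⁻¹ := by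
  rw [enorm_inv (pow_ne_zero _ two_ne_zero), enorm_pow]
  congr 2
  simp [← ofReal_norm]

lemma enorm_cavg_le (j : ℕ) (f : Lat d → ℂ) (x : Lat d) :
    ‖cavg j f x‖ₑ ≤ eavg j (fun y => ‖f y‖ₑ) x := by
  rw [cavg_eq, enorm_mul, enorm_two_pow_inv, eavg]
  gcongr
  exact enorm_sum_le _ _

lemma enorm_sq_eq (z : ℂ) : ‖z‖ₑ ^ 2 = ENNReal.ofReal (Complex.normSq z) := by
  rw [← ofReal_norm, ← ENNReal.ofReal_pow (norm_nonneg _), Complex.normSq_eq_norm_sq]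

/-- Averaging over cells is an orthogonal projection of `ℓ²`. -/
lemma tsum_sq_cavg_add_tsum_sq_sub (j : ℕ) (f : Lat d → ℂ) :
    ∑' x, ‖cavg j f x‖ₑ ^ 2 + ∑' x, ‖f x - cavg j f x‖ₑ ^ 2 = ∑' x, ‖f x‖ₑ ^ 2 := by
  rw [← tsum_eavg j fun x => ‖cavg j f x‖ₑ ^ 2, ← tsum_eavg j fun x => ‖f x - cavg j f x‖ₑ ^ 2,
    ← tsum_eavg j fun x => ‖f x‖ₑ ^ 2, ← ENNReal.tsum_add]
  refine tsum_congr fun x => ?_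
  rw [← eavg_add, eavg, eavg]
  congr 1
  have hc : ∀ y ∈ cell j x, cavg j f y = cavg j f x := fun y hy => cavg_congr hy
  have hs : ∑ y ∈ cell j x, f y = (2 ^ (j * d) : ℂ) * cavg j f x := by
    rw [cavg_eq, ← mul_assoc, mul_inv_cancel₀ (pow_ne_zero _ two_ne_zero), one_mul]
  simp_rw [enorm_sq_eq]
  rw [Finset.sum_congr rfl fun y hy => by
    rw [hc y hy, ← ENNReal.ofReal_add (Complex.normSq_nonneg _) (Complex.normSq_nonneg _)],
    ← ENNReal.ofReal_sum_of_nonneg (fun _ _ => Complex.normSq_nonneg _),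
    ← ENNReal.ofReal_sum_of_nonneg
      (fun _ _ => add_nonneg (Complex.normSq_nonneg _) (Complex.normSq_nonneg _))]
  congr 1
  set c := cavg j f x
  have hre : ∑ y ∈ cell j x, (f y).re = 2 ^ (j * d) * c.re := by
    have := congrArg Complex.re hs
    rw [Complex.re_sum] at this
    rw [this, show (2 : ℂ) ^ (j * d) = ((2 ^ (j * d) : ℝ) : ℂ) by push_cast; rfl,
      Complex.re_ofReal_mul]
  have him : ∑ y ∈ cell j x, (f y).im = 2 ^ (j * d) * c.im := by
    have := congrArg Complex.im hs
    rw [Complex.im_sum] at this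
    rw [this, show (2 : ℂ) ^ (j * d) = ((2 ^ (j * d) : ℝ) : ℂ) by push_cast; rfl,
      Complex.im_ofReal_mul]
  have e : ∀ y, Complex.normSq c + Complex.normSq (f y - c)
      = Complex.normSq (f y) + (2 * (c.re ^ 2 + c.im ^ 2) - 2 * c.re * (f y).re
        - 2 * c.im * (f y).im) := by
    intro y
    simp only [Complex.normSq_apply, Complex.sub_re, Complex.sub_im]; ring
  simp_rw [e]
  rw [Finset.sum_add_distrib, Finset.sum_sub_distrib, Finset.sum_sub_distrib, ← Finset.mul_sum,
    ← Finset.mul_sum, ← Finset.mul_sum, hre, him, Finset.sum_const, card_cell, nsmul_eq_mul]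
  push_cast
  ring

lemma tsum_sum_ball (B : Finset (Lat d)) (φ : Lat d → ℝ≥0∞) :
    ∑' x, ∑ u ∈ B, φ (x + u) = (B.card : ℝ≥0∞) * ∑' x, φ x := by
  rw [Summable.tsum_finsetSum fun _ _ => ENNReal.summable]
  have h : ∀ u : Lat d, ∑' x, φ (x + u) = ∑' x, φ x := fun u => (Equiv.addRight u).tsum_eq φ
  simp only [h, Finset.sum_const, nsmul_eq_mul]

/-- For `b` with vanishing averages over the cells, only the cells that cross the boundary of `F`
contribute to the sum of `b` over `F`. -/
lemma enorm_sum_le_sum_eavg {n : ℕ} {b : Lat d → ℂ} (hb : ∀ x, cavg n b x = 0)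
    (F B : Finset (Lat d))
    (hB : ∀ z, (∃ y ∈ cell n z, y ∈ F) → (∃ y ∈ cell n z, y ∉ F) → z ∈ B) :
    ‖∑ z ∈ F, b z‖ₑ ≤ ∑ z ∈ B, eavg n (fun y => if y ∈ F then ‖b y‖ₑ else 0) z := by
  classical
  set F₀ := F.filter (fun z => cell n z ⊆ F)
  have h0 : ∑ z ∈ F₀, b z = 0 := by
    rw [← sum_cavg_of_saturated (j := n)]
    · simp [hb]
    · intro x hx y hy
      simp only [F₀, Finset.mem_filter] at hx ⊢
      exact ⟨hx.2 hy, by rw [cell_eq_of_mem hy]; exact hx.2⟩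
  rw [← Finset.sum_filter_add_sum_filter_not F (fun z => cell n z ⊆ F), h0, zero_add]
  set B' : Finset (Lat d) := B.filter fun z => (∃ y ∈ cell n z, y ∈ F) ∧ ∃ y ∈ cell n z, y ∉ F
  have hB' : ∀ z, z ∈ B' ↔ (∃ y ∈ cell n z, y ∈ F) ∧ ∃ y ∈ cell n z, y ∉ F := by
    intro z
    simp only [B', Finset.mem_filter]
    exact ⟨fun h => h.2, fun h => ⟨hB z h.1 h.2, h⟩⟩
  have key := tsum_mul_eavg_of_const (j := n) (φ := fun y => if y ∈ F then ‖b y‖ₑ else 0)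
    (ψ := fun z => if z ∈ B' then 1 else 0) (by
      intro x y hy
      simp only [hB', cell_eq_of_mem hy])
  have ts (φ : Lat d → ℝ≥0∞) : ∑' z, (if z ∈ B' then 1 else 0) * φ z = ∑ z ∈ B', φ z := by
    rw [tsum_eq_sum (s := B') (by simp +contextual)]
    exact Finset.sum_congr rfl fun z hz => by simp [hz]
  rw [ts, ts] at key
  calc ‖∑ z ∈ F with ¬cell n z ⊆ F, b z‖ₑ ≤ ∑ z ∈ F with ¬cell n z ⊆ F, ‖b z‖ₑ :=
        enorm_sum_le _ _
    _ = ∑ z ∈ F with ¬cell n z ⊆ F, (if z ∈ F then ‖b z‖ₑ else 0) :=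
        Finset.sum_congr rfl fun z hz => by simp [(Finset.mem_filter.1 hz).1]
    _ ≤ ∑ z ∈ B', (if z ∈ F then ‖b z‖ₑ else 0) := by
        refine Finset.sum_le_sum_of_subset fun z hz => ?_
        rw [Finset.mem_filter] at hz
        rw [hB']
        exact ⟨⟨z, self_mem_cell n z, hz.1⟩, Finset.not_subset.1 hz.2⟩
    _ = ∑ z ∈ B', eavg n (fun y => if y ∈ F then ‖b y‖ₑ else 0) z := key.symm
    _ ≤ _ := Finset.sum_le_sum_of_subset (Finset.filter_subset _ _)

/-! ### Systems of local pieces and their discretized majorants -/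

/-- The common features of the long and the short square function. The `k`-th piece `S f k` is
subadditive in `f`, lives at the scale `2 ^ s k` (up to the fixed factor `2 ^ D`), is dominated by
an average at that scale, annihilates functions that are constant at that scale, and, for `b` with
vanishing averages over the finer cells of side `2 ^ s κ`, gains the factor `β (k - κ)` in a
quadratic estimate. The last condition `growth` makes the scales grow geometrically. -/
structure IsPieceSystem (s : ℕ → ℕ) (D : ℕ) (A : ℝ≥0) (β : ℕ → ℝ≥0)
    (S : (Lat d → ℂ) → ℕ → Lat d → ℝ≥0∞) : Prop where
  zero : s 0 = 0
  mono : Monotone s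
  growth : ∀ k l, (2 : ℝ≥0∞) ^ s k ≤ A * β l ^ 2 * 2 ^ s (k + l)
  add : ∀ f g k x, S (fun y => f y + g y) k x ≤ S f k x + S g k x
  size : ∀ f k x, S f k x ≤
    A * ((2 ^ (s k * d))⁻¹ * ∑ u ∈ ball (2 ^ (s k + D)), ‖f (x + u)‖ₑ)
  const : ∀ f k x, (∀ u ∈ ball (2 ^ (s k + D)), f (x + u) = f x) → S f k x = 0
  smooth : ∀ κ k, κ ≤ k → ∀ b : Lat d → ℂ, (∀ x, cavg (s κ) b x = 0) → ∀ x,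
    S b k x ^ 2 ≤ A * β (k - κ) ^ 2 * ((2 ^ (s k * d))⁻¹ *
      ∑ u ∈ ball (2 ^ (s k + D)), eavg (s κ) (fun y => ‖b y‖ₑ) (x + u) ^ 2)

/-- The lower corner of the dyadic cube of side `2 ^ j` that contains `x`. -/
def corner (j : ℕ) (x : Lat d) : Lat d := fun i => 2 ^ j * (x i / 2 ^ j)

lemma corner_congr {j : ℕ} {x y : Lat d} (h : y ∈ cell j x) : corner j y = corner j x := by
  rw [mem_cell] at h
  exact funext fun i => by simp only [corner, h i]

lemma corner_sub_mem_ball (j : ℕ) (x : Lat d) : corner j x - x ∈ ball (2 ^ j) := by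
  apply sub_mem_ball_of_mem_cell
  rw [mem_cell]
  intro i
  simp [corner]

/-- The supremum of the `k`-th piece over a window of radius `2 ^ (s k + D + 2)` around the lower
corner of the cell of `x`. It is constant on the cells of side `2 ^ s k`, and it dominates both
`S f k` and, up to a factor, the discretization of `S f k`. -/
def hull (s : ℕ → ℕ) (D : ℕ) (S : (Lat d → ℂ) → ℕ → Lat d → ℝ≥0∞) (f : Lat d → ℂ) (k : ℕ)
    (x : Lat d) : ℝ≥0∞ :=
  ⨆ u ∈ ball (2 ^ (s k + D + 2)), S f k (corner (s k) x + u)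

section Pieces

variable {s : ℕ → ℕ} {D : ℕ} {A : ℝ≥0} {β : ℕ → ℝ≥0} {S : (Lat d → ℂ) → ℕ → Lat d → ℝ≥0∞}

lemma hull_congr {f : Lat d → ℂ} {k : ℕ} {x y : Lat d} (h : y ∈ cell (s k) x) :
    hull s D S f k y = hull s D S f k x := by
  rw [hull, hull, corner_congr h]

lemma le_hull (f : Lat d → ℂ) (k : ℕ) {x y : Lat d}
    (h : y - corner (s k) x ∈ ball (2 ^ (s k + D + 2))) : S f k y ≤ hull s D S f k x := by
  have := le_iSup₂ (f := fun u (_ : u ∈ ball (2 ^ (s k + D + 2))) => S f k (corner (s k) x + u)) _ h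
  simpa [hull] using this

lemma corner_add_sub_mem_ball {k : ℕ} {x u v : Lat d} (hu : u ∈ ball (2 ^ (s k + D + 2)))
    (hv : v ∈ ball (2 ^ (s k + D))) :
    corner (s k) x - x + u + v ∈ ball (2 ^ (s k + D + 3)) := by
  refine ball_mono ?_ (add_mem_ball (add_mem_ball (corner_sub_mem_ball (s k) x) hu) hv)
  have : 2 ^ s k ≤ 2 ^ (s k + D) := Nat.pow_le_pow_right (by norm_num) (by omega)
  rw [pow_add _ _ 2, pow_add _ _ 3]; omega

lemma sum_ball_translate_le {φ : Lat d → ℝ≥0∞} {k : ℕ} {x u : Lat d}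
    (hu : u ∈ ball (2 ^ (s k + D + 2))) :
    ∑ v ∈ ball (2 ^ (s k + D)), φ (corner (s k) x + u + v)
      ≤ ∑ v ∈ ball (2 ^ (s k + D + 3)), φ (x + v) := by
  classical
  have inj : Function.Injective fun v : Lat d => corner (s k) x - x + u + v :=
    fun v w h => by simpa using h
  calc ∑ v ∈ ball (2 ^ (s k + D)), φ (corner (s k) x + u + v)
      = ∑ v ∈ (ball (2 ^ (s k + D))).image fun v => corner (s k) x - x + u + v, φ (x + v) := by
        rw [Finset.sum_image inj.injOn]
        refine Finset.sum_congr rfl fun v _ => ?_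
        congr 1; abel
    _ ≤ _ := by
        refine Finset.sum_le_sum_of_subset fun v hv => ?_
        obtain ⟨w, hw, rfl⟩ := Finset.mem_image.1 hv
        exact corner_add_sub_mem_ball hu hw

lemma sq_le_iff_le_rpow {a c : ℝ≥0∞} : a ^ 2 ≤ c ↔ a ≤ c ^ (1 / 2 : ℝ) := by
  rw [one_div, ENNReal.le_rpow_inv_iff (by norm_num)]; simp

namespace IsPieceSystem

variable (hS : IsPieceSystem s D A β S)
include hS

lemma hull_add (f g : Lat d → ℂ) (k : ℕ) (x : Lat d) :
    hull s D S (fun y => f y + g y) k x ≤ hull s D S f k x + hull s D S g k x :=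
  iSup₂_le fun u hu => (hS.add f g k _).trans <| add_le_add
    (le_hull f k (by simpa using hu)) (le_hull g k (by simpa using hu))

lemma hull_size (f : Lat d → ℂ) (k : ℕ) (x : Lat d) :
    hull s D S f k x ≤
      A * ((2 ^ (s k * d))⁻¹ * ∑ u ∈ ball (2 ^ (s k + D + 3)), ‖f (x + u)‖ₑ) := by
  refine iSup₂_le fun u hu => (hS.size f k _).trans ?_
  gcongr
  exact sum_ball_translate_le (φ := fun y => ‖f y‖ₑ) hu

lemma hull_const (f : Lat d → ℂ) (k : ℕ) (x : Lat d)
    (h : ∀ u ∈ ball (2 ^ (s k + D + 3)), f (x + u) = f x) : hull s D S f k x = 0 := by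
  refine le_antisymm (iSup₂_le fun u hu => (hS.const f k _ fun v hv => ?_).le) zero_le
  have key : ∀ v ∈ ball (2 ^ (s k + D)), f (corner (s k) x + u + v) = f x := fun v hv => by
    rw [← h _ (corner_add_sub_mem_ball hu hv)]
    congr 1; abel
  rw [key v hv, ← key 0 (zero_mem_ball _), add_zero]

lemma hull_smooth {κ k : ℕ} (h : κ ≤ k) {b : Lat d → ℂ} (hb : ∀ x, cavg (s κ) b x = 0)
    (x : Lat d) :
    hull s D S b k x ^ 2 ≤ A * β (k - κ) ^ 2 * ((2 ^ (s k * d))⁻¹ *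
      ∑ u ∈ ball (2 ^ (s k + D + 3)), eavg (s κ) (fun y => ‖b y‖ₑ) (x + u) ^ 2) := by
  rw [sq_le_iff_le_rpow]
  refine iSup₂_le fun u hu => ?_
  rw [← sq_le_iff_le_rpow]
  refine (hS.smooth κ k h b hb _).trans ?_
  gcongr
  exact sum_ball_translate_le (φ := fun y => eavg (s κ) (fun y => ‖b y‖ₑ) y ^ 2) hu

/-- The `k`-th piece at `x` sees `f` only in a window around `x`. -/
lemma hull_local {f g : Lat d → ℂ} {k : ℕ} {x : Lat d}
    (h : ∀ u ∈ ball (2 ^ (s k + D + 3)), f (x + u) = g (x + u)) :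
    hull s D S f k x = hull s D S g k x := by
  have key : ∀ f g : Lat d → ℂ, (∀ u ∈ ball (2 ^ (s k + D + 3)), f (x + u) = g (x + u)) →
      hull s D S f k x ≤ hull s D S g k x := by
    intro f g h
    have h1 := hS.hull_add g (fun y => f y - g y) k x
    have h2 : hull s D S (fun y => f y - g y) k x = 0 := by
      refine hS.hull_const _ _ _ fun u hu => ?_
      have h0 := h 0 (zero_mem_ball _)
      rw [add_zero] at h0
      rw [h u hu, h0, sub_self, sub_self]
    simpa [h2] using h1
  exact le_antisymm (key f g h) (key g f fun u hu => (h u hu).symm)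

lemma hull_sum {ι : Type*} (I : Finset ι) (f : ι → Lat d → ℂ) (k : ℕ) (x : Lat d) :
    hull s D S (fun y => ∑ i ∈ I, f i y) k x ≤ ∑ i ∈ I, hull s D S (f i) k x := by
  classical
  induction I using Finset.induction_on with
  | empty => simpa using (hS.hull_const _ k x (by simp)).le
  | insert a I ha ih =>
    simp only [Finset.sum_insert ha]
    exact (hS.hull_add _ _ k x).trans (by gcongr)

end IsPieceSystem

lemma inv_mul_card_window_le (n D : ℕ) :
    ((2 : ℝ≥0∞) ^ (n * d))⁻¹ * ((ball (2 ^ (n + D + 3)) : Finset (Lat d)).card : ℝ≥0∞)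
      ≤ 2 ^ ((D + 5) * d) := by
  have : ((ball (2 ^ (n + D + 3)) : Finset (Lat d)).card : ℝ≥0∞) ≤ 2 ^ ((n + (D + 5)) * d) := by
    apply card_ball_le
    have : 1 ≤ 2 ^ (n + D + 3) := Nat.one_le_two_pow
    rw [show n + (D + 5) = n + D + 3 + 2 by omega, pow_add 2 (n + D + 3) 2]; omega
  calc _ ≤ ((2 : ℝ≥0∞) ^ (n * d))⁻¹ * 2 ^ ((n + (D + 5)) * d) := by gcongr
    _ = 2 ^ ((D + 5) * d) := by rw [add_mul, pow_add, ← mul_assoc, two_pow_inv_mul, one_mul]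

lemma tsum_window_average_le (n D : ℕ) (φ : Lat d → ℝ≥0∞) :
    ∑' x, (2 ^ (n * d))⁻¹ * ∑ u ∈ ball (2 ^ (n + D + 3)), φ (x + u)
      ≤ 2 ^ ((D + 5) * d) * ∑' x, φ x := by
  rw [ENNReal.tsum_mul_left, tsum_sum_ball, ← mul_assoc]
  gcongr
  exact inv_mul_card_window_le n D

/-- The gain on functions that oscillate below the scale of the piece. -/
lemma IsPieceSystem.tsum_sq_hull_smooth_le (hS : IsPieceSystem s D A β S) {κ k : ℕ} (h : κ ≤ k)
    {b : Lat d → ℂ} (hb : ∀ x, cavg (s κ) b x = 0) :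
    ∑' x, hull s D S b k x ^ 2 ≤ A * 2 ^ ((D + 5) * d) * β (k - κ) ^ 2 *
      ∑' x, eavg (s κ) (fun y => ‖b y‖ₑ) x ^ 2 := by
  calc _ ≤ ∑' x, A * β (k - κ) ^ 2 * ((2 ^ (s k * d))⁻¹ *
      ∑ u ∈ ball (2 ^ (s k + D + 3)), eavg (s κ) (fun y => ‖b y‖ₑ) (x + u) ^ 2) :=
        ENNReal.tsum_le_tsum fun x => hS.hull_smooth h hb x
    _ ≤ A * β (k - κ) ^ 2 * (2 ^ ((D + 5) * d) *
          ∑' x, eavg (s κ) (fun y => ‖b y‖ₑ) x ^ 2) := by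
        rw [ENNReal.tsum_mul_left]
        gcongr
        exact tsum_window_average_le (s k) D fun x => eavg (s κ) (fun y => ‖b y‖ₑ) x ^ 2
    _ = _ := by ring

/-! ### The boundary layer of the dyadic cells -/

/-- The points that some translation in the window of radius `r` moves to another cell. -/
def IsNearBoundary (n r : ℕ) (x : Lat d) : Prop := ∃ u ∈ ball r, x + u ∉ cell n x

lemma IsNearBoundary.add {n r : ℕ} {x u : Lat d} (h : IsNearBoundary n r x) (hu : u ∈ ball r) :
    IsNearBoundary n (r + r) (x + u) := by
  obtain ⟨v, hv, hxv⟩ := h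
  by_cases hc : x + u ∈ cell n x
  · refine ⟨-u + v, add_mem_ball (neg_mem_ball hu) hv, ?_⟩
    rwa [cell_eq_of_mem hc, ← add_assoc, add_neg_cancel_right]
  · refine ⟨-u, ball_mono (by omega) (neg_mem_ball hu), ?_⟩
    rw [add_neg_cancel_right, mem_cell_comm]
    exact hc

lemma ediv_add_eq_of_emod {a u : ℤ} {n r : ℕ} (hu : |u| ≤ r) (h1 : (r : ℤ) ≤ a % 2 ^ n)
    (h2 : a % 2 ^ n + r < 2 ^ n) : (a + u) / 2 ^ n = a / 2 ^ n := by
  have hp : (0 : ℤ) < 2 ^ n := by positivity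
  rw [abs_le] at hu
  rw [Int.ediv_eq_iff_of_pos hp]
  have := Int.mul_ediv_add_emod a (2 ^ n)
  constructor <;> nlinarith

/-- The points within `r` of a face of their cell, in the direction of the `i`-th coordinate. -/
def InFaceLayer (n r : ℕ) (i : Fin d) (z : Lat d) : Prop :=
  z i % (2 : ℤ) ^ n < (r : ℤ) ∨ (2 : ℤ) ^ n ≤ z i % (2 : ℤ) ^ n + (r : ℤ)

open Classical in
lemma card_face_layer_le (n r : ℕ) (i : Fin d) (x : Lat d) :
    2 ^ n * ((cell n x).filter (InFaceLayer n r i)).card ≤ 2 * r * 2 ^ (n * d) := by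
  set lo : ℤ := 2 ^ n * (x i / 2 ^ n)
  set F : Fin d → Finset ℤ := fun j =>
    Finset.Ico ((2 : ℤ) ^ n * (x j / 2 ^ n)) ((2 : ℤ) ^ n * (x j / 2 ^ n + 1)) with hF
  set X : Finset ℤ := Finset.Ico lo (lo + r) ∪ Finset.Ico (lo + 2 ^ n - r) (lo + 2 ^ n) with hX
  have hXc : X.card ≤ 2 * r := by
    refine (Finset.card_union_le _ _).trans ?_
    simp only [Int.card_Ico]; omega
  have hsub : (cell n x).filter (InFaceLayer n r i) ⊆
      Fintype.piFinset (Function.update F i X) := by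
    intro z hz
    rw [Finset.mem_filter] at hz
    rw [Fintype.mem_piFinset]
    intro j
    have hzF : z ∈ Fintype.piFinset F := hz.1
    rw [Fintype.mem_piFinset] at hzF
    by_cases hj : j = i
    · subst hj
      have hm := mem_cell.1 hz.1 j
      have h5 := Int.mul_ediv_add_emod (z j) (2 ^ n)
      have h6 := Int.emod_nonneg (z j) (b := (2 : ℤ) ^ n) (by positivity)
      have h7 := Int.emod_lt_of_pos (z j) (b := (2 : ℤ) ^ n) (by positivity)
      rw [hm] at h5
      simp only [Function.update_self, hX, Finset.mem_union, Finset.mem_Ico]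
      rcases hz.2 with h | h
      · left; constructor <;> linarith
      · right; constructor <;> linarith
    · rw [Function.update_of_ne hj]; exact hzF j
  have hFc : (F i).card = 2 ^ n := by
    simp only [hF, Int.card_Ico]
    rw [show (2 : ℤ) ^ n * (x i / 2 ^ n + 1) - 2 ^ n * (x i / 2 ^ n) = ((2 ^ n : ℕ) : ℤ) by
      push_cast; ring, Int.toNat_natCast]
  have hall : ∏ j, (F j).card = 2 ^ (n * d) := by
    rw [← card_cell n x]; exact (Fintype.card_piFinset F).symm
  have h1 := Finset.mul_prod_erase Finset.univ (fun j => (F j).card) (Finset.mem_univ i)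
  have h2 := Finset.mul_prod_erase Finset.univ (fun j => (Function.update F i X j).card)
    (Finset.mem_univ i)
  have h3 : ∏ j ∈ Finset.univ.erase i, (Function.update F i X j).card
      = ∏ j ∈ Finset.univ.erase i, (F j).card :=
    Finset.prod_congr rfl fun j hj => by rw [Function.update_of_ne (Finset.ne_of_mem_erase hj)]
  rw [h3, Function.update_self, ← Fintype.card_piFinset] at h2
  calc _ ≤ 2 ^ n * (Fintype.piFinset (Function.update F i X)).card := by
        gcongr
    _ = X.card * ∏ j, (F j).card := by rw [← h2, ← h1, hFc]; ring
    _ ≤ _ := by rw [hall]; gcongr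

open Classical in
lemma eavg_near_boundary_le (n r : ℕ) (x : Lat d) :
    eavg n (fun z => if IsNearBoundary n r z then 1 else 0) x ≤ d * (2 * r) * (2 ^ n)⁻¹ := by
  have hcard : 2 ^ n * ((cell n x).filter (IsNearBoundary n r)).card
      ≤ d * (2 * r * 2 ^ (n * d)) := by
    have hsub : (cell n x).filter (IsNearBoundary n r) ⊆ Finset.univ.biUnion fun i =>
        (cell n x).filter (InFaceLayer n r i) := by
      intro z hz
      obtain ⟨hz, u, hu, hzu⟩ := Finset.mem_filter.1 hz
      rw [mem_cell, not_forall] at hzu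
      obtain ⟨i, hi⟩ := hzu
      refine Finset.mem_biUnion.2 ⟨i, Finset.mem_univ _, Finset.mem_filter.2 ⟨hz, ?_⟩⟩
      by_contra hcon
      rw [InFaceLayer, not_or, not_lt, not_le] at hcon
      exact hi (ediv_add_eq_of_emod (mem_ball.1 hu i) hcon.1 hcon.2)
    calc _ ≤ 2 ^ n * ∑ i : Fin d, ((cell n x).filter (InFaceLayer n r i)).card := by
            gcongr
            exact (Finset.card_le_card hsub).trans Finset.card_biUnion_le
      _ ≤ ∑ i : Fin d, 2 * r * 2 ^ (n * d) := by
            rw [Finset.mul_sum]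
            exact Finset.sum_le_sum fun i _ => card_face_layer_le n r i x
      _ = _ := by simp
  have hcard' : (2 : ℝ≥0∞) ^ n * (((cell n x).filter (IsNearBoundary n r)).card : ℝ≥0∞)
      ≤ d * (2 * r) * 2 ^ (n * d) := by
    rw [← mul_assoc] at hcard
    exact_mod_cast hcard
  rw [eavg, Finset.sum_boole, ← one_mul (((cell n x).filter _).card : ℝ≥0∞), ← two_pow_inv_mul n]
  calc _ = (2 ^ (n * d))⁻¹ * (2 ^ n)⁻¹ *
        (2 ^ n * (((cell n x).filter (IsNearBoundary n r)).card : ℝ≥0∞)) := by ring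
    _ ≤ (2 ^ (n * d))⁻¹ * (2 ^ n)⁻¹ * (d * (2 * r) * 2 ^ (n * d)) := by gcongr
    _ = ((2 ^ (n * d))⁻¹ * 2 ^ (n * d)) * (d * (2 * r) * (2 ^ n)⁻¹) := by ring
    _ = _ := by rw [two_pow_inv_mul, one_mul]

/-- The constant in the estimates of `ℓ²` norms of pieces. -/
def pieceConst (d D : ℕ) (A : ℝ≥0) : ℝ≥0∞ :=
  A * 2 ^ ((D + 5) * d) + A ^ 3 * 2 ^ ((D + 5) * d) * 2 ^ ((D + 5) * d) * (d * 2 ^ (D + 5))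

open Classical in
/-- The gain on functions that are constant on cells above the scale of the piece: only the
boundary layer of the cells contributes. -/
lemma IsPieceSystem.tsum_sq_hull_coarse_le (hS : IsPieceSystem s D A β S) {κ k : ℕ} (h : k ≤ κ)
    {g : Lat d → ℂ} (hg : ∀ x, ∀ y ∈ cell (s κ) x, g y = g x) :
    ∑' x, hull s D S g k x ^ 2 ≤ pieceConst d D A * β (κ - k) ^ 2 * ∑' x, ‖g x‖ₑ ^ 2 := by
  set R := 2 ^ (s k + D + 3) with hR
  set P : ℝ≥0∞ := 2 ^ ((D + 5) * d)
  set χ : Lat d → ℝ≥0∞ := fun z => if IsNearBoundary (s κ) (R + R) z then 1 else 0 with hχ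
  have hpt : ∀ x, hull s D S g k x ^ 2 ≤
      A ^ 2 * P * ((2 ^ (s k * d))⁻¹ * ∑ u ∈ ball R, ‖g (x + u)‖ₑ ^ 2 * χ (x + u)) := by
    intro x
    by_cases hx : IsNearBoundary (s κ) R x
    · have h1 : ∀ u ∈ ball R, ‖g (x + u)‖ₑ ^ 2 * χ (x + u) = ‖g (x + u)‖ₑ ^ 2 := fun u hu => by
        simp only [hχ, hx.add hu, if_true, mul_one]
      rw [Finset.sum_congr rfl h1]
      calc hull s D S g k x ^ 2
          ≤ (A * ((2 ^ (s k * d))⁻¹ * ∑ u ∈ ball R, ‖g (x + u)‖ₑ)) ^ 2 := by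
            gcongr; exact hS.hull_size g k x
        _ = A ^ 2 * (2 ^ (s k * d))⁻¹ * (2 ^ (s k * d))⁻¹ *
              (∑ u ∈ ball R, ‖g (x + u)‖ₑ) ^ 2 := by ring
        _ ≤ A ^ 2 * (2 ^ (s k * d))⁻¹ * (2 ^ (s k * d))⁻¹ *
              (((ball R : Finset (Lat d)).card : ℝ≥0∞) * ∑ u ∈ ball R, ‖g (x + u)‖ₑ ^ 2) := by
            gcongr; exact sq_sum_le_card_mul _ _
        _ = A ^ 2 * ((2 ^ (s k * d))⁻¹ * ((ball R : Finset (Lat d)).card : ℝ≥0∞)) *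
              ((2 ^ (s k * d))⁻¹ * ∑ u ∈ ball R, ‖g (x + u)‖ₑ ^ 2) := by ring
        _ ≤ _ := by gcongr; exact inv_mul_card_window_le _ _
    · have : hull s D S g k x = 0 := by
        refine hS.hull_const g k x fun u hu => hg _ _ ?_
        by_contra hc
        exact hx ⟨u, hu, hc⟩
      simp [this]
  have hχle : ∀ x, eavg (s κ) χ x ≤
      (d : ℝ≥0∞) * 2 ^ (D + 5) * ((A : ℝ≥0∞) * (β (κ - k) : ℝ≥0∞) ^ 2) := by
    intro x
    refine (eavg_near_boundary_le _ _ x).trans ?_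
    have hgr := hS.growth k (κ - k)
    rw [Nat.add_sub_cancel' h] at hgr
    have e : (2 * ((R + R : ℕ) : ℝ≥0∞)) = 2 ^ (D + 5) * 2 ^ s k := by
      rw [hR]; push_cast; ring
    rw [e]
    calc _ ≤ (d : ℝ≥0∞) * (2 ^ (D + 5) * ((A : ℝ≥0∞) * (β (κ - k) : ℝ≥0∞) ^ 2 * 2 ^ s κ)) *
          (2 ^ s κ)⁻¹ := by gcongr
      _ = (d : ℝ≥0∞) * 2 ^ (D + 5) * ((A : ℝ≥0∞) * (β (κ - k) : ℝ≥0∞) ^ 2) *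
          ((2 ^ s κ)⁻¹ * 2 ^ s κ) := by ring
      _ = _ := by rw [two_pow_inv_mul, mul_one]
  calc ∑' x, hull s D S g k x ^ 2
      ≤ ∑' x, A ^ 2 * P * ((2 ^ (s k * d))⁻¹ * ∑ u ∈ ball R, ‖g (x + u)‖ₑ ^ 2 * χ (x + u)) :=
        ENNReal.tsum_le_tsum hpt
    _ ≤ A ^ 2 * P * (P * ∑' x, ‖g x‖ₑ ^ 2 * χ x) := by
        rw [ENNReal.tsum_mul_left]
        gcongr
        exact tsum_window_average_le (s k) D fun x => ‖g x‖ₑ ^ 2 * χ x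
    _ = A ^ 2 * P * (P * ∑' x, ‖g x‖ₑ ^ 2 * eavg (s κ) χ x) := by
        rw [tsum_mul_eavg_of_const fun x y hy => by rw [hg x y hy]]
    _ ≤ A ^ 2 * P * (P * ∑' x, ‖g x‖ₑ ^ 2 * (d * 2 ^ (D + 5) * (A * β (κ - k) ^ 2))) := by
        gcongr with x; exact hχle x
    _ = A ^ 3 * P * P * (d * 2 ^ (D + 5)) * β (κ - k) ^ 2 * ∑' x, ‖g x‖ₑ ^ 2 := by
        rw [ENNReal.tsum_mul_right]; ring
    _ ≤ _ := by
        unfold pieceConst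
        gcongr
        exact le_add_self

/-! ### Almost orthogonality -/

/-- Schur's test for a square function all of whose pieces are decomposed. -/
lemma tsum_sq_sum_le_of_schur {X : Type*} {I : Finset ℕ} {T : ℕ → ℕ → X → ℝ≥0∞}
    {γ : ℕ → ℕ → ℝ≥0∞} {n : ℕ → ℝ≥0∞} {c B : ℝ≥0∞}
    (hγ0 : ∀ k κ, γ k κ ≠ 0) (hγt : ∀ k κ, γ k κ ≠ ⊤)
    (hT : ∀ k ∈ I, ∀ κ ∈ I, ∑' x, T k κ x ^ 2 ≤ c * γ k κ ^ 2 * n κ)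
    (hrow : ∀ k ∈ I, ∑ κ ∈ I, γ k κ ≤ B) (hcol : ∀ κ ∈ I, ∑ k ∈ I, γ k κ ≤ B) :
    ∑ k ∈ I, ∑' x, (∑ κ ∈ I, T k κ x) ^ 2 ≤ c * B ^ 2 * ∑ κ ∈ I, n κ := by
  have h1 : ∀ k ∈ I, ∑' x, (∑ κ ∈ I, T k κ x) ^ 2 ≤ B * ∑ κ ∈ I, c * (γ k κ * n κ) := by
    intro k hk
    calc ∑' x, (∑ κ ∈ I, T k κ x) ^ 2
        ≤ ∑' x, B * ∑ κ ∈ I, (γ k κ)⁻¹ * T k κ x ^ 2 := by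
          refine ENNReal.tsum_le_tsum fun x => ?_
          refine (sq_sum_le_sum_mul_sum I _ (γ k) (fun κ => (γ k κ)⁻¹ * T k κ x ^ 2)
            fun κ _ => ?_).trans (by gcongr; exact hrow k hk)
          rw [← mul_assoc, ENNReal.mul_inv_cancel (hγ0 k κ) (hγt k κ), one_mul]
      _ = B * ∑ κ ∈ I, (γ k κ)⁻¹ * ∑' x, T k κ x ^ 2 := by
          rw [ENNReal.tsum_mul_left, Summable.tsum_finsetSum fun _ _ => ENNReal.summable]
          simp_rw [ENNReal.tsum_mul_left]
      _ ≤ B * ∑ κ ∈ I, (γ k κ)⁻¹ * (c * γ k κ ^ 2 * n κ) := by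
          gcongr with κ hκ; exact hT k hk κ hκ
      _ = B * ∑ κ ∈ I, c * (γ k κ * n κ) := by
          congr 1
          refine Finset.sum_congr rfl fun κ _ => ?_
          calc _ = ((γ k κ)⁻¹ * γ k κ) * (c * (γ k κ * n κ)) := by ring
            _ = _ := by rw [ENNReal.inv_mul_cancel (hγ0 k κ) (hγt k κ), one_mul]
  calc _ ≤ ∑ k ∈ I, B * ∑ κ ∈ I, c * (γ k κ * n κ) := Finset.sum_le_sum h1
    _ = B * (c * ∑ κ ∈ I, n κ * ∑ k ∈ I, γ k κ) := by
        simp only [Finset.mul_sum]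
        rw [Finset.sum_comm]
        exact Finset.sum_congr rfl fun κ _ => Finset.sum_congr rfl fun k _ => by ring
    _ ≤ B * (c * ∑ κ ∈ I, n κ * B) := by gcongr with κ hκ; exact hcol κ hκ
    _ = _ := by rw [← Finset.sum_mul]; ring

/-- The weight in Schur's test: the pieces `κ < k` live on cells of index `κ + 1`. -/
def gap (β : ℕ → ℝ≥0) (k κ : ℕ) : ℝ≥0∞ := if κ < k then β (k - κ - 1) else β (κ - k)

lemma sum_comp_le_of_injOn {β : ℕ → ℝ≥0} {B : ℝ≥0∞} (hB : ∑' l, (β l : ℝ≥0∞) ≤ B)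
    (I : Finset ℕ) (e : ℕ → ℕ) (he : Set.InjOn e I) : ∑ k ∈ I, (β (e k) : ℝ≥0∞) ≤ B := by
  classical
  rw [← Finset.sum_image (f := fun l => (β l : ℝ≥0∞)) he]
  exact (ENNReal.sum_le_tsum _).trans hB

lemma sum_gap_row_le {β : ℕ → ℝ≥0} {B : ℝ≥0∞} (hB : ∑' l, (β l : ℝ≥0∞) ≤ B) (I : Finset ℕ)
    (k : ℕ) : ∑ κ ∈ I, gap β k κ ≤ 2 * B := by
  rw [two_mul]
  simp only [gap]
  rw [Finset.sum_ite]
  refine add_le_add (sum_comp_le_of_injOn hB _ _ ?_) (sum_comp_le_of_injOn hB _ _ ?_)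
  all_goals
    intro a ha b hb hab
    simp only [Finset.coe_filter, Set.mem_ofPred_eq] at ha hb hab
    omega

lemma sum_gap_col_le {β : ℕ → ℝ≥0} {B : ℝ≥0∞} (hB : ∑' l, (β l : ℝ≥0∞) ≤ B) (I : Finset ℕ)
    (κ : ℕ) : ∑ k ∈ I, gap β k κ ≤ 2 * B := by
  rw [two_mul]
  simp only [gap]
  rw [Finset.sum_ite]
  refine add_le_add (sum_comp_le_of_injOn hB _ _ ?_) (sum_comp_le_of_injOn hB _ _ ?_)
  all_goals
    intro a ha b hb hab
    simp only [Finset.coe_filter, Set.mem_ofPred_eq] at ha hb hab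
    omega

/-- The martingale differences of `g` along the cells of side `2 ^ s κ`, for `κ ≤ J`; the last one
is the average over the cells of side `2 ^ s J`. -/
def mdiff (s : ℕ → ℕ) (J : ℕ) (g : Lat d → ℂ) (κ : ℕ) (x : Lat d) : ℂ :=
  if κ < J then cavg (s κ) g x - cavg (s (κ + 1)) g x else cavg (s κ) g x

lemma sum_mdiff (hs0 : s 0 = 0) (J : ℕ) (g : Lat d → ℂ) (x : Lat d) :
    ∑ κ ∈ Finset.range (J + 1), mdiff s J g κ x = g x := by
  have h : ∀ κ ∈ Finset.range J, mdiff s J g κ x = cavg (s κ) g x - cavg (s (κ + 1)) g x :=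
    fun κ hκ => if_pos (Finset.mem_range.1 hκ)
  rw [Finset.sum_range_succ, Finset.sum_congr rfl h, Finset.sum_range_sub',
    mdiff, if_neg (lt_irrefl _), sub_add_cancel, hs0]
  exact cavg_eq_of_const fun y hy => by rw [cell_zero, Finset.mem_singleton] at hy; rw [hy]

lemma sum_tsum_sq_mdiff_le (hmono : Monotone s) (J : ℕ) (g : Lat d → ℂ) :
    ∑ κ ∈ Finset.range (J + 1), ∑' x, ‖mdiff s J g κ x‖ₑ ^ 2 ≤ ∑' x, ‖g x‖ₑ ^ 2 := by
  have h : ∀ κ ∈ Finset.range J, ∑' x, ‖mdiff s J g κ x‖ₑ ^ 2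
      = ∑' x, ‖cavg (s κ) g x - cavg (s (κ + 1)) g x‖ₑ ^ 2 :=
    fun κ hκ => by simp only [mdiff, if_pos (Finset.mem_range.1 hκ)]
  have step : ∀ κ, ∑' x, ‖cavg (s κ) g x - cavg (s (κ + 1)) g x‖ₑ ^ 2
      + ∑' x, ‖cavg (s (κ + 1)) g x‖ₑ ^ 2 = ∑' x, ‖cavg (s κ) g x‖ₑ ^ 2 := by
    intro κ
    have := tsum_sq_cavg_add_tsum_sq_sub (s (κ + 1)) (cavg (s κ) g)
    simp only [cavg_cavg (hmono κ.le_succ)] at this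
    rw [← this, add_comm]
  have tele : ∀ J, ∑ κ ∈ Finset.range J, ∑' x, ‖cavg (s κ) g x - cavg (s (κ + 1)) g x‖ₑ ^ 2
      + ∑' x, ‖cavg (s J) g x‖ₑ ^ 2 = ∑' x, ‖cavg (s 0) g x‖ₑ ^ 2 := by
    intro J
    induction J with
    | zero => simp
    | succ J ih => rw [Finset.sum_range_succ, add_assoc, step, ih]
  rw [Finset.sum_range_succ, Finset.sum_congr rfl h]
  simp only [mdiff, if_neg (lt_irrefl J)]
  rw [tele, ← tsum_sq_cavg_add_tsum_sq_sub (s 0) g]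
  exact le_self_add

lemma pieceConst_ge : (A : ℝ≥0∞) * 2 ^ ((D + 5) * d) ≤ pieceConst d D A := le_self_add

lemma IsPieceSystem.tsum_sq_hull_mdiff_le (hS : IsPieceSystem s D A β S) {J k κ : ℕ}
    (hk : k ≤ J) (g : Lat d → ℂ) :
    ∑' x, hull s D S (mdiff s J g κ) k x ^ 2 ≤
      pieceConst d D A * gap β k κ ^ 2 * ∑' x, ‖mdiff s J g κ x‖ₑ ^ 2 := by
  by_cases h : κ < k
  · have hm : ∀ x, mdiff s J g κ x = cavg (s κ) g x - cavg (s (κ + 1)) g x :=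
      fun x => if_pos (h.trans_le hk)
    have hz : ∀ x, cavg (s (κ + 1)) (mdiff s J g κ) x = 0 := by
      intro x
      rw [funext hm, cavg_sub, cavg_cavg (hS.mono κ.le_succ), cavg_cavg le_rfl, sub_self]
    refine (hS.tsum_sq_hull_smooth_le (show κ + 1 ≤ k from h) hz).trans ?_
    rw [gap, if_pos h, Nat.sub_sub]
    refine mul_le_mul' (mul_le_mul' pieceConst_ge le_rfl) (tsum_sq_eavg_le _ _)
  · rw [gap, if_neg h]
    refine hS.tsum_sq_hull_coarse_le (not_lt.1 h) fun x y hy => ?_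
    simp only [mdiff]
    split_ifs
    · rw [cavg_congr hy, cavg_congr (cell_mono (hS.mono κ.le_succ) hy)]
    · rw [cavg_congr hy]

/-! ### The Calderón–Zygmund decomposition -/

open Classical in
/-- The largest `j ≤ n` such that the average of `φ` over the cell of side `2 ^ j` exceeds `α`,
and `0` if there is none. -/
def stopIdx (n : ℕ) (φ : Lat d → ℝ≥0∞) (α : ℝ≥0∞) (x : Lat d) : ℕ :=
  Nat.findGreatest (fun j => α < eavg j φ x) n

section Stopping

variable {n : ℕ} {φ : Lat d → ℝ≥0∞} {α : ℝ≥0∞}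

lemma stopIdx_le (x : Lat d) : stopIdx n φ α x ≤ n := Nat.findGreatest_le n

lemma stopIdx_congr {x y : Lat d} (h : y ∈ cell (stopIdx n φ α x) x) :
    stopIdx n φ α y = stopIdx n φ α x := by
  classical
  set j := stopIdx n φ α x with hj
  have hav : ∀ i, j ≤ i → eavg i φ y = eavg i φ x := fun i hi => eavg_congr (cell_mono hi h)
  rw [eq_comm, stopIdx, Nat.findGreatest_eq_iff] at hj
  rw [stopIdx, Nat.findGreatest_eq_iff]
  refine ⟨hj.1, fun h0 => ?_, fun i hi hin => ?_⟩
  · rw [hav j le_rfl]; exact hj.2.1 h0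
  · rw [hav i hi.le]; exact hj.2.2 hi hin

lemma lt_eavg_stopIdx {x : Lat d} (h : stopIdx n φ α x ≠ 0) :
    α < eavg (stopIdx n φ α x) φ x := by
  classical
  exact Nat.findGreatest_of_ne_zero (P := fun j => α < eavg j φ x) rfl h

lemma eavg_le_mul_eavg_succ (j : ℕ) (x : Lat d) : eavg j φ x ≤ 2 ^ d * eavg (j + 1) φ x := by
  rw [eavg, eavg, ← mul_assoc, add_mul, one_mul, pow_add,
    ENNReal.mul_inv (by simp) (by simp), mul_comm ((2 : ℝ≥0∞) ^ d), mul_assoc _ _ ((2 : ℝ≥0∞) ^ d),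
    two_pow_inv_mul, mul_one]
  gcongr
  exact cell_subset j.le_succ (self_mem_cell _ x)

lemma eavg_stopIdx_le (hα : ∀ x, eavg n φ x ≤ α) (x : Lat d) :
    eavg (stopIdx n φ α x) φ x ≤ 2 ^ d * α := by
  classical
  rcases (stopIdx_le (n := n) (φ := φ) (α := α) x).eq_or_lt with h | h
  · rw [h]
    calc eavg n φ x ≤ 1 * α := by rw [one_mul]; exact hα x
      _ ≤ _ := by gcongr; exact one_le_pow₀ (by norm_num)
  · refine (eavg_le_mul_eavg_succ _ x).trans ?_
    gcongr
    exact not_lt.1 (Nat.findGreatest_is_greatest (P := fun j => α < eavg j φ x)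
      (Nat.lt_succ_self _) h)

/-- Optional stopping: averages over the stopping cells have the same integral against any function
that is constant on the stopping cells. -/
lemma tsum_mul_eavg_stopIdx {ψ : Lat d → ℝ≥0∞}
    (hψ : ∀ x, ∀ y ∈ cell (stopIdx n φ α x) x, ψ y = ψ x) :
    ∑' x, ψ x * eavg (stopIdx n φ α x) φ x = ∑' x, ψ x * φ x := by
  have split : ∀ θ : ℕ → Lat d → ℝ≥0∞, ∑' x, ψ x * θ (stopIdx n φ α x) x
      = ∑' j, ∑' x, (if stopIdx n φ α x = j then ψ x else 0) * θ j x := by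
    intro θ
    rw [ENNReal.tsum_comm]
    refine tsum_congr fun x => ?_
    rw [tsum_eq_single (stopIdx n φ α x) (fun j hj => by simp [hj.symm])]
    simp
  rw [split fun j => eavg j φ, split fun _ => φ]
  refine tsum_congr fun j => tsum_mul_eavg_of_const fun x y hy => ?_
  by_cases hx : stopIdx n φ α x = j
  · subst hx
    rw [if_pos (stopIdx_congr hy), if_pos rfl, hψ x y hy]
  · have : stopIdx n φ α y ≠ j := by
      intro hyj
      subst hyj
      exact hx (stopIdx_congr (mem_cell_comm.1 hy))
    rw [if_neg this, if_neg hx]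

/-- The good part: `f` is averaged over the stopping cells. -/
def goodPart (n : ℕ) (f : Lat d → ℂ) (α : ℝ≥0∞) (x : Lat d) : ℂ :=
  cavg (stopIdx n (fun y => ‖f y‖ₑ) α x) f x

/-- The contribution to the bad part of the stopping cells with index in `(m, m']`. -/
def badPiece (n : ℕ) (f : Lat d → ℂ) (α : ℝ≥0∞) (m m' : ℕ) (x : Lat d) : ℂ :=
  if m < stopIdx n (fun y => ‖f y‖ₑ) α x ∧ stopIdx n (fun y => ‖f y‖ₑ) α x ≤ m' then
    f x - goodPart n f α x else 0

lemma goodPart_add_sum_badPiece (hs0 : s 0 = 0) (hmono : Monotone s) (J : ℕ) (f : Lat d → ℂ)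
    (x : Lat d) : goodPart (s J) f α x +
      ∑ κ ∈ Finset.range J, badPiece (s J) f α (s κ) (s (κ + 1)) x = f x := by
  set τ := stopIdx (s J) (fun y => ‖f y‖ₑ) α x with hτ
  have h : ∀ (c : ℂ) (J : ℕ), ∑ κ ∈ Finset.range J, (if s κ < τ ∧ τ ≤ s (κ + 1) then c else 0)
      = if 0 < τ ∧ τ ≤ s J then c else 0 := by
    intro c J
    induction J with
    | zero =>
      rw [Finset.sum_range_zero, if_neg]
      omega
    | succ J ih =>
      rw [Finset.sum_range_succ, ih]
      have := hmono J.le_succ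
      rw [← Nat.succ_eq_add_one] at *
      split_ifs <;> first | omega | simp
  simp only [badPiece, ← hτ]
  rw [h]
  have hle : τ ≤ s J := stopIdx_le x
  by_cases h0 : 0 < τ
  · rw [if_pos ⟨h0, hle⟩]; ring
  · have h0' : τ = 0 := by omega
    rw [if_neg (by omega), goodPart, ← hτ, h0', add_zero]
    exact cavg_eq_of_const fun y hy => by rw [cell_zero, Finset.mem_singleton] at hy; rw [hy]

lemma enorm_goodPart_le (f : Lat d → ℂ) (x : Lat d) :
    ‖goodPart n f α x‖ₑ ≤ eavg (stopIdx n (fun y => ‖f y‖ₑ) α x) (fun y => ‖f y‖ₑ) x :=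
  enorm_cavg_le _ _ _

lemma tsum_sq_goodPart_le {f : Lat d → ℂ} (hα : ∀ x, eavg n (fun y => ‖f y‖ₑ) x ≤ α) :
    ∑' x, ‖goodPart n f α x‖ₑ ^ 2 ≤ 2 ^ d * α * ∑' x, ‖f x‖ₑ := by
  calc _ ≤ ∑' x, 2 ^ d * α * (1 * eavg (stopIdx n (fun y => ‖f y‖ₑ) α x) (fun y => ‖f y‖ₑ) x) := by
        refine ENNReal.tsum_le_tsum fun x => ?_
        rw [sq, one_mul]
        exact mul_le_mul' ((enorm_goodPart_le f x).trans (eavg_stopIdx_le hα x))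
          (enorm_goodPart_le f x)
    _ = _ := by
        rw [ENNReal.tsum_mul_left,
          tsum_mul_eavg_stopIdx (φ := fun y => ‖f y‖ₑ) (ψ := fun _ => 1) (fun _ _ _ => rfl)]
        simp

/-- The cells of side `2 ^ m'` are unions of stopping cells of index at most `m'`, apart from points
where the bad piece vanishes. -/
lemma cavg_badPiece (f : Lat d → ℂ) (m m' : ℕ) (x : Lat d) :
    cavg m' (badPiece n f α m m') x = 0 := by
  classical
  set τ := stopIdx n (fun y => ‖f y‖ₑ) α with hτ
  rw [cavg_eq]
  refine mul_eq_zero_of_right _ ?_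
  simp only [badPiece, ← hτ]
  rw [← Finset.sum_filter, Finset.sum_sub_distrib, sub_eq_zero]
  set F := (cell m' x).filter fun y => m < τ y ∧ τ y ≤ m' with hF
  have hmap : ∀ y ∈ F, τ y ∈ Finset.range (m' + 1) := fun y hy => by
    have := (Finset.mem_filter.1 hy).2.2
    exact Finset.mem_range.2 (by omega)
  rw [← Finset.sum_fiberwise_of_maps_to hmap f, ← Finset.sum_fiberwise_of_maps_to hmap]
  refine Finset.sum_congr rfl fun j hj => ?_
  rw [← sum_cavg_of_saturated (j := j)]
  · refine Finset.sum_congr rfl fun y hy => ?_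
    rw [goodPart, ← (Finset.mem_filter.1 hy).2]
  · intro y hy z hz
    obtain ⟨hyF, hyj⟩ := Finset.mem_filter.1 hy
    obtain ⟨hyc, hyτ⟩ := Finset.mem_filter.1 hyF
    have hzτ : τ z = τ y := stopIdx_congr (by rw [← hτ, hyj]; exact hz)
    refine Finset.mem_filter.2 ⟨Finset.mem_filter.2 ⟨?_, ?_⟩, ?_⟩
    · exact cell_subset (by omega) hyc hz
    · rw [hzτ]; exact hyτ
    · rw [hzτ]; exact hyj

lemma enorm_badPiece_le (f : Lat d → ℂ) (m m' : ℕ) (x : Lat d) :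
    ‖badPiece n f α m m' x‖ₑ ≤
      (if m < stopIdx n (fun y => ‖f y‖ₑ) α x ∧ stopIdx n (fun y => ‖f y‖ₑ) α x ≤ m' then 1 else 0)
      * (‖f x‖ₑ + eavg (stopIdx n (fun y => ‖f y‖ₑ) α x) (fun y => ‖f y‖ₑ) x) := by
  rw [badPiece]
  split_ifs
  · rw [one_mul]
    exact (enorm_sub_le).trans (by gcongr; exact enorm_goodPart_le f x)
  · simp

lemma stop_range_const {m m' : ℕ} {x y : Lat d} (h : y ∈ cell (stopIdx n φ α x) x) :
    (if m < stopIdx n φ α y ∧ stopIdx n φ α y ≤ m' then (1 : ℝ≥0∞) else 0)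
      = if m < stopIdx n φ α x ∧ stopIdx n φ α x ≤ m' then 1 else 0 := by
  rw [stopIdx_congr h]

/-- On the cells of side `2 ^ m'` the bad piece has average at most `2 ^ (d + 1) * α`. -/
lemma eavg_badPiece_le {f : Lat d → ℂ} (hα : ∀ x, eavg n (fun y => ‖f y‖ₑ) x ≤ α) (m m' : ℕ)
    (x : Lat d) : eavg m' (fun y => ‖badPiece n f α m m' y‖ₑ) x ≤ 2 ^ (d + 1) * α := by
  set φ : Lat d → ℝ≥0∞ := fun y => ‖f y‖ₑ with hφ
  set τ := stopIdx n φ α with hτ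
  set ψ : Lat d → ℝ≥0∞ := fun y => if m < τ y ∧ τ y ≤ m' then 1 else 0 with hψ
  have hloc : eavg m' (fun y => ψ y * φ y) x = eavg m' (fun y => ψ y * eavg (τ y) φ y) x := by
    simp only [eavg_eq_tsum (j := m'), ENNReal.tsum_mul_left]
    congr 1
    have := tsum_mul_eavg_stopIdx (n := n) (φ := φ) (α := α)
      (ψ := fun y => (if y ∈ cell m' x then 1 else 0) * ψ y) (by
        intro y z hz
        have hψz : ψ z = ψ y := stop_range_const hz
        simp only [hψz]
        by_cases hy : m < τ y ∧ τ y ≤ m'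
        · have : z ∈ cell m' x ↔ y ∈ cell m' x := by
            have hzy : z ∈ cell m' y := cell_mono hy.2 hz
            rw [mem_cell_comm, cell_eq_of_mem hzy, mem_cell_comm]
          simp only [this]
        · simp [hψ, hy])
    simp only [ite_mul, one_mul, zero_mul] at this
    rw [← hτ] at this
    exact this.symm
  calc _ ≤ eavg m' (fun y => ψ y * φ y + ψ y * eavg (τ y) φ y) x :=
        eavg_mono (fun y => by rw [← mul_add]; exact enorm_badPiece_le f m m' y) x
    _ = eavg m' (fun y => ψ y * eavg (τ y) φ y) x + eavg m' (fun y => ψ y * eavg (τ y) φ y) x := by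
        rw [eavg_add, hloc]
    _ ≤ 2 ^ d * α + 2 ^ d * α := by
        have : eavg m' (fun y => ψ y * eavg (τ y) φ y) x ≤ 2 ^ d * α := by
          calc _ ≤ eavg m' (fun _ => 2 ^ d * α) x := by
                refine eavg_mono (fun y => ?_) x
                calc _ ≤ 1 * (2 ^ d * α) := by
                      gcongr
                      · simp only [hψ]; split_ifs <;> simp
                      · exact eavg_stopIdx_le hα y
                  _ = _ := one_mul _
            _ = _ := eavg_eq_of_const (φ := fun _ => 2 ^ d * α) fun _ _ => rfl
        gcongr
    _ = _ := by ring

lemma sum_tsum_enorm_badPiece_le (hmono : Monotone s) (J : ℕ) (f : Lat d → ℂ) :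
    ∑ κ ∈ Finset.range J, ∑' x, ‖badPiece n f α (s κ) (s (κ + 1)) x‖ₑ ≤ 2 * ∑' x, ‖f x‖ₑ := by
  set φ : Lat d → ℝ≥0∞ := fun y => ‖f y‖ₑ with hφ
  set τ := stopIdx n φ α with hτ
  have hone : ∀ x, ∑ κ ∈ Finset.range J, (if s κ < τ x ∧ τ x ≤ s (κ + 1) then (1 : ℝ≥0∞) else 0)
      ≤ 1 := by
    intro x
    by_cases h : ∃ κ ∈ Finset.range J, s κ < τ x ∧ τ x ≤ s (κ + 1)
    · obtain ⟨κ, hκ, h⟩ := h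
      rw [Finset.sum_eq_single_of_mem κ hκ, if_pos h]
      intro l _ hl
      rw [if_neg]
      rintro ⟨h1, h2⟩
      rcases lt_or_gt_of_ne hl with hlt | hlt
      · have := hmono (show l + 1 ≤ κ from hlt); omega
      · have := hmono (show κ + 1 ≤ l from hlt); omega
    · push Not at h
      rw [Finset.sum_eq_zero fun κ hκ => if_neg fun hh => by have := h κ hκ hh.1; omega]
      exact zero_le
  rw [← Summable.tsum_finsetSum fun _ _ => ENNReal.summable]
  calc _ ≤ ∑' x, (φ x + 1 * eavg (τ x) φ x) := by
        refine ENNReal.tsum_le_tsum fun x => ?_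
        refine (Finset.sum_le_sum fun κ _ => enorm_badPiece_le f _ _ x).trans ?_
        rw [← Finset.sum_mul]
        calc _ ≤ 1 * (φ x + eavg (τ x) φ x) := by gcongr; exact hone x
          _ = _ := by simp only [one_mul]
    _ = _ := by
        rw [ENNReal.tsum_add,
          tsum_mul_eavg_stopIdx (φ := φ) (ψ := fun _ => 1) (fun _ _ _ => rfl), two_mul]
        simp

/-- The dilated union of the stopping cells: outside of it, no piece is influenced by a stopping
cell above its own scale. -/
def exceptional (n D : ℕ) (φ : Lat d → ℝ≥0∞) (α : ℝ≥0∞) : Set (Lat d) :=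
  {x | ∃ z, stopIdx n φ α z ≠ 0 ∧ z - x ∈ ball (2 ^ (stopIdx n φ α z + D + 3))}

open Classical in
/-- The exceptional set is small, since the average of `φ` over each stopping cell exceeds `α`. -/
lemma mul_card_exceptional_le (D : ℕ) :
    α * ∑' x, (if x ∈ exceptional n D φ α then 1 else 0) ≤ 2 ^ ((D + 6) * d) * ∑' x, φ x := by
  set τ := stopIdx n φ α with hτ
  set χ : ℕ → Lat d → ℝ≥0∞ := fun j x => if τ x = j then 1 else 0 with hχ
  set I := (Finset.range (n + 1)).erase 0 with hI
  have hpt : ∀ x, (if x ∈ exceptional n D φ α then (1 : ℝ≥0∞) else 0) ≤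
      ∑ j ∈ I, (2 ^ (j * d))⁻¹ * ∑ u ∈ ball (2 ^ (j + (D + 1) + 3)), χ j (x + u) := by
    intro x
    split_ifs with hx
    · obtain ⟨z, hz0, hz⟩ := hx
      have hzI : τ z ∈ I := Finset.mem_erase.2
        ⟨hz0, Finset.mem_range.2 (Nat.lt_succ_of_le (stopIdx_le z))⟩
      refine le_trans ?_ (Finset.single_le_sum
        (f := fun j => (2 ^ (j * d))⁻¹ * ∑ u ∈ ball (2 ^ (j + (D + 1) + 3)), χ j (x + u))
        (fun _ _ => zero_le) hzI)
      have hsub : (cell (τ z) z).image (fun y => y - x) ⊆ ball (2 ^ (τ z + (D + 1) + 3)) := by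
        intro v hv
        obtain ⟨y, hy, rfl⟩ := Finset.mem_image.1 hv
        rw [show y - x = (y - z) + (z - x) by abel]
        refine ball_mono ?_ (add_mem_ball (sub_mem_ball_of_mem_cell hy) hz)
        have : 2 ^ τ z ≤ 2 ^ (τ z + D + 3) := Nat.pow_le_pow_right (by norm_num) (by omega)
        rw [← hτ, show τ z + (D + 1) + 3 = τ z + D + 3 + 1 by omega, pow_succ 2 (τ z + D + 3)]
        omega
      calc (1 : ℝ≥0∞) = (2 ^ (τ z * d))⁻¹ * ∑ y ∈ cell (τ z) z, χ (τ z) y := by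
            rw [Finset.sum_congr rfl (g := fun _ => (1 : ℝ≥0∞)) fun y hy => by
              simp only [hχ]; exact if_pos (stopIdx_congr hy)]
            simp [card_cell, two_pow_inv_mul]
        _ = (2 ^ (τ z * d))⁻¹ * ∑ u ∈ (cell (τ z) z).image (fun y => y - x), χ (τ z) (x + u) := by
            rw [Finset.sum_image (sub_left_injective.injOn)]
            simp
        _ ≤ _ := by
            gcongr
    · exact zero_le
  calc _ ≤ α * ∑' x, ∑ j ∈ I,
        (2 ^ (j * d))⁻¹ * ∑ u ∈ ball (2 ^ (j + (D + 1) + 3)), χ j (x + u) := by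
        gcongr with x; exact hpt x
    _ ≤ α * ∑ j ∈ I, 2 ^ ((D + 6) * d) * ∑' x, χ j x := by
        rw [Summable.tsum_finsetSum fun _ _ => ENNReal.summable]
        gcongr with j hj
        exact tsum_window_average_le j (D + 1) (χ j)
    _ = 2 ^ ((D + 6) * d) * ∑ j ∈ I, ∑' x, χ j x * α := by
        have e : ∀ j, ∑' x, χ j x * α = (∑' x, χ j x) * α := fun j => ENNReal.tsum_mul_right
        simp only [e]
        rw [← Finset.mul_sum, ← Finset.sum_mul]; ring
    _ ≤ 2 ^ ((D + 6) * d) * ∑ j ∈ I, ∑' x, χ j x * eavg (τ x) φ x := by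
        refine mul_le_mul' le_rfl (Finset.sum_le_sum fun j hj => ENNReal.tsum_le_tsum fun x => ?_)
        simp only [hχ]
        split_ifs with h
        · have : τ x ≠ 0 := by rw [h]; exact (Finset.mem_erase.1 hj).1
          rw [one_mul, one_mul]
          exact (lt_eavg_stopIdx this).le
        · simp
    _ = 2 ^ ((D + 6) * d) * ∑' x, (∑ j ∈ I, χ j x) * φ x := by
        congr 1
        simp_rw [Finset.sum_mul]
        rw [Summable.tsum_finsetSum fun _ _ => ENNReal.summable]
        refine Finset.sum_congr rfl fun j _ => tsum_mul_eavg_stopIdx fun x y hy => ?_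
        simp only [hχ, hτ, stopIdx_congr hy]
    _ ≤ 2 ^ ((D + 6) * d) * ∑' x, 1 * φ x := by
        gcongr with x
        simp only [hχ]
        rw [Finset.sum_ite_eq]
        split_ifs <;> simp
    _ = _ := by simp

lemma badPiece_eq_zero_of_notMem {f : Lat d → ℂ} {x u : Lat d} {m m' : ℕ}
    (hx : x ∉ exceptional n D (fun y => ‖f y‖ₑ) α) {j : ℕ} (hj : j ≤ m)
    (hu : u ∈ ball (2 ^ (j + D + 3))) : badPiece n f α m m' (x + u) = 0 := by
  rw [badPiece, if_neg]
  rintro ⟨h1, -⟩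
  refine hx ⟨x + u, by omega, ?_⟩
  rw [add_sub_cancel_left]
  exact ball_mono (Nat.pow_le_pow_right (by norm_num) (by omega)) hu

end Stopping

/-! ### The weak-type estimate -/

/-- The constant in the weak-type estimate. -/
def weakConst (d D : ℕ) (A : ℝ≥0) (B : ℝ≥0∞) : ℝ≥0∞ :=
  2 ^ ((D + 6) * d) + 8 * pieceConst d D A * B ^ 2 * (2 ^ d + 2 * 2 ^ (d + 1))

open Classical in
/-- The square function of the pieces of index `k ≤ J` is of weak type `(1, 1)`, at heights that
dominate the averages of `f` at the top scale. -/
theorem IsPieceSystem.weak_type (hS : IsPieceSystem s D A β S) (hβ : ∀ l, β l ≠ 0) {B : ℝ≥0∞}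
    (hB : ∑' l, (β l : ℝ≥0∞) ≤ B) (J : ℕ) (f : Lat d → ℂ) {α : ℝ≥0∞} (hα0 : α ≠ 0) (hαt : α ≠ ⊤)
    (hα : ∀ x, eavg (s J) (fun y => ‖f y‖ₑ) x ≤ α) :
    α * ∑' x, (if α ^ 2 < ∑ k ∈ Finset.range (J + 1), hull s D S f k x ^ 2 then 1 else 0)
      ≤ weakConst d D A B * ∑' x, ‖f x‖ₑ := by
  set n := s J with hn
  set Ω := exceptional n D (fun y => ‖f y‖ₑ) α with hΩ
  set I := Finset.range (J + 1) with hI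
  set g := goodPart n f α with hg
  set h : ℕ → Lat d → ℂ := fun κ => badPiece n f α (s κ) (s (κ + 1)) with hh
  set T : ℕ → ℕ → Lat d → ℝ≥0∞ := fun k κ x =>
    hull s D S (mdiff s J g κ) k x + (if κ < k then hull s D S (h κ) k x else 0) with hT
  set N : ℕ → ℝ≥0∞ := fun κ => ∑' x, ‖mdiff s J g κ x‖ₑ ^ 2 +
    (if κ < J then ∑' x, eavg (s (κ + 1)) (fun y => ‖h κ y‖ₑ) x ^ 2 else 0) with hN
  -- Outside the exceptional set only the bad pieces below the scale of the hull are visible.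
  have hdec : ∀ k ∈ I, ∀ x ∉ Ω, hull s D S f k x ≤ ∑ κ ∈ I, T k κ x := by
    intro k hk x hx
    have hkJ : k ≤ J := Nat.lt_succ_iff.1 (Finset.mem_range.1 hk)
    have e : f = fun y => (∑ κ ∈ I, mdiff s J g κ y) + ∑ κ ∈ Finset.range J, h κ y :=
      funext fun y => by
        rw [sum_mdiff hS.zero]; exact (goodPart_add_sum_badPiece hS.zero hS.mono J f y).symm
    calc hull s D S f k x
        = hull s D S (fun y => (∑ κ ∈ I, mdiff s J g κ y) + ∑ κ ∈ Finset.range J, h κ y) k x :=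
          congrArg (fun F => hull s D S F k x) e
      _ ≤ ∑ κ ∈ I, hull s D S (mdiff s J g κ) k x
          + ∑ κ ∈ Finset.range J, hull s D S (h κ) k x :=
          (hS.hull_add _ _ k x).trans (add_le_add (hS.hull_sum _ _ k x) (hS.hull_sum _ _ k x))
      _ ≤ ∑ κ ∈ I, hull s D S (mdiff s J g κ) k x
          + ∑ κ ∈ I, (if κ < k then hull s D S (h κ) k x else 0) := by
          gcongr
          calc _ ≤ ∑ κ ∈ Finset.range J, (if κ < k then hull s D S (h κ) k x else 0) := by
                refine Finset.sum_le_sum fun κ _ => ?_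
                split_ifs with hκ
                · exact le_rfl
                · refine (hS.hull_const _ k x fun u hu => ?_).le
                  have hm : s k ≤ s κ := hS.mono (not_lt.1 hκ)
                  have h0 := badPiece_eq_zero_of_notMem (m' := s (κ + 1)) hx hm
                    (zero_mem_ball (d := d) (2 ^ (s k + D + 3)))
                  rw [add_zero] at h0
                  exact (badPiece_eq_zero_of_notMem hx hm hu).trans h0.symm
            _ ≤ _ := Finset.sum_le_sum_of_subset (Finset.range_subset_range.2 (by omega))
      _ = _ := by rw [← Finset.sum_add_distrib]
  -- Martingale differences and visible bad pieces obey the same off-diagonal decay. The bad pieces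
  -- have mean zero over cells of side `2 ^ s (κ + 1)`, where their averages are bounded by `α`, so
  -- that the square of their averages sums to at most `α` times the mass.
  have hTN : ∀ k ∈ I, ∀ κ ∈ I,
      ∑' x, T k κ x ^ 2 ≤ 2 * pieceConst d D A * gap β k κ ^ 2 * N κ := by
    intro k hk κ hκ
    have hkJ : k ≤ J := Nat.lt_succ_iff.1 (Finset.mem_range.1 hk)
    calc ∑' x, T k κ x ^ 2
        ≤ ∑' x, 2 * (hull s D S (mdiff s J g κ) k x ^ 2 +
            (if κ < k then hull s D S (h κ) k x else 0) ^ 2) :=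
          ENNReal.tsum_le_tsum fun x => sq_add_le_two_mul _ _
      _ = 2 * (∑' x, hull s D S (mdiff s J g κ) k x ^ 2 +
            ∑' x, (if κ < k then hull s D S (h κ) k x else 0) ^ 2) := by
          rw [ENNReal.tsum_mul_left, ENNReal.tsum_add]
      _ ≤ 2 * (pieceConst d D A * gap β k κ ^ 2 * ∑' x, ‖mdiff s J g κ x‖ₑ ^ 2 +
            pieceConst d D A * gap β k κ ^ 2 * (if κ < J then
              ∑' x, eavg (s (κ + 1)) (fun y => ‖h κ y‖ₑ) x ^ 2 else 0)) := by
          gcongr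
          · exact hS.tsum_sq_hull_mdiff_le hkJ g
          · by_cases hlt : κ < k
            · simp only [if_pos hlt, if_pos (hlt.trans_le hkJ)]
              refine (hS.tsum_sq_hull_smooth_le (show κ + 1 ≤ k from hlt)
                (cavg_badPiece f _ _)).trans ?_
              rw [gap, if_pos hlt, Nat.sub_sub]
              gcongr
              exact pieceConst_ge
            · simp [if_neg hlt]
      _ = _ := by rw [← mul_add]; ring
  have hNsum : ∑ κ ∈ I, N κ ≤ (2 ^ d + 2 * 2 ^ (d + 1)) * α * ∑' x, ‖f x‖ₑ := by
    have h1 : ∑ κ ∈ I, ∑' x, ‖mdiff s J g κ x‖ₑ ^ 2 ≤ 2 ^ d * α * ∑' x, ‖f x‖ₑ :=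
      (sum_tsum_sq_mdiff_le hS.mono J g).trans (tsum_sq_goodPart_le hα)
    have h2 : ∑ κ ∈ I, (if κ < J then ∑' x, eavg (s (κ + 1)) (fun y => ‖h κ y‖ₑ) x ^ 2 else 0)
        ≤ 2 ^ (d + 1) * α * (2 * ∑' x, ‖f x‖ₑ) := by
      rw [hI, Finset.sum_range_succ, if_neg (lt_irrefl J), add_zero]
      calc _ ≤ ∑ κ ∈ Finset.range J, 2 ^ (d + 1) * α * ∑' x, ‖h κ x‖ₑ := by
            refine Finset.sum_le_sum fun κ hκ => ?_
            rw [if_pos (Finset.mem_range.1 hκ), ← tsum_eavg (s (κ + 1)) fun x => ‖h κ x‖ₑ,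
              ← ENNReal.tsum_mul_left]
            refine ENNReal.tsum_le_tsum fun x => ?_
            rw [sq]
            gcongr
            exact eavg_badPiece_le hα _ _ x
        _ ≤ _ := by
            rw [← Finset.mul_sum]
            gcongr
            exact sum_tsum_enorm_badPiece_le hS.mono J f
    calc _ ≤ 2 ^ d * α * ∑' x, ‖f x‖ₑ + 2 ^ (d + 1) * α * (2 * ∑' x, ‖f x‖ₑ) := by
          simp only [hN]
          rw [Finset.sum_add_distrib]
          exact add_le_add h1 h2
      _ = _ := by ring
  have hL2 : ∑ k ∈ I, ∑' x, (∑ κ ∈ I, T k κ x) ^ 2 ≤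
      2 * pieceConst d D A * (2 * B) ^ 2 * ∑ κ ∈ I, N κ := by
    refine tsum_sq_sum_le_of_schur (γ := gap β) (fun k κ => ?_) (fun k κ => ?_) hTN
      (fun k _ => sum_gap_row_le hB I k) (fun κ _ => sum_gap_col_le hB I κ)
    · unfold gap; split_ifs <;> exact_mod_cast hβ _
    · unfold gap; split_ifs <;> exact ENNReal.coe_ne_top
  -- Chebyshev's inequality outside the exceptional set.
  have hcheb : α * (α * ∑' x, (if x ∉ Ω ∧ α ^ 2 < ∑ k ∈ I, hull s D S f k x ^ 2 then 1 else 0)) ≤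
      α * (8 * pieceConst d D A * B ^ 2 * (2 ^ d + 2 * 2 ^ (d + 1)) * ∑' x, ‖f x‖ₑ) := by
    calc _ = ∑' x, α ^ 2 *
          (if x ∉ Ω ∧ α ^ 2 < ∑ k ∈ I, hull s D S f k x ^ 2 then 1 else 0) := by
          rw [ENNReal.tsum_mul_left]; ring
      _ ≤ ∑' x, ∑ k ∈ I, (∑ κ ∈ I, T k κ x) ^ 2 := by
          refine ENNReal.tsum_le_tsum fun x => ?_
          split_ifs with hx
          · rw [mul_one]
            exact hx.2.le.trans (Finset.sum_le_sum fun k hk => by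
              gcongr; exact hdec k hk x hx.1)
          · simp
      _ ≤ 2 * pieceConst d D A * (2 * B) ^ 2 * ∑ κ ∈ I, N κ := by
          rw [Summable.tsum_finsetSum fun _ _ => ENNReal.summable]; exact hL2
      _ ≤ 2 * pieceConst d D A * (2 * B) ^ 2 *
            ((2 ^ d + 2 * 2 ^ (d + 1)) * α * ∑' x, ‖f x‖ₑ) := by gcongr
      _ = _ := by ring
  rw [ENNReal.mul_le_mul_iff_right hα0 hαt] at hcheb
  calc _ ≤ α * ∑' x, ((if x ∈ Ω then 1 else 0) +
        (if x ∉ Ω ∧ α ^ 2 < ∑ k ∈ I, hull s D S f k x ^ 2 then 1 else 0)) := by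
        gcongr with x
        by_cases hx : x ∈ Ω
        · simp only [hx, if_true, not_true, false_and, if_false, add_zero]
          split_ifs <;> simp
        · simp [hx]
    _ ≤ 2 ^ ((D + 6) * d) * ∑' x, ‖f x‖ₑ +
        8 * pieceConst d D A * B ^ 2 * (2 ^ d + 2 * 2 ^ (d + 1)) * ∑' x, ‖f x‖ₑ := by
        rw [ENNReal.tsum_add, mul_add]
        exact add_le_add (mul_card_exceptional_le D) hcheb
    _ = _ := by rw [weakConst]; ring

/-! ### The weighted good-`λ` inequality -/

lemma cell_eq_cube (j : ℕ) (x : Lat d) : cell j x = cube (corner j x) (2 ^ j - 1) := by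
  ext y
  rw [cell, atom, cube, Fintype.mem_piFinset, Finset.mem_Icc, Pi.le_def, Pi.le_def, ← forall_and]
  refine forall_congr' fun i => ?_
  have h1 : 1 ≤ 2 ^ j := Nat.one_le_two_pow
  simp only [Finset.mem_Ico, atomIndex, corner]
  push_cast [h1]
  rw [mul_add, mul_one]
  constructor <;> rintro ⟨h2, h3⟩ <;> constructor <;> linarith

lemma le_maxHL (f : Lat d → ℂ) {x y : Lat d} {n : ℕ} (h : x ∈ cube y n) :
    (∑ m ∈ cube y n, ‖f m‖ₑ) / ((cube y n).card : ℝ≥0∞) ≤ maxHL f x :=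
  le_iSup_of_le y (le_iSup_of_le n (le_iSup_of_le h le_rfl))

lemma sum_cell_le_mul_maxHL (f : Lat d → ℂ) (j : ℕ) {x y : Lat d} (hy : y ∈ cell j x) :
    ∑ m ∈ cell j x, ‖f m‖ₑ ≤ maxHL f y * 2 ^ (j * d) := by
  have hy' := hy
  rw [cell_eq_cube] at hy'
  have h := le_maxHL f hy'
  rw [← cell_eq_cube, card_cell] at h
  push_cast at h
  rwa [ENNReal.div_le_iff (by simp) (by simp)] at h

/-- An `A_p` weight charges every subset of a cell whose complement in the cell is small: removing
at most half of the cell loses at most a fixed proportion of its weight. -/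
lemma IsApWeight.sum_le_of_card_le {p : ℝ} (hp : 0 < p) {N : ℝ≥0} {w : Lat d → ℝ≥0}
    (hw : IsApWeight p N w) (j : ℕ) (x : Lat d) {G : Finset (Lat d)} (hG : G ⊆ cell j x)
    (hcard : 2 * (G.card : ℝ≥0∞) ≤ 2 ^ (j * d)) :
    ((2 * (N : ℝ≥0∞)) ^ p + 1) * ∑ y ∈ G, (w y : ℝ≥0∞)
      ≤ (2 * (N : ℝ≥0∞)) ^ p * ∑ y ∈ cell j x, (w y : ℝ≥0∞) := by
  classical
  set Q := cell j x with hQ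
  set f : Lat d → ℂ := fun y => if y ∈ Q \ G then 1 else 0 with hf
  -- The indicator of `Q \ G` has average at least one half over `Q`.
  have hhalf : ∀ y ∈ Q, (2 : ℝ≥0∞)⁻¹ ≤ maxHL f y := by
    intro y hy
    have h1 := sum_cell_le_mul_maxHL f j hy
    have h2 : ∑ m ∈ Q, ‖f m‖ₑ = ((Q \ G).card : ℝ≥0∞) := by
      have : ∀ m ∈ Q, ‖f m‖ₑ = if m ∈ Q \ G then 1 else 0 := fun m _ => by
        simp only [hf]; split_ifs <;> simp
      rw [Finset.sum_congr rfl this, Finset.sum_boole, Finset.filter_mem_eq_inter,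
        Finset.inter_eq_right.2 Finset.sdiff_subset]
    rw [← hQ, h2] at h1
    have h3 : 2 ^ (j * d) ≤ 2 * (Q \ G).card := by
      have hc : 2 * G.card ≤ 2 ^ (j * d) := by exact_mod_cast hcard
      have := Finset.card_sdiff_add_card_eq_card hG
      rw [hQ, card_cell, ← hQ] at this
      omega
    have h4 : (2 : ℝ≥0∞) ^ (j * d) ≤ 2 * (maxHL f y * 2 ^ (j * d)) := by
      calc (2 : ℝ≥0∞) ^ (j * d) ≤ 2 * ((Q \ G).card : ℝ≥0∞) := by exact_mod_cast h3
        _ ≤ _ := by gcongr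
    rw [← mul_assoc] at h4
    have h5 : 1 ≤ 2 * maxHL f y := by
      rw [← ENNReal.mul_le_mul_iff_left (c := 2 ^ (j * d)) (by simp) (by simp), one_mul]
      exact h4
    rw [ENNReal.inv_le_iff_le_mul (by simp) (by simp)]
    exact h5
  have hb := hw.bound f
  have hR : ∑' n, ‖f n‖ₑ ^ p * (w n : ℝ≥0∞) = ∑ y ∈ Q \ G, (w y : ℝ≥0∞) := by
    rw [tsum_eq_sum (s := Q \ G) fun y hy => by
      simp only [hf, if_neg hy, enorm_zero, ENNReal.zero_rpow_of_pos hp, zero_mul]]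
    exact Finset.sum_congr rfl fun y hy => by simp only [hf, if_pos hy]; simp
  have hL : (2 : ℝ≥0∞)⁻¹ ^ p * ∑ y ∈ Q, (w y : ℝ≥0∞) ≤ ∑' n, maxHL f n ^ p * (w n : ℝ≥0∞) := by
    rw [Finset.mul_sum]
    refine le_trans (Finset.sum_le_sum fun y hy => ?_) (ENNReal.sum_le_tsum Q)
    gcongr
    exact hhalf y hy
  have key : ∑ y ∈ Q, (w y : ℝ≥0∞) ≤ (2 * (N : ℝ≥0∞)) ^ p * ∑ y ∈ Q \ G, (w y : ℝ≥0∞) := by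
    calc ∑ y ∈ Q, (w y : ℝ≥0∞) = 2 ^ p * ((2 : ℝ≥0∞)⁻¹ ^ p * ∑ y ∈ Q, (w y : ℝ≥0∞)) := by
          rw [← mul_assoc, ← ENNReal.mul_rpow_of_nonneg _ _ hp.le,
            ENNReal.mul_inv_cancel (by simp) (by simp), ENNReal.one_rpow, one_mul]
      _ ≤ 2 ^ p * ((N : ℝ≥0∞) ^ p * ∑ y ∈ Q \ G, (w y : ℝ≥0∞)) := by
          rw [← hR]; exact mul_le_mul_right (hL.trans hb) _
      _ = _ := by rw [ENNReal.mul_rpow_of_nonneg _ _ hp.le]; ring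
  rw [← Finset.sum_sdiff hG] at key ⊢
  rw [add_mul, one_mul, mul_add, add_comm]
  gcongr
  exact le_add_self.trans key

lemma sum_window_le_mul_maxHL (f : Lat d → ℂ) (x : Lat d) (n D : ℕ) :
    ∑ u ∈ ball (2 ^ (n + D + 4)), ‖f (x + u)‖ₑ ≤ maxHL f x * (2 ^ ((D + 6) * d) * 2 ^ (n * d)) := by
  classical
  set R := 2 ^ (n + D + 4) with hR
  set Q := cube (fun i => x i - R) (2 * R) with hQ
  have hmem : ∀ y, y ∈ Q ↔ y - x ∈ ball R := by
    intro y
    rw [hQ, cube, Finset.mem_Icc, Pi.le_def, Pi.le_def, ← forall_and, mem_ball]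
    refine forall_congr' fun i => ?_
    rw [abs_le, Pi.sub_apply]
    push_cast
    constructor <;> rintro ⟨h2, h3⟩ <;> constructor <;> linarith
  have himg : (ball R).image (fun u => x + u) = Q := by
    ext y
    rw [hmem, Finset.mem_image]
    exact ⟨by rintro ⟨u, hu, rfl⟩; simpa using hu, fun h => ⟨_, h, by abel⟩⟩
  have hcard : (Q.card : ℝ≥0∞) ≤ 2 ^ ((D + 6) * d) * 2 ^ (n * d) := by
    rw [← himg, Finset.card_image_of_injective _ (add_right_injective x), ← pow_add, ← add_mul]
    apply card_ball_le
    have h1 : 1 ≤ R := Nat.one_le_two_pow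
    rw [show D + 6 + n = n + D + 4 + 2 by omega, pow_add 2 (n + D + 4) 2, ← hR]; omega
  have h := le_maxHL f ((hmem x).2 (by rw [sub_self]; exact zero_mem_ball R))
  have hQ0 : (Q.card : ℝ≥0∞) ≠ 0 := by
    simp only [ne_eq, Nat.cast_eq_zero, Finset.card_eq_zero]
    exact Finset.ne_empty_of_mem ((hmem x).2 (by rw [sub_self]; exact zero_mem_ball R))
  rw [ENNReal.div_le_iff hQ0 (by simp)] at h
  calc _ = ∑ m ∈ Q, ‖f m‖ₑ := by
        rw [← himg, Finset.sum_image (add_right_injective x).injOn]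
    _ ≤ maxHL f x * Q.card := h
    _ ≤ _ := by gcongr

/-- The square function of the pieces with index in `[m, J]`, squared. -/
def tailSq (s : ℕ → ℕ) (D : ℕ) (S : (Lat d → ℂ) → ℕ → Lat d → ℝ≥0∞) (J : ℕ) (f : Lat d → ℂ)
    (m : ℕ) (x : Lat d) : ℝ≥0∞ :=
  ∑ k ∈ Finset.Ico m (J + 1), hull s D S f k x ^ 2

lemma tailSq_congr (hs : Monotone s) {J m : ℕ} {f : Lat d → ℂ} {x y : Lat d}
    (h : y ∈ cell (s m) x) : tailSq s D S J f m y = tailSq s D S J f m x :=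
  Finset.sum_congr rfl fun _ hk => by
    rw [hull_congr (cell_mono (hs (Finset.mem_Ico.1 hk).1) h)]

lemma tailSq_anti {J m m' : ℕ} (h : m ≤ m') (f : Lat d → ℂ) (x : Lat d) :
    tailSq s D S J f m' x ≤ tailSq s D S J f m x :=
  Finset.sum_le_sum_of_subset (Finset.Ico_subset_Ico_left h)

/-- In a cell `Q` on which the pieces above the scale of `Q` are not yet large, the full square
function is large on at most half of the points if the maximal function is small at a point of
`Q`: localize `f` to a dilate of `Q` and use the weak-type estimate. -/
lemma IsPieceSystem.card_large_le (hS : IsPieceSystem s D A β S) (hβ : ∀ l, β l ≠ 0) {B : ℝ≥0∞}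
    (hB : ∑' l, (β l : ℝ≥0∞) ≤ B) {J m : ℕ} (hm : m ≤ J) (f : Lat d → ℂ)
    {lam σ ρ γ : ℝ≥0∞} (hl0 : lam ≠ 0) (hlt : lam ≠ ⊤) (hσ0 : σ ≠ 0) (hσt : σ ≠ ⊤)
    (hρ : ρ ^ 2 = 1 + σ ^ 2)
    (hγ : γ * 2 ^ ((D + 6) * d) * (1 + 2 * weakConst d D A B) ≤ σ) (x : Lat d)
    (hx : tailSq s D S J f (m + 1) x ≤ lam ^ 2) {G : Finset (Lat d)} (hG : G ⊆ cell (s m) x)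
    (hGl : ∀ y ∈ G, (ρ * lam) ^ 2 < tailSq s D S J f 0 y ∧ maxHL f y ≤ γ * lam) :
    2 * (G.card : ℝ≥0∞) ≤ 2 ^ (s m * d) := by
  classical
  rcases G.eq_empty_or_nonempty with rfl | ⟨x₀, hx₀⟩
  · simp
  set R := 2 ^ (s m + D + 4) with hR
  set f' : Lat d → ℂ := fun z => if z - x₀ ∈ ball R then f z else 0 with hf'
  -- The window around `x₀ ∈ G` lies in a cube comparable to `Q` on which the maximal function at `x₀`
  -- controls the mass of `f`.
  have hmass : ∑' z, ‖f' z‖ₑ ≤ γ * lam * (2 ^ ((D + 6) * d) * 2 ^ (s m * d)) := by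
    have : ∑' z, ‖f' z‖ₑ = ∑ u ∈ ball R, ‖f (x₀ + u)‖ₑ := by
      rw [← (Equiv.addLeft x₀).tsum_eq fun z => ‖f' z‖ₑ, tsum_eq_sum (s := ball R)]
      · exact Finset.sum_congr rfl fun u hu => by simp [hf', hu]
      · intro u hu; simp [hf', hu]
    rw [this]
    refine (sum_window_le_mul_maxHL f x₀ (s m) D).trans ?_
    gcongr
    exact (hGl x₀ hx₀).2
  have hσl : σ * lam ≠ 0 := mul_ne_zero hσ0 hl0
  have hσlt : σ * lam ≠ ⊤ := ENNReal.mul_ne_top hσt hlt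
  have hav : ∀ z, eavg (s m) (fun y => ‖f' y‖ₑ) z ≤ σ * lam := by
    intro z
    calc eavg (s m) (fun y => ‖f' y‖ₑ) z
        ≤ (2 ^ (s m * d))⁻¹ * (γ * lam * (2 ^ ((D + 6) * d) * 2 ^ (s m * d))) := by
          rw [eavg]; gcongr; exact (ENNReal.sum_le_tsum _).trans hmass
      _ = ((2 ^ (s m * d))⁻¹ * 2 ^ (s m * d)) * (γ * 2 ^ ((D + 6) * d) * 1 * lam) := by ring
      _ ≤ 1 * (γ * 2 ^ ((D + 6) * d) * (1 + 2 * weakConst d D A B) * lam) := by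
          rw [two_pow_inv_mul]; gcongr; exact le_self_add
      _ ≤ _ := by rw [one_mul]; gcongr
  have hwk := hS.weak_type hβ hB m f' hσl hσlt hav
  -- The tail above `m` contributes at most `lam ^ 2` on `Q`, so the excess comes from the pieces of
  -- index at most `m`, which see only `f'`.
  have hlarge : ∀ y ∈ G,
      (σ * lam) ^ 2 < ∑ k ∈ Finset.range (m + 1), hull s D S f' k y ^ 2 := by
    intro y hy
    have h1 : tailSq s D S J f 0 y = ∑ k ∈ Finset.range (m + 1), hull s D S f k y ^ 2
        + tailSq s D S J f (m + 1) y := by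
      rw [tailSq, tailSq, Finset.range_eq_Ico,
        Finset.sum_Ico_consecutive _ (Nat.zero_le _) (by omega)]
    have h2 : tailSq s D S J f (m + 1) y ≤ lam ^ 2 := by
      rwa [tailSq_congr hS.mono (cell_mono (hS.mono m.le_succ) (hG hy))]
    have h3 : ∑ k ∈ Finset.range (m + 1), hull s D S f k y ^ 2
        = ∑ k ∈ Finset.range (m + 1), hull s D S f' k y ^ 2 := by
      refine Finset.sum_congr rfl fun k hk => ?_
      have hkm : s k ≤ s m := hS.mono (Nat.lt_succ_iff.1 (Finset.mem_range.1 hk))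
      rw [hS.hull_local (f := f) (g := f')]
      intro u hu
      have hmem : y + u - x₀ ∈ ball R := by
        rw [show y + u - x₀ = (y - x₀) + u by abel]
        have hyx : y ∈ cell (s m) x₀ := by
          rw [cell_eq_of_mem (hG hx₀)]; exact hG hy
        refine ball_mono ?_ (add_mem_ball (sub_mem_ball_of_mem_cell hyx) hu)
        have e1 : 2 ^ s m ≤ 2 ^ (s m + D + 3) := Nat.pow_le_pow_right (by norm_num) (by omega)
        have e2 : 2 ^ (s k + D + 3) ≤ 2 ^ (s m + D + 3) :=
          Nat.pow_le_pow_right (by norm_num) (by omega)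
        rw [hR, show s m + D + 4 = s m + D + 3 + 1 by omega, pow_succ 2 (s m + D + 3)]; omega
      simp [hf', hmem]
    by_contra hcon
    refine absurd (hGl y hy).1 (not_lt.2 ?_)
    rw [h1, h3]
    calc _ ≤ (σ * lam) ^ 2 + lam ^ 2 := add_le_add (not_lt.1 hcon) h2
      _ = (1 + σ ^ 2) * lam ^ 2 := by ring
      _ = _ := by rw [← hρ]; ring
  have hcount : (G.card : ℝ≥0∞) ≤ ∑' y,
      (if (σ * lam) ^ 2 < ∑ k ∈ Finset.range (m + 1), hull s D S f' k y ^ 2 then 1 else 0) := by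
    calc (G.card : ℝ≥0∞) = ∑ y ∈ G, 1 := by simp
      _ = ∑ y ∈ G, (if (σ * lam) ^ 2 <
            ∑ k ∈ Finset.range (m + 1), hull s D S f' k y ^ 2 then 1 else 0) :=
          Finset.sum_congr rfl fun y hy => by rw [if_pos (hlarge y hy)]
      _ ≤ _ := ENNReal.sum_le_tsum G
  rw [← ENNReal.mul_le_mul_iff_right hσl hσlt]
  calc σ * lam * (2 * (G.card : ℝ≥0∞)) = 2 * (σ * lam * (G.card : ℝ≥0∞)) := by ring
    _ ≤ 2 * (weakConst d D A B * (γ * lam * (2 ^ ((D + 6) * d) * 2 ^ (s m * d)))) := by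
        exact mul_le_mul_right (((mul_le_mul_right hcount _).trans hwk).trans
          (mul_le_mul_right hmass _)) _
    _ = γ * 2 ^ ((D + 6) * d) * (2 * weakConst d D A B) * (lam * 2 ^ (s m * d)) := by ring
    _ ≤ γ * 2 ^ ((D + 6) * d) * (1 + 2 * weakConst d D A B) * (lam * 2 ^ (s m * d)) := by
        gcongr; exact le_add_self
    _ ≤ σ * (lam * 2 ^ (s m * d)) := by gcongr
    _ = _ := by ring

open Classical in
/-- The good-`λ` inequality. The set where the square function exceeds `lam` is cut according to the
last index whose tail exceeds `lam`; each part is a union of cells of the corresponding side, and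
on each of these cells the count `card_large_le` becomes a weighted estimate by the `A_p`
condition. -/
lemma IsPieceSystem.good_lambda (hS : IsPieceSystem s D A β S) (hβ : ∀ l, β l ≠ 0) {B : ℝ≥0∞}
    (hB : ∑' l, (β l : ℝ≥0∞) ≤ B) {p : ℝ} (hp : 0 < p) {N : ℝ≥0} {w : Lat d → ℝ≥0}
    (hw : IsApWeight p N w) (J : ℕ) (f : Lat d → ℂ)
    {lam σ ρ γ : ℝ≥0∞} (hl0 : lam ≠ 0) (hlt : lam ≠ ⊤) (hσ0 : σ ≠ 0) (hσt : σ ≠ ⊤)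
    (hρ : ρ ^ 2 = 1 + σ ^ 2)
    (hγ : γ * 2 ^ ((D + 6) * d) * (1 + 2 * weakConst d D A B) ≤ σ) :
    ((2 * (N : ℝ≥0∞)) ^ p + 1) * ∑' x, (if (ρ * lam) ^ 2 < tailSq s D S J f 0 x ∧
        maxHL f x ≤ γ * lam then (w x : ℝ≥0∞) else 0)
      ≤ (2 * (N : ℝ≥0∞)) ^ p *
        ∑' x, (if lam ^ 2 < tailSq s D S J f 0 x then (w x : ℝ≥0∞) else 0) := by
  set a : Lat d → ℝ≥0∞ := fun x => if (ρ * lam) ^ 2 < tailSq s D S J f 0 x ∧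
        maxHL f x ≤ γ * lam then (w x : ℝ≥0∞) else 0 with ha
  set b : Lat d → ℝ≥0∞ := fun x => if lam ^ 2 < tailSq s D S J f 0 x then (w x : ℝ≥0∞) else 0
    with hb
  -- The largest index from which on the tail of the square function exceeds `lam`.
  set M : Lat d → ℕ := fun x => Nat.findGreatest (fun m => lam ^ 2 < tailSq s D S J f m x) J
    with hM
  set χ : ℕ → Lat d → ℝ≥0∞ := fun m x =>
    if lam ^ 2 < tailSq s D S J f m x ∧ tailSq s D S J f (m + 1) x ≤ lam ^ 2 then 1 else 0 with hχ
  set I := Finset.range (J + 1) with hI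
  have hχM : ∀ x, lam ^ 2 < tailSq s D S J f 0 x → χ (M x) x = 1 := by
    intro x hx
    have h1 : lam ^ 2 < tailSq s D S J f (M x) x :=
      Nat.findGreatest_spec (P := fun m => lam ^ 2 < tailSq s D S J f m x) (Nat.zero_le J) hx
    have h2 : tailSq s D S J f (M x + 1) x ≤ lam ^ 2 := by
      by_cases h : M x + 1 ≤ J
      · exact not_lt.1 (Nat.findGreatest_is_greatest
          (P := fun m => lam ^ 2 < tailSq s D S J f m x) (Nat.lt_succ_self _) h)
      · rw [tailSq, Finset.Ico_eq_empty (by omega)]; simp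
    simp only [hχ, h1, h2, and_self, if_true]
  have hχle : ∀ x, ∑ m ∈ I, χ m x ≤ 1 := by
    intro x
    by_cases h : ∃ m ∈ I, lam ^ 2 < tailSq s D S J f m x ∧ tailSq s D S J f (m + 1) x ≤ lam ^ 2
    · obtain ⟨m, hm, h1, h2⟩ := h
      rw [Finset.sum_eq_single_of_mem m hm]
      · simp only [hχ]; split_ifs <;> simp
      · intro l _ hl
        simp only [hχ]
        rw [if_neg]
        rintro ⟨h3, h4⟩
        rcases lt_or_gt_of_ne hl with hlt' | hlt'
        · exact absurd (h1.trans_le (tailSq_anti (show l + 1 ≤ m from hlt') f x)) (not_lt.2 h4)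
        · exact absurd (h3.trans_le (tailSq_anti (show m + 1 ≤ l from hlt') f x)) (not_lt.2 h2)
    · push Not at h
      rw [Finset.sum_eq_zero fun m hm => if_neg fun hh => absurd hh.2 (not_le.2 (h m hm hh.1))]
      exact zero_le
  have hab : ∀ x, a x ≠ 0 → lam ^ 2 < tailSq s D S J f 0 x := by
    intro x hx
    have h1 : (ρ * lam) ^ 2 < tailSq s D S J f 0 x := by
      by_contra hcon
      exact hx (if_neg fun hh => hcon hh.1)
    refine lt_of_le_of_lt ?_ h1
    rw [mul_pow, hρ, add_mul, one_mul]
    exact le_self_add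
  have ha_le : ∀ x, a x ≤ ∑ m ∈ I, χ m x * a x := by
    intro x
    by_cases h0 : a x = 0
    · rw [h0]; exact zero_le
    · have hMI : M x ∈ I := Finset.mem_range.2 (Nat.lt_succ_of_le (Nat.findGreatest_le J))
      refine le_trans ?_ (Finset.single_le_sum (f := fun m => χ m x * a x)
        (fun _ _ => zero_le) hMI)
      rw [hχM x (hab x h0), one_mul]
  have hχc : ∀ m x, ∀ y ∈ cell (s m) x, χ m y = χ m x := by
    intro m x y hy
    simp only [hχ]
    rw [tailSq_congr hS.mono hy, tailSq_congr hS.mono (cell_mono (hS.mono m.le_succ) hy)]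
  have hcell : ∀ m ∈ I, ∀ x, ((2 * (N : ℝ≥0∞)) ^ p + 1) * (χ m x * eavg (s m) a x) ≤
      (2 * (N : ℝ≥0∞)) ^ p * (χ m x * eavg (s m) b x) := by
    intro m hm x
    by_cases hx : lam ^ 2 < tailSq s D S J f m x ∧ tailSq s D S J f (m + 1) x ≤ lam ^ 2
    · have h1 : χ m x = 1 := if_pos hx
      set G := (cell (s m) x).filter fun y => (ρ * lam) ^ 2 < tailSq s D S J f 0 y ∧
        maxHL f y ≤ γ * lam with hG
      have hGs : G ⊆ cell (s m) x := Finset.filter_subset _ _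
      have hc := hS.card_large_le hβ hB (Nat.lt_succ_iff.1 (Finset.mem_range.1 hm)) f hl0 hlt
        hσ0 hσt hρ hγ x hx.2 hGs fun y hy => (Finset.mem_filter.1 hy).2
      have hA := hw.sum_le_of_card_le hp (s m) x hGs hc
      have hbw : ∀ y ∈ cell (s m) x, b y = w y := fun y hy => by
        refine if_pos (lt_of_lt_of_le ?_ (tailSq_anti (Nat.zero_le m) f y))
        rw [tailSq_congr hS.mono hy]; exact hx.1
      rw [h1, one_mul, one_mul, eavg, eavg, Finset.sum_congr rfl hbw, ← Finset.sum_filter, ← hG,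
        mul_left_comm, mul_left_comm _ (_⁻¹)]
      gcongr
    · have h1 : χ m x = 0 := if_neg hx
      simp [h1]
  have hsum : ∀ m ∈ I, ((2 * (N : ℝ≥0∞)) ^ p + 1) * ∑' x, χ m x * a x ≤
      (2 * (N : ℝ≥0∞)) ^ p * ∑' x, χ m x * b x := by
    intro m hm
    rw [← tsum_mul_eavg_of_const (φ := a) (hχc m), ← tsum_mul_eavg_of_const (φ := b) (hχc m),
      ← ENNReal.tsum_mul_left, ← ENNReal.tsum_mul_left]
    exact ENNReal.tsum_le_tsum (hcell m hm)
  calc _ ≤ ((2 * (N : ℝ≥0∞)) ^ p + 1) * ∑' x, ∑ m ∈ I, χ m x * a x := by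
        gcongr with x; exact ha_le x
    _ = ∑ m ∈ I, ((2 * (N : ℝ≥0∞)) ^ p + 1) * ∑' x, χ m x * a x := by
        rw [Summable.tsum_finsetSum fun _ _ => ENNReal.summable, Finset.mul_sum]
    _ ≤ ∑ m ∈ I, (2 * (N : ℝ≥0∞)) ^ p * ∑' x, χ m x * b x := Finset.sum_le_sum hsum
    _ = (2 * (N : ℝ≥0∞)) ^ p * ∑' x, (∑ m ∈ I, χ m x) * b x := by
        rw [← Finset.mul_sum, ← Summable.tsum_finsetSum fun _ _ => ENNReal.summable]
        simp_rw [Finset.sum_mul]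
    _ ≤ (2 * (N : ℝ≥0∞)) ^ p * ∑' x, 1 * b x := by
        gcongr with x; exact hχle x
    _ = _ := by simp only [one_mul]

/-! ### The weighted estimate for systems of pieces -/

open MeasureTheory in
/-- Integration of a good-`λ` inequality that gains only the factor `M / (M + 1)`. The dilation `ρ`
is kept on the left side, to be chosen close to `1` later. -/
lemma lintegral_rpow_le_of_good_lambda {X : Type*} [MeasurableSpace X] (μ : Measure X)
    {F G : X → ℝ} (hF : Measurable F) (hG : Measurable G) (hF0 : ∀ x, 0 ≤ F x) (hG0 : ∀ x, 0 ≤ G x)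
    {p ρ γ : ℝ} (hp : 0 < p) (hρ : 0 < ρ) (hγ : 0 < γ) {M : ℝ≥0∞}
    (h : ∀ t : ℝ, 0 < t →
      (M + 1) * μ {x | ρ * t < F x ∧ G x ≤ γ * t} ≤ M * μ {x | t < F x}) :
    (M + 1) * ∫⁻ x, ENNReal.ofReal ((F x / ρ) ^ p) ∂μ ≤
      M * ∫⁻ x, ENNReal.ofReal (F x ^ p) ∂μ +
        (M + 1) * ∫⁻ x, ENNReal.ofReal ((G x / γ) ^ p) ∂μ := by
  have anti : ∀ H : X → ℝ, Measurable fun t : ℝ => μ {a | t < H a} := fun H =>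
    Antitone.measurable fun t t' htt => measure_mono fun a (ha : t' < H a) => htt.trans_lt ha
  have hm : ∀ H : X → ℝ, Measurable fun t : ℝ =>
      μ {a | t < H a} * ENNReal.ofReal (t ^ (p - 1)) := fun H =>
    (anti H).mul (by fun_prop)
  rw [lintegral_rpow_eq_lintegral_meas_lt_mul μ (.of_forall fun x => div_nonneg (hF0 x) hρ.le)
      (hF.div_const ρ).aemeasurable hp,
    lintegral_rpow_eq_lintegral_meas_lt_mul μ (.of_forall hF0) hF.aemeasurable hp,
    lintegral_rpow_eq_lintegral_meas_lt_mul μ (.of_forall fun x => div_nonneg (hG0 x) hγ.le)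
      (hG.div_const γ).aemeasurable hp,
    mul_left_comm, mul_left_comm M, mul_left_comm (M + 1), ← mul_add,
    ← lintegral_const_mul _ (hm _), ← lintegral_const_mul _ (hm _),
    ← lintegral_const_mul _ (hm _), ← lintegral_add_left ((hm _).const_mul _)]
  gcongr ENNReal.ofReal p * ?_
  refine setLIntegral_mono' measurableSet_Ioi fun t ht => ?_
  rw [← mul_assoc, ← mul_assoc, ← mul_assoc, ← add_mul]
  gcongr
  calc (M + 1) * μ {a | t < F a / ρ}
      ≤ (M + 1) * (μ {x | ρ * t < F x ∧ G x ≤ γ * t} + μ {a | t < G a / γ}) := by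
        gcongr
        refine (measure_mono fun a (ha : t < F a / ρ) => ?_).trans (measure_union_le _ _)
        rw [lt_div_iff₀ hρ, mul_comm] at ha
        by_cases hGa : G a ≤ γ * t
        · exact Or.inl ⟨ha, hGa⟩
        · right
          change t < G a / γ
          rw [lt_div_iff₀ hγ, mul_comm]
          exact not_le.1 hGa
    _ ≤ _ := by
        rw [mul_add]
        exact add_le_add (h t ht) le_rfl

/-- The measure `∑ w(n) δ_n`. -/
def wMeasure (w : Lat d → ℝ≥0) : MeasureTheory.Measure (Lat d) :=
  MeasureTheory.Measure.count.withDensity fun n => (w n : ℝ≥0∞)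

lemma lintegral_wMeasure (w : Lat d → ℝ≥0) (F : Lat d → ℝ≥0∞) :
    ∫⁻ x, F x ∂wMeasure w = ∑' x, F x * (w x : ℝ≥0∞) := by
  rw [wMeasure, MeasureTheory.lintegral_withDensity_eq_lintegral_mul _ (by fun_prop) (by fun_prop),
    MeasureTheory.lintegral_count]
  exact tsum_congr fun x => by rw [Pi.mul_apply, mul_comm]

lemma wMeasure_apply (w : Lat d → ℝ≥0) (P : Lat d → Prop) [DecidablePred P] :
    wMeasure w {x | P x} = ∑' x, if P x then (w x : ℝ≥0∞) else 0 := by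
  rw [← MeasureTheory.lintegral_indicator_one (MeasurableSet.of_discrete), lintegral_wMeasure]
  refine tsum_congr fun x => ?_
  by_cases h : P x <;> simp [h]

lemma maxHL_ne_top {f : Lat d → ℂ} (hf : ∑' x, ‖f x‖ₑ ≠ ⊤) (x : Lat d) : maxHL f x ≠ ⊤ := by
  refine ne_top_of_le_ne_top hf (iSup_le fun y => iSup_le fun n => iSup_le fun hx => ?_)
  have h0 : (cube y n).card ≠ 0 := Finset.card_ne_zero_of_mem hx
  calc _ ≤ (∑ m ∈ cube y n, ‖f m‖ₑ) / 1 := by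
        gcongr
        exact_mod_cast Nat.one_le_iff_ne_zero.2 h0
    _ ≤ _ := by rw [div_one]; exact ENNReal.sum_le_tsum _

lemma IsPieceSystem.hull_ne_top (hS : IsPieceSystem s D A β S) (f : Lat d → ℂ) (k : ℕ)
    (x : Lat d) : hull s D S f k x ≠ ⊤ := by
  refine ne_top_of_le_ne_top ?_ (hS.hull_size f k x)
  refine ENNReal.mul_ne_top ENNReal.coe_ne_top (ENNReal.mul_ne_top (by simp) ?_)
  exact ENNReal.sum_ne_top.2 fun u _ => enorm_ne_top

lemma IsPieceSystem.tailSq_ne_top (hS : IsPieceSystem s D A β S) (J : ℕ) (f : Lat d → ℂ)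
    (x : Lat d) : tailSq s D S J f 0 x ≠ ⊤ :=
  ENNReal.sum_ne_top.2 fun k _ => ENNReal.pow_ne_top (hS.hull_ne_top f k x)

/-- The points moved into `F` by some translation in the window of radius `r`. -/
def thicken (F : Finset (Lat d)) (r : ℕ) : Finset (Lat d) :=
  Finset.image₂ (fun x u => x + u) F (ball r)

lemma mem_thicken {F : Finset (Lat d)} {r : ℕ} {x u : Lat d} (hx : x ∈ F) (hu : u ∈ ball r) :
    x + u ∈ thicken F r :=
  Finset.mem_image₂_of_mem hx hu

lemma IsPieceSystem.tailSq_eq_zero (hS : IsPieceSystem s D A β S) (J : ℕ) {f : Lat d → ℂ}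
    {F : Finset (Lat d)} (hf : ∀ x ∉ F, f x = 0) {x : Lat d}
    (hx : x ∉ thicken F (2 ^ (s J + D + 3))) : tailSq s D S J f 0 x = 0 := by
  refine Finset.sum_eq_zero fun k hk => ?_
  have hz : ∀ u ∈ ball (2 ^ (s k + D + 3)), f (x + u) = 0 := by
    intro u hu
    refine hf _ fun hxu => hx ?_
    have hk' : s k ≤ s J := hS.mono (Nat.lt_succ_iff.1 (Finset.mem_Ico.1 hk).2)
    have := mem_thicken hxu (neg_mem_ball
      (ball_mono (Nat.pow_le_pow_right (by norm_num) (by omega : s k + D + 3 ≤ s J + D + 3)) hu))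
    rwa [add_neg_cancel_right] at this
  rw [hS.hull_const f k x fun u hu => by
    have h0 := hz 0 (zero_mem_ball _)
    rw [add_zero] at h0
    rw [hz u hu, h0]]
  simp

lemma ofReal_toReal_rpow {a : ℝ≥0∞} (ha : a ≠ ⊤) {p : ℝ} (hp : 0 ≤ p) :
    ENNReal.ofReal (a.toReal ^ p) = a ^ p := by
  rw [ENNReal.toReal_rpow, ENNReal.ofReal_toReal (ENNReal.rpow_ne_top_of_nonneg hp ha)]

lemma lt_toReal_sqrt_iff {a : ℝ≥0∞} (ha : a ≠ ⊤) {t : ℝ} (ht : 0 ≤ t) :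
    t < (a ^ (1 / 2 : ℝ)).toReal ↔ ENNReal.ofReal t ^ 2 < a := by
  have hfin : a ^ (1 / 2 : ℝ) ≠ ⊤ := ENNReal.rpow_ne_top_of_nonneg (by norm_num) ha
  rw [← not_le, ← not_le, not_iff_not, ← ENNReal.le_ofReal_iff_toReal_le hfin ht, one_div,
    ENNReal.rpow_inv_le_iff (by norm_num)]
  simp

/-- Weighted estimate for finitely supported functions and finitely many pieces. The finite support
makes the left side finite, so that it can be absorbed. -/
lemma IsPieceSystem.tsum_tailSq_le (hS : IsPieceSystem s D A β S) (hβ : ∀ l, β l ≠ 0) {B : ℝ≥0∞}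
    (hB : ∑' l, (β l : ℝ≥0∞) ≤ B) {p : ℝ} (hp : 0 < p) {N : ℝ≥0} {w : Lat d → ℝ≥0}
    (hw : IsApWeight p N w) (J : ℕ) (f : Lat d → ℂ) {F : Finset (Lat d)}
    (hf : ∀ x ∉ F, f x = 0) {σ ρ γ : ℝ} (hσ : 0 < σ) (hρ0 : 0 < ρ) (hγ0 : 0 < γ)
    (hρ : ρ ^ 2 = 1 + σ ^ 2)
    (hρp : ((2 * N : ℝ) ^ p + 1) = ((2 * N : ℝ) ^ p + 1 / 2) * ρ ^ p)
    (hγ : ENNReal.ofReal γ * 2 ^ ((D + 6) * d) * (1 + 2 * weakConst d D A B)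
      ≤ ENNReal.ofReal σ) :
    ∑' x, (tailSq s D S J f 0 x ^ (1 / 2 : ℝ)) ^ p * (w x : ℝ≥0∞) ≤
      2 * (((2 * (N : ℝ≥0∞)) ^ p + 1) * (ENNReal.ofReal (γ⁻¹ ^ p) * (N : ℝ≥0∞) ^ p)) *
        ∑' x, ‖f x‖ₑ ^ p * (w x : ℝ≥0∞) := by
  classical
  set M : ℝ≥0∞ := (2 * (N : ℝ≥0∞)) ^ p with hM
  have hMt : M ≠ ⊤ := ENNReal.rpow_ne_top_of_nonneg hp.le (ENNReal.mul_ne_top (by simp) (by simp))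
  set T : Lat d → ℝ≥0∞ := tailSq s D S J f 0 with hT
  have hTt : ∀ x, T x ≠ ⊤ := hS.tailSq_ne_top J f
  have hTs : ∀ x, T x ^ (1 / 2 : ℝ) ≠ ⊤ := fun x =>
    ENNReal.rpow_ne_top_of_nonneg (by norm_num) (hTt x)
  have hmt : ∀ x, maxHL f x ≠ ⊤ := maxHL_ne_top (by
    rw [tsum_eq_sum (s := F) fun x hx => by simp [hf x hx]]
    exact ENNReal.sum_ne_top.2 fun u _ => enorm_ne_top)
  set X : ℝ≥0∞ := ∑' x, (T x ^ (1 / 2 : ℝ)) ^ p * (w x : ℝ≥0∞) with hX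
  set Y : ℝ≥0∞ := ∑' x, maxHL f x ^ p * (w x : ℝ≥0∞) with hY
  have hXt : X ≠ ⊤ := by
    rw [hX, tsum_eq_sum (s := thicken F (2 ^ (s J + D + 3)))]
    · refine ENNReal.sum_ne_top.2 fun x _ => ENNReal.mul_ne_top ?_ ENNReal.coe_ne_top
      exact ENNReal.rpow_ne_top_of_nonneg hp.le (hTs x)
    · intro x hx
      rw [hT, hS.tailSq_eq_zero J hf hx, ENNReal.zero_rpow_of_pos (by norm_num),
        ENNReal.zero_rpow_of_pos hp, zero_mul]
  have hgl := lintegral_rpow_le_of_good_lambda (wMeasure w)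
    (F := fun x => (T x ^ (1 / 2 : ℝ)).toReal) (G := fun x => (maxHL f x).toReal)
    Measurable.of_discrete Measurable.of_discrete (fun _ => ENNReal.toReal_nonneg)
    (fun _ => ENNReal.toReal_nonneg) hp hρ0 hγ0 (fun t ht => by
      rw [wMeasure_apply, wMeasure_apply]
      have := hS.good_lambda hβ hB hp hw J f (lam := ENNReal.ofReal t) (σ := ENNReal.ofReal σ)
        (ρ := ENNReal.ofReal ρ) (γ := ENNReal.ofReal γ) (by simpa using ht) (by simp)
        (by simpa using hσ) (by simp) (by
          rw [← ENNReal.ofReal_pow hρ0.le, hρ, ENNReal.ofReal_add (by norm_num) (by positivity),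
            ENNReal.ofReal_pow hσ.le, ENNReal.ofReal_one]) hγ
      refine le_trans (le_of_eq ?_) (this.trans (le_of_eq ?_))
      · congr 1
        refine tsum_congr fun x => ?_
        refine if_congr (and_congr ?_ ?_) rfl rfl
        · rw [lt_toReal_sqrt_iff (hTt x) (by positivity), ENNReal.ofReal_mul hρ0.le]
        · rw [← ENNReal.ofReal_mul hγ0.le, ENNReal.le_ofReal_iff_toReal_le (hmt x) (by positivity)]
      · congr 1
        exact tsum_congr fun x => if_congr (lt_toReal_sqrt_iff (hTt x) ht.le).symm rfl rfl)
  have hcv : ∀ {H : Lat d → ℝ≥0∞} (_ : ∀ x, H x ≠ ⊤) {c : ℝ} (_ : 0 < c),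
      ∫⁻ x, ENNReal.ofReal (((H x).toReal / c) ^ p) ∂wMeasure w
        = ENNReal.ofReal (c⁻¹ ^ p) * ∑' x, H x ^ p * (w x : ℝ≥0∞) := by
    intro H hH c hc
    rw [lintegral_wMeasure, ← ENNReal.tsum_mul_left]
    refine tsum_congr fun x => ?_
    rw [div_eq_inv_mul, Real.mul_rpow (by positivity) ENNReal.toReal_nonneg,
      ENNReal.ofReal_mul (by positivity), ofReal_toReal_rpow (hH x) hp.le, mul_assoc]
  have h1 := hcv hTs (c := 1) one_pos
  simp only [div_one, inv_one, Real.one_rpow, ENNReal.ofReal_one, one_mul] at h1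
  rw [hcv hTs hρ0, hcv hmt hγ0, h1, ← hX, ← hY, ← mul_assoc] at hgl
  have hMρ : (M + 1) * ENNReal.ofReal (ρ⁻¹ ^ p) = M + 2⁻¹ := by
    have e1 : M = ENNReal.ofReal ((2 * N : ℝ) ^ p) := by
      rw [hM, ← ENNReal.ofReal_rpow_of_nonneg (by positivity) hp.le,
        ENNReal.ofReal_mul (by norm_num)]
      simp
    have e2 : (2 : ℝ≥0∞)⁻¹ = ENNReal.ofReal (1 / 2) := by
      rw [one_div, ENNReal.ofReal_inv_of_pos (by norm_num)]; simp
    rw [e1, e2, ← ENNReal.ofReal_one, ← ENNReal.ofReal_add (by positivity) (by norm_num),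
      ← ENNReal.ofReal_add (by positivity) (by norm_num), ← ENNReal.ofReal_mul (by positivity),
      hρp, mul_assoc, ← Real.mul_rpow hρ0.le (by positivity), mul_inv_cancel₀ hρ0.ne',
      Real.one_rpow, mul_one]
  rw [hMρ, add_mul] at hgl
  -- The choice of `ρ` leaves `(M + 1 / 2) X` on the left and `M X` on the right.
  have h2 : 2⁻¹ * X ≤ (M + 1) * (ENNReal.ofReal (γ⁻¹ ^ p) * Y) :=
    (ENNReal.add_le_add_iff_left (ENNReal.mul_ne_top hMt hXt)).1 hgl
  calc X = 2 * (2⁻¹ * X) := by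
        rw [← mul_assoc, ENNReal.mul_inv_cancel (by simp) (by simp), one_mul]
    _ ≤ 2 * ((M + 1) * (ENNReal.ofReal (γ⁻¹ ^ p) *
          ((N : ℝ≥0∞) ^ p * ∑' x, ‖f x‖ₑ ^ p * (w x : ℝ≥0∞)))) := by
        refine mul_le_mul_right (h2.trans ?_) _
        gcongr
        exact hw.bound f
    _ = _ := by ring

/-- Passage to infinitely many pieces and to arbitrary functions, by locality. -/
lemma IsPieceSystem.wInt_hull_le_of_finite (hS : IsPieceSystem s D A β S) {p : ℝ} (hp : 0 < p)
    {w : Lat d → ℝ≥0} {C : ℝ≥0∞}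
    (h : ∀ (J : ℕ) (f : Lat d → ℂ) (F : Finset (Lat d)), (∀ x ∉ F, f x = 0) →
      ∑' x, (tailSq s D S J f 0 x ^ (1 / 2 : ℝ)) ^ p * (w x : ℝ≥0∞) ≤
        C * ∑' x, ‖f x‖ₑ ^ p * (w x : ℝ≥0∞)) (f : Lat d → ℂ) :
    wInt p w (squareFn (hull s D S f)) ≤ C * wInt p w fun n => ‖f n‖ₑ := by
  classical
  have hfin : ∀ (J : ℕ) (E : Finset (Lat d)),
      ∑ x ∈ E, (tailSq s D S J f 0 x ^ (1 / 2 : ℝ)) ^ p * (w x : ℝ≥0∞) ≤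
        C * wInt p w fun n => ‖f n‖ₑ := by
    intro J E
    set F := thicken E (2 ^ (s J + D + 3)) with hF
    set f' : Lat d → ℂ := fun x => if x ∈ F then f x else 0 with hf'
    have hloc : ∀ x ∈ E, tailSq s D S J f 0 x = tailSq s D S J f' 0 x := by
      intro x hx
      refine Finset.sum_congr rfl fun k hk => ?_
      have hk' : s k ≤ s J := hS.mono (Nat.lt_succ_iff.1 (Finset.mem_Ico.1 hk).2)
      rw [hS.hull_local (f := f) (g := f') fun u hu => ?_]
      have : x + u ∈ F := mem_thicken hx
        (ball_mono (Nat.pow_le_pow_right (by norm_num) (by omega)) hu)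
      simp [hf', this]
    calc _ = ∑ x ∈ E, (tailSq s D S J f' 0 x ^ (1 / 2 : ℝ)) ^ p * (w x : ℝ≥0∞) :=
          Finset.sum_congr rfl fun x hx => by rw [hloc x hx]
      _ ≤ ∑' x, (tailSq s D S J f' 0 x ^ (1 / 2 : ℝ)) ^ p * (w x : ℝ≥0∞) := ENNReal.sum_le_tsum _
      _ ≤ C * ∑' x, ‖f' x‖ₑ ^ p * (w x : ℝ≥0∞) := h J f' F fun x hx => if_neg hx
      _ ≤ _ := by
          rw [wInt]
          gcongr with x
          simp only [hf']
          split_ifs <;> simp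
  rw [wInt, ENNReal.tsum_eq_iSup_sum]
  refine iSup_le fun E => ?_
  have hlim : Filter.Tendsto
      (fun J => ∑ x ∈ E, (tailSq s D S J f 0 x ^ (1 / 2 : ℝ)) ^ p * (w x : ℝ≥0∞)) Filter.atTop
      (nhds (∑ x ∈ E, squareFn (hull s D S f) x ^ p * (w x : ℝ≥0∞))) := by
    refine tendsto_finsetSum _ fun x _ => ENNReal.Tendsto.mul_const ?_ (Or.inr ENNReal.coe_ne_top)
    refine Filter.Tendsto.ennrpow_const p (Filter.Tendsto.ennrpow_const _ ?_)
    have := (ENNReal.tendsto_nat_tsum fun k => hull s D S f k x ^ 2).comp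
      (Filter.tendsto_add_atTop_nat 1)
    simpa only [tailSq, ← Finset.range_eq_Ico, Function.comp_def] using this
  exact le_of_tendsto' hlim fun J => hfin J E

/-- The weighted estimate for the hulls of the pieces, with uniform constants. -/
theorem exists_wInt_hull_le (d D : ℕ) (A B N : ℝ≥0) {p : ℝ} (hp : 0 < p) :
    ∃ C : ℝ≥0, ∀ (s : ℕ → ℕ) (β : ℕ → ℝ≥0) (S : (Lat d → ℂ) → ℕ → Lat d → ℝ≥0∞),
      IsPieceSystem s D A β S → (∀ l, β l ≠ 0) → ∑' l, (β l : ℝ≥0∞) ≤ B →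
      ∀ w : Lat d → ℝ≥0, IsApWeight p N w → ∀ f : Lat d → ℂ,
        wInt p w (squareFn (hull s D S f)) ≤ C * wInt p w fun n => ‖f n‖ₑ := by
  set M : ℝ := (2 * N : ℝ) ^ p with hM
  have hM0 : 0 ≤ M := by positivity
  -- The dilation factor `ρ` is chosen so close to `1` that `ρ ^ p` does not spoil the gain
  -- `M / (M + 1)`.
  set q : ℝ := (M + 1) / (M + 1 / 2) with hq
  have hq1 : 1 < q := by rw [hq, one_lt_div (by positivity)]; linarith
  set ρ : ℝ := q ^ (p⁻¹) with hρdef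
  have hρ1 : 1 < ρ := Real.one_lt_rpow hq1 (by positivity)
  set σ : ℝ := √(ρ ^ 2 - 1) with hσdef
  have hσ2 : 0 < ρ ^ 2 - 1 := by nlinarith
  have hσ : 0 < σ := Real.sqrt_pos.2 hσ2
  have hWt : (1 + 2 * weakConst d D A B) ≠ ⊤ := by
    refine ENNReal.add_ne_top.2 ⟨by simp, ENNReal.mul_ne_top (by simp) ?_⟩
    unfold weakConst pieceConst
    finiteness
  set V : ℝ≥0∞ := 2 ^ ((D + 6) * d) * (1 + 2 * weakConst d D A B) with hV
  have hVt : V ≠ ⊤ := ENNReal.mul_ne_top (by simp) hWt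
  have hV1 : 1 ≤ V := by
    calc (1 : ℝ≥0∞) = 1 * 1 := by ring
      _ ≤ V := by
          rw [hV]
          gcongr
          · exact one_le_pow₀ (by norm_num)
          · exact le_self_add
  have hV0 : 0 < V.toReal := ENNReal.toReal_pos (by positivity) hVt
  set γ : ℝ := σ / V.toReal with hγdef
  have hγ0 : 0 < γ := div_pos hσ hV0
  set C : ℝ≥0∞ := 2 * (((2 * (N : ℝ≥0∞)) ^ p + 1) * (ENNReal.ofReal (γ⁻¹ ^ p) * (N : ℝ≥0∞) ^ p))
    with hC
  have hCt : C ≠ ⊤ := by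
    have h1 : (2 * (N : ℝ≥0∞)) ^ p ≠ ⊤ :=
      ENNReal.rpow_ne_top_of_nonneg hp.le (ENNReal.mul_ne_top (by simp) (by simp))
    have h2 : (N : ℝ≥0∞) ^ p ≠ ⊤ := ENNReal.rpow_ne_top_of_nonneg hp.le (by simp)
    exact ENNReal.mul_ne_top (by simp) (ENNReal.mul_ne_top (ENNReal.add_ne_top.2 ⟨h1, by simp⟩)
      (ENNReal.mul_ne_top (by simp) h2))
  refine ⟨C.toNNReal, fun s β S hS hβ hB w hw f => ?_⟩
  rw [ENNReal.coe_toNNReal hCt]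
  refine hS.wInt_hull_le_of_finite hp (fun J f F hf => ?_) f
  refine hS.tsum_tailSq_le hβ hB hp hw J f hf (ρ := ρ) hσ (by positivity) hγ0 ?_ ?_ ?_
  · rw [hσdef, Real.sq_sqrt hσ2.le]; ring
  · rw [hρdef, ← Real.rpow_mul (by positivity), inv_mul_cancel₀ hp.ne', Real.rpow_one, hq, ← hM]
    field_simp
  · rw [mul_assoc, ← hV, hγdef]
    nth_rewrite 2 [← ENNReal.ofReal_toReal hVt]
    rw [← ENNReal.ofReal_mul (by positivity), div_mul_cancel₀ _ hV0.ne']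

end Pieces

/-! ### Cubic families live on rectangles of bounded eccentricity -/

lemma card_symRect (b : Fin d → ℕ) : (symRect b).card = ∏ i, 2 ^ (b i + 1) := by
  simp only [symRect, Fintype.card_piFinset, Int.card_Ico]
  refine Finset.prod_congr rfl fun i _ => ?_
  rw [show (2 : ℤ) ^ b i - -2 ^ b i = ((2 ^ (b i + 1) : ℕ) : ℤ) by push_cast; ring,
    Int.toNat_natCast]

lemma mem_symRect {b : Fin d → ℕ} {x : Lat d} :
    x ∈ symRect b ↔ ∀ i, -(2 : ℤ) ^ b i ≤ x i ∧ x i < 2 ^ b i := by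
  simp [symRect]

/-- A set that fills a fixed proportion of a rectangle reaches far in each direction. -/
lemma exists_far_point {b : Fin d → ℕ} {E : Finset (Lat d)} {c : ℝ} (hc : 0 < c)
    (hE : E ⊆ symRect b) (hcard : c * ((symRect b).card : ℝ) ≤ E.card) (i : Fin d) :
    ∃ x ∈ E, c * 2 ^ b i ≤ (x i).natAbs + 1 := by
  have hpos : 0 < (symRect b).card := by rw [card_symRect]; positivity
  have hne : E.Nonempty := by
    rw [← Finset.card_pos]
    have : (0 : ℝ) < E.card := lt_of_lt_of_le (by positivity) hcard
    exact_mod_cast this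
  -- If `x` maximizes `|x i|`, then `E` lies in a slab of width `2 |x i| + 1`.
  obtain ⟨x, hx, hmax⟩ := E.exists_max_image (fun x => (x i).natAbs) hne
  refine ⟨x, hx, ?_⟩
  set r := (x i).natAbs
  set F : Fin d → Finset ℤ := fun j => Finset.Ico (-(2 : ℤ) ^ b j) ((2 : ℤ) ^ b j) with hF
  set X : Finset ℤ := Finset.Icc (-(r : ℤ)) r with hX
  have hsub : E ⊆ Fintype.piFinset (Function.update F i X) := by
    intro y hy
    rw [Fintype.mem_piFinset]
    intro j
    by_cases hj : j = i
    · subst hj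
      rw [Function.update_self, hX, Finset.mem_Icc]
      have := hmax y hy
      omega
    · rw [Function.update_of_ne hj]
      exact Fintype.mem_piFinset.1 (hE hy) j
  have h1 := Finset.mul_prod_erase Finset.univ (fun j => (F j).card) (Finset.mem_univ i)
  have h2 := Finset.mul_prod_erase Finset.univ (fun j => (Function.update F i X j).card)
    (Finset.mem_univ i)
  have h3 : ∏ j ∈ Finset.univ.erase i, (Function.update F i X j).card
      = ∏ j ∈ Finset.univ.erase i, (F j).card :=
    Finset.prod_congr rfl fun j hj => by rw [Function.update_of_ne (Finset.ne_of_mem_erase hj)]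
  rw [h3, Function.update_self, ← Fintype.card_piFinset] at h2
  rw [← Fintype.card_piFinset] at h1
  have hFi : (F i).card = 2 ^ (b i + 1) := by
    simp only [hF, Int.card_Ico]
    rw [show (2 : ℤ) ^ b i - -2 ^ b i = ((2 ^ (b i + 1) : ℕ) : ℤ) by push_cast; ring,
      Int.toNat_natCast]
  have hXc : X.card = 2 * r + 1 := by rw [hX, Int.card_Icc]; omega
  set p := ∏ j ∈ Finset.univ.erase i, (F j).card
  have hp : 0 < p := by
    rcases Nat.eq_zero_or_pos p with h0 | h0
    · rw [h0, mul_zero] at h1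
      have : (symRect b).card = 0 := h1.symm
      omega
    · exact h0
  have h4 : E.card ≤ (2 * r + 1) * p := by
    rw [← hXc, h2]; exact Finset.card_le_card hsub
  have h5 : (symRect b).card = 2 ^ (b i + 1) * p := by rw [← hFi, h1]; rfl
  rw [h5] at hcard
  have h6 : c * ((2 ^ (b i + 1) * p : ℕ) : ℝ) ≤ (((2 * r + 1) * p : ℕ) : ℝ) :=
    hcard.trans (by exact_mod_cast h4)
  push_cast at h6
  have hp' : (0 : ℝ) < p := by exact_mod_cast hp
  rw [← mul_assoc] at h6
  have h7 := le_of_mul_le_mul_right h6 hp'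
  rw [pow_succ] at h7
  linarith

lemma card_cube (y : Lat d) (n : ℕ) : (cube y n).card = (n + 1) ^ d := by
  rw [cube, Pi.card_Icc]
  have : ∀ i, (Finset.Icc (y i) (y i + n)).card = n + 1 := fun i => by
    rw [Int.card_Icc]; omega
  simp [this]

/-- The maximal function of the unit mass at the origin. -/
lemma maxHL_single_le (i : Fin d) (x : Lat d) :
    maxHL (Pi.single (0 : Lat d) (1 : ℂ)) x ≤ ((((x i).natAbs + 1) ^ d : ℕ) : ℝ≥0∞)⁻¹ := by
  refine iSup_le fun y => iSup_le fun n => iSup_le fun hx => ?_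
  by_cases h0 : (0 : Lat d) ∈ cube y n
  · have hs : ∑ m ∈ cube y n, ‖(Pi.single (0 : Lat d) (1 : ℂ) : Lat d → ℂ) m‖ₑ = 1 := by
      rw [Finset.sum_eq_single_of_mem 0 h0 fun m _ hm => by
        rw [Pi.single_eq_of_ne hm, enorm_zero]]
      simp
    rw [hs, one_div, ENNReal.inv_le_inv, card_cube]
    rw [cube, Finset.mem_Icc, Pi.le_def, Pi.le_def] at hx h0
    have h1 := hx.1 i
    have h2 := hx.2 i
    have h3 := h0.1 i
    have h4 := h0.2 i
    simp only [Pi.zero_apply] at h3 h4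
    exact_mod_cast Nat.pow_le_pow_left (by omega) d
  · have hs : ∑ m ∈ cube y n, ‖(Pi.single (0 : Lat d) (1 : ℂ) : Lat d → ℂ) m‖ₑ = 0 :=
      Finset.sum_eq_zero fun m hm => by
        rw [Pi.single_eq_of_ne (fun h : m = 0 => h0 (h ▸ hm)), enorm_zero]
    rw [hs, ENNReal.zero_div]; exact zero_le

/-- If averaging over a large part of a rectangle is controlled by the cubic maximal function, then
the rectangle is comparable to a cube. This is seen on the unit mass at the origin, at the point of
the set that is farthest away in the direction of the longest side. -/
lemma eccentricity_le {b : Fin d → ℕ} {E : Finset (Lat d)} {c : ℝ} (hc : 0 < c) {K : ℝ≥0}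
    (hE : E ⊆ symRect b) (hcard : c * ((symRect b).card : ℝ) ≤ E.card)
    (hK : ∀ (f : Lat d → ℂ) (x : Lat d), ‖avg E f x‖ₑ ≤ (K : ℝ≥0∞) * maxHL f x) (i j : Fin d) :
    (2 : ℝ) ^ b i ≤ K * (2 / c) ^ d * 2 ^ b j := by
  obtain ⟨i₀, -, hmax⟩ := Finset.univ.exists_max_image b ⟨i, Finset.mem_univ i⟩
  obtain ⟨x, hx, hfar⟩ := exists_far_point hc hE hcard i₀
  have hE0 : E.card ≠ 0 := Finset.card_ne_zero_of_mem hx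
  set r := (x i₀).natAbs + 1 with hr
  have hav : ‖avg E (Pi.single (0 : Lat d) (1 : ℂ)) x‖ₑ = (E.card : ℝ≥0∞)⁻¹ := by
    rw [avg, Finset.sum_eq_single_of_mem x hx fun y _ hy => by
      rw [Pi.single_eq_of_ne (sub_ne_zero.2 hy.symm)]]
    rw [sub_self, Pi.single_eq_same, mul_one, enorm_inv (by exact_mod_cast hE0), ← ofReal_norm]
    simp
  have h1 : (E.card : ℝ≥0∞)⁻¹ ≤ K * ((r ^ d : ℕ) : ℝ≥0∞)⁻¹ := by
    rw [← hav]
    refine (hK _ x).trans ?_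
    gcongr
    exact maxHL_single_le i₀ x
  have h2 : ((r ^ d : ℕ) : ℝ≥0∞) ≤ K * E.card := by
    have hr0 : ((r ^ d : ℕ) : ℝ≥0∞) ≠ 0 := by
      have : r ^ d ≠ 0 := pow_ne_zero _ (by omega)
      exact_mod_cast this
    rw [ENNReal.inv_le_iff_le_mul (fun _ => by exact_mod_cast hE0) (by simp)] at h1
    calc ((r ^ d : ℕ) : ℝ≥0∞) = ((r ^ d : ℕ) : ℝ≥0∞) * 1 := (mul_one _).symm
      _ ≤ ((r ^ d : ℕ) : ℝ≥0∞) * (E.card * (K * ((r ^ d : ℕ) : ℝ≥0∞)⁻¹)) := by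
          gcongr
      _ = (((r ^ d : ℕ) : ℝ≥0∞) * ((r ^ d : ℕ) : ℝ≥0∞)⁻¹) * (K * E.card) := by ring
      _ = _ := by rw [ENNReal.mul_inv_cancel hr0 (by simp), one_mul]
  have h3 : (r : ℝ) ^ d ≤ K * E.card := by exact_mod_cast h2
  have h4 : (E.card : ℝ) ≤ 2 ^ d * ((2 ^ b i₀) ^ (d - 1) * 2 ^ b j) := by
    have e1 : E.card ≤ ∏ l, 2 ^ (b l + 1) := by
      rw [← card_symRect]; exact Finset.card_le_card hE
    have e2 : ∏ l, 2 ^ (b l + 1) = 2 ^ d * ∏ l, 2 ^ b l := by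
      simp only [pow_succ, Finset.prod_mul_distrib]
      simp [mul_comm]
    have e3 : ∏ l, 2 ^ b l ≤ (2 ^ b i₀) ^ (d - 1) * 2 ^ b j := by
      rw [← Finset.prod_erase_mul Finset.univ _ (Finset.mem_univ j)]
      gcongr
      refine (Finset.prod_le_pow_card _ _ (2 ^ b i₀) fun l _ =>
        Nat.pow_le_pow_right (by norm_num) (hmax l (Finset.mem_univ l))).trans_eq ?_
      simp
    rw [e2] at e1
    calc (E.card : ℝ) ≤ ((2 ^ d * ((2 ^ b i₀) ^ (d - 1) * 2 ^ b j) : ℕ) : ℝ) := by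
          exact_mod_cast e1.trans (Nat.mul_le_mul_left _ e3)
      _ = _ := by push_cast; rfl
  have hd : d = (d - 1) + 1 := by have := i.pos; omega
  set T : ℝ := 2 ^ b i₀ with hT
  have hT0 : 0 < T := by positivity
  have h5 : (c * T) ^ d ≤ K * (2 ^ d * (T ^ (d - 1) * 2 ^ b j)) := by
    calc (c * T) ^ d ≤ (r : ℝ) ^ d := by
          gcongr
          rw [hr]; push_cast; exact hfar
      _ ≤ K * E.card := h3
      _ ≤ _ := by gcongr
  have h6 : T ^ (d - 1) * (c ^ d * T) ≤ T ^ (d - 1) * (K * 2 ^ d * 2 ^ b j) := by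
    calc T ^ (d - 1) * (c ^ d * T) = (c * T) ^ d := by
          rw [mul_pow]
          nth_rewrite 4 [hd]
          rw [pow_succ]; ring
      _ ≤ _ := h5
      _ = _ := by ring
  have h7 := le_of_mul_le_mul_left h6 (by positivity)
  calc (2 : ℝ) ^ b i ≤ T := by
        rw [hT]
        exact pow_le_pow_right₀ (by norm_num) (hmax i (Finset.mem_univ i))
    _ ≤ (K * 2 ^ d * 2 ^ b j) / c ^ d := by rw [le_div_iff₀ (by positivity)]; linarith
    _ = _ := by rw [div_pow]; ring

/-! ### The shortest side of the rectangles -/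

/-- The exponent of the shortest side of the `k`-th rectangle. -/
def minScale (a : ℕ → Fin d → ℕ) (k : ℕ) : ℕ := ⨅ i, a k i

lemma minScale_le (a : ℕ → Fin d → ℕ) (k : ℕ) (i : Fin d) : minScale a k ≤ a k i :=
  ciInf_le (OrderBot.bddBelow _) i

lemma exists_eq_minScale [Nonempty (Fin d)] (a : ℕ → Fin d → ℕ) (k : ℕ) :
    ∃ i, a k i = minScale a k := exists_eq_ciInf_of_finite

lemma IsDyadicScale.monotone {a : ℕ → Fin d → ℕ} (ha : IsDyadicScale a) (i : Fin d) :
    Monotone fun k => a k i := monotone_nat_of_le_succ fun k => ha.mono k i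

lemma IsDyadicScale.monotone_minScale [Nonempty (Fin d)] {a : ℕ → Fin d → ℕ}
    (ha : IsDyadicScale a) : Monotone (minScale a) := by
  intro k l h
  obtain ⟨i, hi⟩ := exists_eq_minScale a l
  rw [← hi]
  exact (minScale_le a k i).trans (ha.monotone i h)

lemma IsDyadicScale.sum_add_le {a : ℕ → Fin d → ℕ} (ha : IsDyadicScale a) (k l : ℕ) :
    ∑ i, a k i + l ≤ ∑ i, a (k + l) i := by
  induction l with
  | zero => simp
  | succ l ih =>
    obtain ⟨i, hi⟩ := ha.strict (k + l)
    have : ∑ i, a (k + l) i < ∑ i, a (k + l + 1) i :=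
      Finset.sum_lt_sum (fun j _ => ha.mono (k + l) j) ⟨i, Finset.mem_univ i, hi⟩
    rw [← add_assoc k l 1]; omega

/-- With bounded eccentricity the shortest side grows linearly in the exponent. -/
lemma IsDyadicScale.minScale_growth {a : ℕ → Fin d → ℕ} (ha : IsDyadicScale a) {D : ℕ}
    (hD : ∀ k i, a k i ≤ minScale a k + D) (k l : ℕ) :
    d * minScale a k + l ≤ d * (minScale a (k + l) + D) := by
  have h1 : d * minScale a k ≤ ∑ i, a k i := by
    simpa using Finset.sum_le_sum (s := Finset.univ) fun i _ => minScale_le a k i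
  have h2 : ∑ i, a (k + l) i ≤ d * (minScale a (k + l) + D) := by
    simpa using Finset.sum_le_sum (s := Finset.univ) fun i _ => hD (k + l) i
  have := ha.sum_add_le k l
  omega

/-- The geometric rate that belongs to the growth of the shortest side: `rate d ^ (2 * d) = 1 / 2`.
-/
def rate (d : ℕ) : ℝ≥0 := (1 / 2 : ℝ≥0) ^ ((2 * d : ℕ) : ℝ)⁻¹

lemma rate_pos (d : ℕ) : 0 < rate d := NNReal.rpow_pos (by norm_num)

lemma rate_pow {d : ℕ} (hd : d ≠ 0) : rate d ^ (2 * d) = 1 / 2 := by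
  rw [rate, NNReal.rpow_inv_natCast_pow _ (by omega)]

lemma rate_lt_one {d : ℕ} (hd : d ≠ 0) : rate d < 1 := by
  by_contra h
  have := one_le_pow₀ (n := 2 * d) (not_lt.1 h)
  rw [rate_pow hd] at this
  exact absurd this (not_le.2 (by rw [← NNReal.coe_lt_coe]; norm_num))

lemma two_pow_le_of_growth {d : ℕ} (hd : d ≠ 0) {m m' l D : ℕ} (h : d * m + l ≤ d * (m' + D)) :
    (2 : ℝ≥0) ^ m ≤ 2 ^ D * (rate d ^ l) ^ 2 * 2 ^ m' := by
  rw [← pow_le_pow_iff_left₀ (zero_le) (zero_le) hd]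
  have e : (2 ^ D * (rate d ^ l) ^ 2 * 2 ^ m') ^ d = 2 ^ (d * (m' + D)) * (rate d ^ (2 * d)) ^ l := by
    ring
  rw [e, rate_pow hd, ← pow_mul]
  calc (2 : ℝ≥0) ^ (m * d) = 2 ^ (d * m + l) * (1 / 2) ^ l := by
        rw [pow_add, mul_assoc, ← mul_pow, mul_one_div_cancel two_ne_zero, one_pow, mul_one,
          mul_comm]
    _ ≤ _ := by gcongr; norm_num

/-! ### Thin boundaries -/

/-- A cell that contains both points of a set and points outside contains a boundary point. -/
lemma exists_boundary_mem_cell {n : ℕ} {z : Lat d} (P : Lat d → Prop) :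
    ∀ (N : ℕ) (y₁ y₂ : Lat d), y₁ ∈ cell n z → y₂ ∈ cell n z →
      ∑ i, (y₂ i - y₁ i).natAbs = N → P y₁ → ¬ P y₂ →
      ∃ y ∈ cell n z, P y ∧ ∃ i, ¬ P (y + Pi.single i 1) ∨ ¬ P (y - Pi.single i 1) := by
  intro N
  induction N with
  | zero =>
    intro y₁ y₂ _ _ hN h1 h2
    exfalso
    have : y₁ = y₂ := funext fun i => by
      have := (Finset.sum_eq_zero_iff.1 hN) i (Finset.mem_univ i)
      omega
    exact h2 (this ▸ h1)
  | succ N ih =>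
    intro y₁ y₂ hy₁ hy₂ hN h1 h2
    obtain ⟨i, -, hi⟩ : ∃ i ∈ Finset.univ, (y₂ i - y₁ i).natAbs ≠ 0 := by
      by_contra hcon
      push Not at hcon
      rw [Finset.sum_eq_zero hcon] at hN
      omega
    -- One step from `y₁` towards `y₂`.
    have step : ∀ e : ℤ, (e = 1 ∧ y₁ i < y₂ i) ∨ (e = -1 ∧ y₂ i < y₁ i) →
        y₁ + Pi.single i e ∈ cell n z ∧
          ∑ j, (y₂ j - (y₁ + Pi.single i e : Lat d) j).natAbs = N := by
      intro e he
      constructor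
      · rw [mem_cell] at hy₁ hy₂ ⊢
        intro j
        by_cases hj : j = i
        · subst hj
          rw [Pi.add_apply, Pi.single_eq_same]
          have g1 := hy₁ j
          have g2 := hy₂ j
          have hp : (0 : ℤ) < 2 ^ n := by positivity
          rw [Int.ediv_eq_iff_of_pos hp] at g1 g2 ⊢
          constructor <;> omega
        · rw [Pi.add_apply, Pi.single_eq_of_ne hj, add_zero]; exact hy₁ j
      · rw [← Finset.add_sum_erase _ _ (Finset.mem_univ i)] at hN ⊢
        rw [Finset.sum_congr rfl (g := fun j => (y₂ j - y₁ j).natAbs) fun j hj => by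
          rw [Pi.add_apply, Pi.single_eq_of_ne (Finset.ne_of_mem_erase hj), add_zero]]
        rw [Pi.add_apply, Pi.single_eq_same]
        omega
    rcases lt_or_gt_of_ne (show y₁ i ≠ y₂ i by omega) with hlt | hlt
    · obtain ⟨hc, hs⟩ := step 1 (Or.inl ⟨rfl, hlt⟩)
      by_cases hP : P (y₁ + Pi.single i 1)
      · exact ih _ _ hc hy₂ hs hP h2
      · exact ⟨y₁, hy₁, h1, i, Or.inl hP⟩
    · obtain ⟨hc, hs⟩ := step (-1) (Or.inr ⟨rfl, hlt⟩)
      by_cases hP : P (y₁ + Pi.single i (-1))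
      · exact ih _ _ hc hy₂ hs hP h2
      · refine ⟨y₁, hy₁, h1, i, Or.inr ?_⟩
        rwa [Pi.single_neg, ← sub_eq_add_neg] at hP

/-- For every `x`, the cells of side `2 ^ n` that cross the boundary of `x - E` lie in the window
of radius `r` around `x` and contain at most `θ` points. -/
def HasThinBoundary (n r : ℕ) (θ : ℝ≥0∞) (E : Finset (Lat d)) : Prop :=
  ∀ x : Lat d, ∃ B : Finset (Lat d),
    (∀ z, (∃ y ∈ cell n z, x - y ∈ E) → (∃ y ∈ cell n z, x - y ∉ E) → z ∈ B) ∧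
    (B.card : ℝ≥0∞) ≤ θ ∧ ∀ z ∈ B, z - x ∈ ball r

/-- A cell that crosses the boundary of `x - E` contains a boundary point, and since the rectangle is
at least as long as the cell, all its points are among the translates that `bdryCount` counts. -/
lemma hasThinBoundary_of_bdryCount {b b' : Fin d → ℕ} {E : Finset (Lat d)} {n R : ℕ}
    (hE : E ⊆ symRect b') (hn : ∀ i, n ≤ b i) (hb : ∀ i, b i ≤ R) (hb' : ∀ i, b' i ≤ R) :
    HasThinBoundary n (2 ^ (R + 1)) (bdryCount E (symRect b)) E := by
  classical
  intro x
  set Z : Set (Lat d) := {ξ | ∃ h ∈ symRect b, h - ξ ∈ bdry E} with hZ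
  have hZsub : Z ⊆ (Finset.image₂ (fun h e => h - e) (symRect b) E : Finset (Lat d)) := by
    rintro ξ ⟨h, hh, hξ⟩
    rw [Finset.mem_coe, Finset.mem_image₂]
    exact ⟨h, hh, h - ξ, hξ.1, by abel⟩
  have hZfin : Z.Finite := (Finset.finite_toSet _).subset hZsub
  refine ⟨hZfin.toFinset.image (fun ξ => ξ + x), fun z h1 h2 => ?_, ?_, fun z hz => ?_⟩
  · obtain ⟨y₁, hy₁, h1⟩ := h1
    obtain ⟨y₂, hy₂, h2⟩ := h2
    obtain ⟨y, hy, hyE, i, hi⟩ :=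
      exists_boundary_mem_cell (fun y => x - y ∈ E) _ y₁ y₂ hy₁ hy₂ rfl h1 h2
    refine Finset.mem_image.2 ⟨z - x, ?_, sub_add_cancel z x⟩
    rw [Set.Finite.mem_toFinset]
    refine ⟨z - y, ?_, ?_⟩
    · rw [mem_symRect]
      intro j
      have h3 := abs_sub_lt_of_ediv_eq (mem_cell.1 (mem_cell_comm.1 hy) j)
      have h4 : (2 : ℤ) ^ n ≤ 2 ^ b j := pow_le_pow_right₀ (by norm_num) (hn j)
      rw [abs_lt] at h3
      rw [Pi.sub_apply]
      constructor <;> linarith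
    · rw [show z - y - (z - x) = x - y by abel]
      refine ⟨hyE, i, ?_⟩
      rcases hi with hi | hi
      · right; rwa [sub_add_eq_sub_sub] at hi
      · left; rwa [sub_sub_eq_add_sub, add_sub_right_comm] at hi
  · have : (hZfin.toFinset.image (fun ξ => ξ + x)).card ≤ bdryCount E (symRect b) := by
      refine Finset.card_image_le.trans_eq ?_
      rw [bdryCount, ← Set.ncard_eq_toFinset_card Z hZfin]
    exact_mod_cast this
  · obtain ⟨ξ, hξ, rfl⟩ := Finset.mem_image.1 hz
    rw [Set.Finite.mem_toFinset] at hξ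
    obtain ⟨h, hh, hξ⟩ := hξ
    rw [add_sub_cancel_right, mem_ball]
    intro i
    have h1 := mem_symRect.1 hh i
    have h2 := mem_symRect.1 (hE hξ.1) i
    have h3 : (2 : ℤ) ^ b i ≤ 2 ^ R := pow_le_pow_right₀ (by norm_num) (hb i)
    have h4 : (2 : ℤ) ^ b' i ≤ 2 ^ R := pow_le_pow_right₀ (by norm_num) (hb' i)
    rw [Pi.sub_apply] at h2
    push_cast
    rw [pow_succ, abs_le]
    constructor <;> linarith

/-! ### Averages over sets with thin boundary -/

/-- The reflected translate `x - E`. -/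
def refl (x : Lat d) (E : Finset (Lat d)) : Finset (Lat d) := E.image fun y => x - y

lemma mem_refl {x z : Lat d} {E : Finset (Lat d)} : z ∈ refl x E ↔ x - z ∈ E := by
  rw [refl, Finset.mem_image]
  exact ⟨by rintro ⟨y, hy, rfl⟩; simpa using hy, fun h => ⟨_, h, by abel⟩⟩

lemma avg_eq_refl (E : Finset (Lat d)) (f : Lat d → ℂ) (x : Lat d) :
    avg E f x = (E.card : ℂ)⁻¹ * ∑ z ∈ refl x E, f z := by
  rw [avg, refl, Finset.sum_image (sub_right_injective.injOn)]

lemma sum_le_window {x : Lat d} {r : ℕ} {G : Finset (Lat d)} (hG : ∀ z ∈ G, z - x ∈ ball r)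
    (φ : Lat d → ℝ≥0∞) : ∑ z ∈ G, φ z ≤ ∑ u ∈ ball r, φ (x + u) := by
  classical
  calc ∑ z ∈ G, φ z = ∑ u ∈ G.image (fun z => z - x), φ (x + u) := by
        rw [Finset.sum_image (sub_left_injective.injOn)]; simp
    _ ≤ _ := Finset.sum_le_sum_of_subset fun u hu => by
        obtain ⟨z, hz, rfl⟩ := Finset.mem_image.1 hu
        exact hG z hz

/-- `E` lies in the window of radius `r` and fills a fixed proportion of a cell of side `2 ^ n`. -/
structure IsFat (n r : ℕ) (q : ℝ≥0) (E : Finset (Lat d)) : Prop where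
  inv_card_le : (E.card : ℝ≥0∞)⁻¹ ≤ q * (2 ^ (n * d))⁻¹
  subset : E ⊆ ball r

lemma enorm_inv_natCast {m : ℕ} (hm : m ≠ 0) : ‖(m : ℂ)⁻¹‖ₑ = (m : ℝ≥0∞)⁻¹ := by
  rw [enorm_inv (by exact_mod_cast hm), ← ofReal_norm]; simp

section Fat

variable {n r : ℕ} {q : ℝ≥0} {E : Finset (Lat d)}

lemma IsFat.card_ne_zero (h : IsFat n r q E) : E.card ≠ 0 := by
  intro h0
  have := h.inv_card_le
  rw [h0, Nat.cast_zero, ENNReal.inv_zero, top_le_iff] at this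
  exact ENNReal.mul_ne_top ENNReal.coe_ne_top (by simp) this

lemma IsFat.refl_window (h : IsFat n r q E) (x : Lat d) : ∀ z ∈ refl x E, z - x ∈ ball r := by
  intro z hz
  rw [← neg_sub x z]
  exact neg_mem_ball (h.subset (mem_refl.1 hz))

lemma IsFat.enorm_inv_card_le (h : IsFat n r q E) :
    ‖(E.card : ℂ)⁻¹‖ₑ ≤ q * (2 ^ (n * d))⁻¹ := by
  rw [enorm_inv_natCast h.card_ne_zero]; exact h.inv_card_le

lemma IsFat.enorm_avg_le (h : IsFat n r q E) (f : Lat d → ℂ) (x : Lat d) :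
    ‖avg E f x‖ₑ ≤ q * ((2 ^ (n * d))⁻¹ * ∑ u ∈ ball r, ‖f (x + u)‖ₑ) := by
  rw [avg_eq_refl, enorm_mul, ← mul_assoc]
  gcongr
  · exact h.enorm_inv_card_le
  · exact (enorm_sum_le _ _).trans (sum_le_window (h.refl_window x) fun z => ‖f z‖ₑ)

lemma IsFat.avg_eq_of_const (h : IsFat n r q E) {f : Lat d → ℂ} {x : Lat d}
    (hf : ∀ u ∈ ball r, f (x + u) = f x) : avg E f x = f x := by
  have : ∀ y ∈ E, f (x - y) = f x := fun y hy => by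
    rw [sub_eq_add_neg]; exact hf _ (neg_mem_ball (h.subset hy))
  rw [avg, Finset.sum_congr rfl this, Finset.sum_const, nsmul_eq_mul, ← mul_assoc,
    inv_mul_cancel₀ (by exact_mod_cast h.card_ne_zero), one_mul]

end Fat

/-- Cauchy–Schwarz over the cells that cross the boundary of `U`. -/
lemma sq_enorm_sum_le_of_boundary {n r : ℕ} {θ : ℝ≥0∞} {b : Lat d → ℂ}
    (hb : ∀ x, cavg n b x = 0) {x : Lat d} {U B : Finset (Lat d)}
    (hB : ∀ z, (∃ y ∈ cell n z, y ∈ U) → (∃ y ∈ cell n z, y ∉ U) → z ∈ B)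
    (hθ : (B.card : ℝ≥0∞) ≤ θ) (hBx : ∀ z ∈ B, z - x ∈ ball r) :
    ‖∑ z ∈ U, b z‖ₑ ^ 2 ≤
      θ * ∑ u ∈ ball r, eavg n (fun y => if y ∈ U then ‖b y‖ₑ else 0) (x + u) ^ 2 := by
  calc _ ≤ (∑ z ∈ B, eavg n (fun y => if y ∈ U then ‖b y‖ₑ else 0) z) ^ 2 := by
        gcongr; exact enorm_sum_le_sum_eavg hb U B hB
    _ ≤ (B.card : ℝ≥0∞) * ∑ z ∈ B, eavg n (fun y => if y ∈ U then ‖b y‖ₑ else 0) z ^ 2 :=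
        sq_sum_le_card_mul _ _
    _ ≤ _ := by
        gcongr
        exact sum_le_window hBx fun z => eavg n (fun y => if y ∈ U then ‖b y‖ₑ else 0) z ^ 2

lemma HasThinBoundary.sq_enorm_sum_le {n r : ℕ} {θ : ℝ≥0∞} {E : Finset (Lat d)}
    (h : HasThinBoundary n r θ E) {b : Lat d → ℂ} (hb : ∀ x, cavg n b x = 0) (x : Lat d) :
    ‖∑ z ∈ refl x E, b z‖ₑ ^ 2 ≤ θ * ∑ u ∈ ball r, eavg n (fun y => ‖b y‖ₑ) (x + u) ^ 2 := by
  obtain ⟨B, hB, hθ, hBx⟩ := h x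
  refine (sq_enorm_sum_le_of_boundary hb (U := refl x E) (by simpa only [mem_refl] using hB)
    hθ hBx).trans ?_
  gcongr with u hu
  exact eavg_mono (fun y => by split_ifs <;> simp) _

lemma HasThinBoundary.sq_enorm_sum_sdiff_le {n r : ℕ} {θ : ℝ≥0∞} {E E' : Finset (Lat d)}
    (h : HasThinBoundary n r θ E) (h' : HasThinBoundary n r θ E') {b : Lat d → ℂ}
    (hb : ∀ x, cavg n b x = 0) (x : Lat d) :
    ‖∑ z ∈ refl x E' \ refl x E, b z‖ₑ ^ 2 ≤ 2 * θ * ∑ u ∈ ball r,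
      eavg n (fun y => if y ∈ refl x E' \ refl x E then ‖b y‖ₑ else 0) (x + u) ^ 2 := by
  obtain ⟨B, hB, hθ, hBx⟩ := h x
  obtain ⟨B', hB', hθ', hBx'⟩ := h' x
  refine sq_enorm_sum_le_of_boundary hb (B := B ∪ B') ?_ ?_ ?_
  · rintro z ⟨y, hy, hyU⟩ ⟨y', hy', hyU'⟩
    simp only [Finset.mem_sdiff, mem_refl, not_and, not_not] at hyU hyU'
    rw [Finset.mem_union]
    by_cases hc : x - y' ∈ E'
    · exact Or.inl (hB z ⟨y', hy', hyU' hc⟩ ⟨y, hy, hyU.2⟩)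
    · exact Or.inr (hB' z ⟨y, hy, hyU.1⟩ ⟨y', hy', hc⟩)
  · rw [two_mul]
    refine le_trans ?_ (add_le_add hθ hθ')
    exact_mod_cast Finset.card_union_le B B'
  · intro z hz
    rcases Finset.mem_union.1 hz with hz | hz
    · exact hBx z hz
    · exact hBx' z hz

/-! ### Increasing sequences of sets -/

lemma avg_sub_avg {E E' : Finset (Lat d)} (h : E ⊆ E') (f : Lat d → ℂ) (x : Lat d) :
    avg E f x - avg E' f x = ((E.card : ℂ)⁻¹ - (E'.card : ℂ)⁻¹) * ∑ z ∈ refl x E, f z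
      - (E'.card : ℂ)⁻¹ * ∑ z ∈ refl x E' \ refl x E, f z := by
  have hs : refl x E ⊆ refl x E' := fun z hz => mem_refl.2 (h (mem_refl.1 hz))
  rw [avg_eq_refl, avg_eq_refl, ← Finset.sum_sdiff hs]; ring

/-- The differences of an increasing sequence of sets are disjoint. -/
lemma sum_sum_sdiff_le {m : ℕ} (F : Fin (m + 1) → Finset (Lat d)) (hF : Monotone F)
    (φ : Lat d → ℝ≥0∞) :
    ∑ j : Fin m, ∑ z ∈ F j.succ \ F j.castSucc, φ z ≤ ∑ z ∈ F (Fin.last m), φ z := by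
  induction m with
  | zero => simp
  | succ m ih =>
    rw [Fin.sum_univ_castSucc]
    have h1 := ih (fun j => F j.castSucc) fun i j hij => hF (by simpa using hij)
    have h2 : F (Fin.last m).castSucc ⊆ F (Fin.last (m + 1)) := hF (Fin.le_last _)
    rw [← Finset.sum_sdiff h2, add_comm]
    refine add_le_add ?_ h1
    rw [Fin.succ_last]

lemma sum_eavg_sdiff_le {m n : ℕ} (F : Fin (m + 1) → Finset (Lat d)) (hF : Monotone F)
    (φ : Lat d → ℝ≥0∞) (x : Lat d) :
    ∑ j : Fin m, eavg n (fun y => if y ∈ F j.succ \ F j.castSucc then φ y else 0) x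
      ≤ eavg n φ x := by
  simp only [eavg]
  rw [← Finset.mul_sum, Finset.sum_comm]
  gcongr with y hy
  have h := sum_sum_sdiff_le F hF fun z => if z = y then φ y else 0
  simp only [Finset.sum_ite_eq'] at h
  exact h.trans (by split_ifs <;> simp)

/-- The variation of the normalizing factors is controlled by the first one. -/
lemma sum_enorm_inv_card_sub_le {m : ℕ} (F : Fin (m + 1) → Finset (Lat d)) (hF : Monotone F)
    (h0 : ∀ j, (F j).card ≠ 0) :
    ∑ j : Fin m, ‖((F j.castSucc).card : ℂ)⁻¹ - ((F j.succ).card : ℂ)⁻¹‖ₑ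
      ≤ ((F 0).card : ℝ≥0∞)⁻¹ := by
  have tele : ∀ (m : ℕ) (r : Fin (m + 1) → ℝ),
      ∑ j : Fin m, (r j.castSucc - r j.succ) = r 0 - r (Fin.last m) := by
    intro m r
    induction m with
    | zero => simp
    | succ m ih =>
      have := ih fun j => r j.castSucc
      rw [Fin.sum_univ_castSucc]
      simp only [Fin.castSucc_zero, ← Fin.succ_castSucc] at this ⊢
      rw [this, Fin.succ_last]; ring
  set r : Fin (m + 1) → ℝ := fun j => ((F j).card : ℝ)⁻¹ with hr
  have hr0 : ∀ j, 0 ≤ r j := fun j => by positivity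
  have hanti : ∀ j : Fin m, 0 ≤ r j.castSucc - r j.succ := fun j => by
    rw [sub_nonneg]
    refine inv_anti₀ ?_ ?_
    · exact_mod_cast Nat.pos_of_ne_zero (h0 _)
    · exact_mod_cast Finset.card_le_card (hF (Fin.castSucc_lt_succ).le)
  have he : ∀ j : Fin m, ‖((F j.castSucc).card : ℂ)⁻¹ - ((F j.succ).card : ℂ)⁻¹‖ₑ
      = ENNReal.ofReal (r j.castSucc - r j.succ) := by
    intro j
    rw [← ofReal_norm, show ((F j.castSucc).card : ℂ)⁻¹ - ((F j.succ).card : ℂ)⁻¹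
      = ((r j.castSucc - r j.succ : ℝ) : ℂ) by simp [hr], Complex.norm_real, Real.norm_eq_abs,
      abs_of_nonneg (hanti j)]
  rw [Finset.sum_congr rfl fun j _ => he j, ← ENNReal.ofReal_sum_of_nonneg fun j _ => hanti j,
    tele]
  calc _ ≤ ENNReal.ofReal (r 0) := ENNReal.ofReal_le_ofReal (by linarith [hr0 (Fin.last m)])
    _ = _ := by
        simp only [hr]
        rw [ENNReal.ofReal_inv_of_pos (by exact_mod_cast Nat.pos_of_ne_zero (h0 0)),
          ENNReal.ofReal_natCast]

section Chain

variable {m n n' r : ℕ} {q : ℝ≥0} {F : Fin (m + 1) → Finset (Lat d)}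

lemma refl_mono (hF : Monotone F) (x : Lat d) : Monotone fun j => refl x (F j) :=
  fun _ _ h _ hz => mem_refl.2 (hF h (mem_refl.1 hz))

lemma sum_enorm_avg_sub_le (hF : Monotone F) (hfat : ∀ j, IsFat n r q (F j)) (f : Lat d → ℂ)
    (x : Lat d) :
    ∑ j : Fin m, ‖avg (F j.castSucc) f x - avg (F j.succ) f x‖ₑ ≤
      2 * q * ((2 ^ (n * d))⁻¹ * ∑ u ∈ ball r, ‖f (x + u)‖ₑ) := by
  set Φ := ∑ u ∈ ball r, ‖f (x + u)‖ₑ with hΦ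
  have hw : ∀ j, ∑ z ∈ refl x (F j), ‖f z‖ₑ ≤ Φ := fun j =>
    sum_le_window ((hfat j).refl_window x) fun z => ‖f z‖ₑ
  calc _ ≤ ∑ j : Fin m, (‖((F j.castSucc).card : ℂ)⁻¹ - ((F j.succ).card : ℂ)⁻¹‖ₑ * Φ +
        q * (2 ^ (n * d))⁻¹ * ∑ z ∈ refl x (F j.succ) \ refl x (F j.castSucc), ‖f z‖ₑ) := by
        refine Finset.sum_le_sum fun j _ => ?_
        rw [avg_sub_avg (hF (Fin.castSucc_lt_succ).le)]
        refine enorm_sub_le.trans (add_le_add ?_ ?_)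
        · rw [enorm_mul]; gcongr; exact (enorm_sum_le _ _).trans (hw _)
        · rw [enorm_mul]
          gcongr
          · exact (hfat _).enorm_inv_card_le
          · exact enorm_sum_le _ _
    _ = (∑ j : Fin m, ‖((F j.castSucc).card : ℂ)⁻¹ - ((F j.succ).card : ℂ)⁻¹‖ₑ) * Φ +
        q * (2 ^ (n * d))⁻¹ *
          ∑ j : Fin m, ∑ z ∈ refl x (F j.succ) \ refl x (F j.castSucc), ‖f z‖ₑ := by
        rw [Finset.sum_add_distrib, Finset.sum_mul, Finset.mul_sum]
    _ ≤ q * (2 ^ (n * d))⁻¹ * Φ + q * (2 ^ (n * d))⁻¹ * Φ := by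
        gcongr
        · exact (sum_enorm_inv_card_sub_le F hF fun j => (hfat j).card_ne_zero).trans
            (hfat 0).inv_card_le
        · exact (sum_sum_sdiff_le _ (refl_mono hF x) _).trans (hw _)
    _ = _ := by ring

/-- The quadratic gain for an increasing sequence. In each difference, the change of the normalizing
factor and the contribution of the new points are estimated separately; both can be summed, since
the factors are monotone and the sets of new points are disjoint. -/
lemma sum_sq_enorm_avg_sub_le (hF : Monotone F) (hfat : ∀ j, IsFat n r q (F j)) {θ : ℝ≥0∞}
    (hthin : ∀ j, HasThinBoundary n' r θ (F j)) {b : Lat d → ℂ} (hb : ∀ x, cavg n' b x = 0)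
    (x : Lat d) :
    ∑ j : Fin m, ‖avg (F j.castSucc) b x - avg (F j.succ) b x‖ₑ ^ 2 ≤
      6 * (q * (2 ^ (n * d))⁻¹) ^ 2 * (θ *
        ∑ u ∈ ball r, eavg n' (fun y => ‖b y‖ₑ) (x + u) ^ 2) := by
  set Ψ := ∑ u ∈ ball r, eavg n' (fun y => ‖b y‖ₑ) (x + u) ^ 2 with hΨ
  set Q : ℝ≥0∞ := q * (2 ^ (n * d))⁻¹ with hQ
  set δ : Fin m → ℝ≥0∞ := fun j => ‖((F j.castSucc).card : ℂ)⁻¹ - ((F j.succ).card : ℂ)⁻¹‖ₑ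
    with hδ
  set G : Fin m → Finset (Lat d) := fun j => refl x (F j.succ) \ refl x (F j.castSucc) with hG
  set v : Fin m → Lat d → ℝ≥0∞ := fun j => eavg n' (fun y => if y ∈ G j then ‖b y‖ₑ else 0) with hv
  have hδsum : ∑ j, δ j ^ 2 ≤ Q ^ 2 := by
    refine (sum_sq_le_sq_sum _ _).trans ?_
    gcongr
    exact (sum_enorm_inv_card_sub_le F hF fun j => (hfat j).card_ne_zero).trans
      (hfat 0).inv_card_le
  have hvsum : ∑ j, ∑ u ∈ ball r, v j (x + u) ^ 2 ≤ Ψ := by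
    rw [Finset.sum_comm]
    refine Finset.sum_le_sum fun u _ => (sum_sq_le_sq_sum _ _).trans ?_
    gcongr
    exact sum_eavg_sdiff_le _ (refl_mono hF x) _ _
  calc _ ≤ ∑ j : Fin m, 2 * (δ j ^ 2 * (θ * Ψ) +
        Q ^ 2 * (2 * θ * ∑ u ∈ ball r, v j (x + u) ^ 2)) := by
        refine Finset.sum_le_sum fun j _ => ?_
        rw [avg_sub_avg (hF (Fin.castSucc_lt_succ).le)]
        refine (pow_le_pow_left' enorm_sub_le 2).trans ((sq_add_le_two_mul _ _).trans ?_)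
        rw [enorm_mul, enorm_mul, mul_pow, mul_pow]
        gcongr
        · exact (hthin _).sq_enorm_sum_le hb x
        · exact (hfat _).enorm_inv_card_le
        · exact (hthin _).sq_enorm_sum_sdiff_le (hthin _) hb x
    _ = 2 * ((∑ j, δ j ^ 2) * (θ * Ψ) +
          Q ^ 2 * (2 * θ * ∑ j, ∑ u ∈ ball r, v j (x + u) ^ 2)) := by
        rw [← Finset.mul_sum, Finset.sum_add_distrib, Finset.sum_mul]
        simp only [Finset.mul_sum]
    _ ≤ 2 * (Q ^ 2 * (θ * Ψ) + Q ^ 2 * (2 * θ * Ψ)) := by gcongr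
    _ = _ := by ring

end Chain

/-! ### The long and the short pieces form systems -/

/-- The properties of a regular family that the estimates use: the scales `2 ^ s k` grow
geometrically, the sets of the `k`-th block are increasing and comparable to cubes of side
`2 ^ s k`, and their boundaries are thin. -/
structure IsRegularCubic (s : ℕ → ℕ) (D : ℕ) (q Q : ℝ≥0) (β : ℕ → ℝ≥0)
    (E : ℕ → Finset (Lat d)) : Prop where
  zero : s 0 = 0
  mono : Monotone s
  growth : ∀ k l, (2 : ℝ≥0) ^ s k ≤ 2 ^ D * β l ^ 2 * 2 ^ s (k + l)
  nested : ∀ k, ∀ t ∈ block k, ∀ t' ∈ block k, t ≤ t' → E t ⊆ E t'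
  fat : ∀ k, ∀ t ∈ block k, IsFat (s k) (2 ^ (s k + D)) q (E t)
  thin : ∀ κ k, κ ≤ k → ∀ t ∈ block k, HasThinBoundary (s κ) (2 ^ (s k + D))
    (Q * (β (k - κ) : ℝ≥0∞) ^ 2 * 2 ^ (s k * d)) (E t)

/-- The constant in the systems of long and short pieces. -/
def systemConst (D : ℕ) (q Q : ℝ≥0) : ℝ≥0 := 2 ^ D + (1 + 2 * q) + 6 * q ^ 2 * Q

section Systems

variable {s : ℕ → ℕ} {D : ℕ} {q Q : ℝ≥0} {β : ℕ → ℝ≥0} {E : ℕ → Finset (Lat d)}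

lemma le_systemConst_growth : (2 : ℝ≥0) ^ D ≤ systemConst D q Q :=
  le_add_of_le_of_nonneg (le_add_of_nonneg_right zero_le) zero_le

lemma le_systemConst_size : ((1 : ℝ≥0∞) + 2 * q) ≤ (systemConst D q Q : ℝ≥0) := by
  have : 1 + 2 * q ≤ systemConst D q Q :=
    le_add_of_le_of_nonneg (le_add_of_nonneg_left zero_le) zero_le
  exact_mod_cast this

lemma le_systemConst_smooth : (6 * (q : ℝ≥0∞) ^ 2 * Q) ≤ (systemConst D q Q : ℝ≥0) := by
  have : 6 * q ^ 2 * Q ≤ systemConst D q Q := le_add_of_nonneg_left zero_le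
  exact_mod_cast this

lemma IsRegularCubic.growth_ennreal (h : IsRegularCubic s D q Q β E) (k l : ℕ) :
    (2 : ℝ≥0∞) ^ s k ≤ (systemConst D q Q : ℝ≥0) * β l ^ 2 * 2 ^ s (k + l) := by
  have : (2 : ℝ≥0) ^ s k ≤ systemConst D q Q * β l ^ 2 * 2 ^ s (k + l) :=
    (h.growth k l).trans (by gcongr; exact le_systemConst_growth)
  exact_mod_cast this

/-- The volume of the cell cancels against the size of the boundary. -/
lemma thin_mul_fat_le (n : ℕ) (b W : ℝ≥0∞) :
    6 * ((q : ℝ≥0∞) * (2 ^ (n * d))⁻¹) ^ 2 * (Q * b ^ 2 * 2 ^ (n * d) * W) ≤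
      (systemConst D q Q : ℝ≥0) * b ^ 2 * ((2 ^ (n * d))⁻¹ * W) := by
  calc _ = (((2 : ℝ≥0∞) ^ (n * d))⁻¹ * 2 ^ (n * d)) *
        (6 * (q : ℝ≥0∞) ^ 2 * Q * b ^ 2 * ((2 ^ (n * d))⁻¹ * W)) := by ring
    _ ≤ _ := by
        rw [two_pow_inv_mul, one_mul]
        gcongr
        exact le_systemConst_smooth

lemma shortPiece_le_iff {f : Lat d → ℂ} {k : ℕ} {x : Lat d} {C : ℝ≥0∞} :
    shortPiece E f k x ≤ C ↔ ∀ (n : ℕ) (t : Fin (n + 1) → ℕ), StrictMono t →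
      (∀ j, t j ∈ block k) →
      ∑ j : Fin n, ‖avg (E (t j.castSucc)) f x - avg (E (t j.succ)) f x‖ₑ ^ 2 ≤ C ^ 2 := by
  rw [shortPiece, one_div, ENNReal.rpow_inv_le_iff (by norm_num)]
  simp only [iSup_le_iff, ENNReal.rpow_ofNat]

lemma sq_rpow_half (a : ℝ≥0∞) : (a ^ (1 / 2 : ℝ)) ^ 2 = a := by
  rw [← ENNReal.rpow_ofNat, ← ENNReal.rpow_mul]; norm_num

lemma rpow_half_sq (a : ℝ≥0∞) : (a ^ 2) ^ (1 / 2 : ℝ) = a := by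
  rw [← ENNReal.rpow_ofNat, ← ENNReal.rpow_mul]; norm_num

lemma avg_add (F : Finset (Lat d)) (f g : Lat d → ℂ) (x : Lat d) :
    avg F (fun y => f y + g y) x = avg F f x + avg F g x := by
  simp only [avg, Finset.sum_add_distrib, mul_add]

lemma condAvg_add (b : Fin d → ℕ) (f g : Lat d → ℂ) (x : Lat d) :
    condAvg b (fun y => f y + g y) x = condAvg b f x + condAvg b g x := by
  simp only [condAvg, Finset.sum_add_distrib, mul_add]

lemma shortPiece_add (f g : Lat d → ℂ) (k : ℕ) (x : Lat d) :
    shortPiece E (fun y => f y + g y) k x ≤ shortPiece E f k x + shortPiece E g k x := by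
  rw [shortPiece_le_iff]
  intro n t ht htk
  have hf := shortPiece_le_iff.1 (le_refl (shortPiece E f k x)) n t ht htk
  have hg := shortPiece_le_iff.1 (le_refl (shortPiece E g k x)) n t ht htk
  set u : Fin n → ℝ≥0∞ := fun j => ‖avg (E (t j.castSucc)) f x - avg (E (t j.succ)) f x‖ₑ
  set v : Fin n → ℝ≥0∞ := fun j => ‖avg (E (t j.castSucc)) g x - avg (E (t j.succ)) g x‖ₑ
  have hmink := ENNReal.Lp_add_le Finset.univ u v (p := 2) (by norm_num)
  simp only [ENNReal.rpow_ofNat] at hmink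
  rw [← sq_rpow_half (∑ j : Fin n, _)]
  gcongr
  calc _ ≤ (∑ j, (u j + v j) ^ 2) ^ (1 / 2 : ℝ) := by
        gcongr with j
        rw [avg_add, avg_add, add_sub_add_comm]
        exact enorm_add_le _ _
    _ ≤ _ := hmink
    _ ≤ _ := by
        refine add_le_add ?_ ?_
        · rw [← rpow_half_sq (shortPiece E f k x)]
          gcongr
        · rw [← rpow_half_sq (shortPiece E g k x)]
          gcongr

theorem IsRegularCubic.isPieceSystem_short (h : IsRegularCubic s D q Q β E) :
    IsPieceSystem s D (systemConst D q Q) β (shortPiece E) where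
  zero := h.zero
  mono := h.mono
  growth := h.growth_ennreal
  add := shortPiece_add
  size f k x := by
    rw [shortPiece_le_iff]
    intro n t ht htk
    have hF : Monotone fun j => E (t j) := fun i j hij =>
      h.nested k _ (htk i) _ (htk j) (ht.monotone hij)
    refine (sum_sq_le_sq_sum _ _).trans ?_
    gcongr
    refine (sum_enorm_avg_sub_le hF (fun j => h.fat k _ (htk j)) f x).trans ?_
    gcongr
    exact le_trans le_add_self le_systemConst_size
  const f k x hf := by
    refine le_antisymm (shortPiece_le_iff.2 fun n t _ htk => ?_) zero_le
    refine (Finset.sum_eq_zero fun j _ => ?_).le.trans zero_le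
    rw [(h.fat k _ (htk _)).avg_eq_of_const hf, (h.fat k _ (htk _)).avg_eq_of_const hf]
    simp
  smooth κ k hκ b hb x := by
    rw [sq_le_iff_le_rpow, shortPiece_le_iff]
    intro n t ht htk
    rw [sq_rpow_half]
    have hF : Monotone fun j => E (t j) := fun i j hij =>
      h.nested k _ (htk i) _ (htk j) (ht.monotone hij)
    exact (sum_sq_enorm_avg_sub_le hF (fun j => h.fat k _ (htk j))
      (fun j => h.thin κ k hκ _ (htk j)) hb x).trans (thin_mul_fat_le _ _ _)

lemma atom_window {b : Fin d → ℕ} {R : ℕ} (hR : ∀ i, b i ≤ R) (x : Lat d) :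
    ∀ z ∈ atom b (atomIndex b x), z - x ∈ ball (2 ^ R) := by
  intro z hz
  rw [mem_atom] at hz
  rw [mem_ball]
  intro i
  have h1 := abs_sub_lt_of_ediv_eq (congrFun hz i)
  have h2 : (2 : ℤ) ^ b i ≤ 2 ^ R := pow_le_pow_right₀ (by norm_num) (hR i)
  push_cast
  exact (h1.trans_le h2).le

lemma atom_card_ne_zero (b : Fin d → ℕ) (m : Lat d) : (atom b m).card ≠ 0 := by
  rw [card_atom]; positivity

lemma enorm_inv_card_atom_le {b : Fin d → ℕ} {n : ℕ} (hn : ∀ i, n ≤ b i) (m : Lat d) :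
    ‖((atom b m).card : ℂ)⁻¹‖ₑ ≤ (2 ^ (n * d))⁻¹ := by
  rw [enorm_inv_natCast (atom_card_ne_zero b m), ENNReal.inv_le_inv, card_atom]
  have : 2 ^ (n * d) ≤ ∏ i, 2 ^ b i := by
    calc 2 ^ (n * d) = ∏ _i : Fin d, 2 ^ n := by simp [pow_mul]
      _ ≤ _ := Finset.prod_le_prod' fun i _ => Nat.pow_le_pow_right (by norm_num) (hn i)
  exact_mod_cast this

lemma condAvg_eq_of_const {b : Fin d → ℕ} {R : ℕ} (hR : ∀ i, b i ≤ R) {f : Lat d → ℂ} {x : Lat d}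
    (hf : ∀ u ∈ ball (2 ^ R), f (x + u) = f x) : condAvg b f x = f x := by
  have : ∀ z ∈ atom b (atomIndex b x), f z = f x := fun z hz => by
    rw [← hf _ (atom_window hR x z hz), add_sub_cancel]
  rw [condAvg, Finset.sum_congr rfl this, Finset.sum_const, nsmul_eq_mul, ← mul_assoc,
    inv_mul_cancel₀ (by exact_mod_cast atom_card_ne_zero b _), one_mul]

lemma condAvg_eq_zero {b : Fin d → ℕ} {n : ℕ} (hn : ∀ i, n ≤ b i) {f : Lat d → ℂ}
    (hf : ∀ x, cavg n f x = 0) (x : Lat d) : condAvg b f x = 0 := by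
  rw [condAvg, ← sum_cavg_of_saturated (j := n)]
  · simp [hf]
  · intro y hy z hz
    rw [mem_atom] at hy ⊢
    rw [← hy]
    exact funext fun i => ediv_two_pow_congr (hn i) (mem_cell.1 hz i)

/-- On functions with mean zero over smaller cells the conditional average vanishes, because the boxes
are unions of such cells; only the average over `E t` remains. -/
theorem IsRegularCubic.isPieceSystem_long (h : IsRegularCubic s D q Q β E) {a : ℕ → Fin d → ℕ}
    (ha : ∀ k i, s k ≤ a k i) (haD : ∀ k i, a k i ≤ s k + D) :
    IsPieceSystem s D (systemConst D q Q) β (longPiece a E) where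
  zero := h.zero
  mono := h.mono
  growth := h.growth_ennreal
  add f g k x := by
    refine iSup₂_le fun t ht => ?_
    rw [avg_add, condAvg_add, add_sub_add_comm]
    refine (enorm_add_le _ _).trans (add_le_add ?_ ?_)
    · exact le_iSup₂ (f := fun t (_ : t ∈ block k) => ‖avg (E t) f x - condAvg (a k) f x‖ₑ) t ht
    · exact le_iSup₂ (f := fun t (_ : t ∈ block k) => ‖avg (E t) g x - condAvg (a k) g x‖ₑ) t ht
  size f k x := by
    refine iSup₂_le fun t ht => enorm_sub_le.trans ?_
    calc _ ≤ q * ((2 ^ (s k * d))⁻¹ * ∑ u ∈ ball (2 ^ (s k + D)), ‖f (x + u)‖ₑ) +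
          (2 ^ (s k * d))⁻¹ * ∑ u ∈ ball (2 ^ (s k + D)), ‖f (x + u)‖ₑ := by
          refine add_le_add ((h.fat k t ht).enorm_avg_le f x) ?_
          rw [condAvg, enorm_mul]
          gcongr
          · exact enorm_inv_card_atom_le (ha k) _
          · exact (enorm_sum_le _ _).trans
              (sum_le_window (atom_window (haD k) x) fun z => ‖f z‖ₑ)
      _ = (1 + q) * ((2 ^ (s k * d))⁻¹ * ∑ u ∈ ball (2 ^ (s k + D)), ‖f (x + u)‖ₑ) := by ring
      _ ≤ _ := by
          gcongr
          refine le_trans ?_ le_systemConst_size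
          rw [two_mul]
          gcongr
          exact le_self_add
  const f k x hf := by
    refine le_antisymm (iSup₂_le fun t ht => ?_) zero_le
    rw [(h.fat k t ht).avg_eq_of_const hf, condAvg_eq_of_const (haD k) hf]
    simp
  smooth κ k hκ b hb x := by
    rw [sq_le_iff_le_rpow]
    refine iSup₂_le fun t ht => ?_
    rw [← sq_le_iff_le_rpow, condAvg_eq_zero (fun i => (h.mono hκ).trans (ha k i)) hb, sub_zero,
      avg_eq_refl, enorm_mul, mul_pow]
    refine le_trans ?_ (thin_mul_fat_le (s k) (β (k - κ)) _)
    rw [mul_assoc 6]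
    refine le_trans ?_ (le_mul_of_one_le_left zero_le (by norm_num))
    gcongr
    · exact (h.fat k t ht).enorm_inv_card_le
    · exact (h.thin κ k hκ t ht).sq_enorm_sum_le hb x

end Systems

/-! ### Regular cubic families -/

lemma HasThinBoundary.mono {n r : ℕ} {θ θ' : ℝ≥0∞} {E : Finset (Lat d)}
    (h : HasThinBoundary n r θ E) (hθ : θ ≤ θ') : HasThinBoundary n r θ' E := by
  intro x
  obtain ⟨B, h1, h2, h3⟩ := h x
  exact ⟨B, h1, h2.trans hθ, h3⟩

lemma two_pow_mem_block (k : ℕ) : 2 ^ k ∈ block k :=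
  ⟨le_rfl, Nat.pow_lt_pow_right (by norm_num) k.lt_succ_self⟩

section Family

variable {a : ℕ → Fin d → ℕ} {𝒜 : ℕ → Set (Finset (Lat d))} {E : ℕ → Finset (Lat d)}
  {c : ℝ} {ι ε : ℕ → ℝ} {K : ℝ≥0} {D : ℕ}

lemma le_minScale_add [Nonempty (Fin d)] (hc : 0 < c) (hA : IsJRW a 𝒜 c ι ε)
    (hreg : IsRegularWrt 𝒜 E) (hK : IsCubic E K) (hD : (K : ℝ) * (2 / c) ^ d ≤ 2 ^ D)
    (k : ℕ) (i : Fin d) : a k i ≤ minScale a k + D := by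
  obtain ⟨j, hj⟩ := exists_eq_minScale a k
  have hmem := hreg.mem k _ (two_pow_mem_block k)
  have h := eccentricity_le hc (hA.location k _ hmem) (hA.size k _ hmem)
    (fun f x => (le_iSup₂ (f := fun t (_ : 1 ≤ t) => ‖avg (E t) f x‖ₑ) (2 ^ k)
      Nat.one_le_two_pow).trans (hK f x)) i j
  rw [hj] at h
  have h2 : (2 : ℝ) ^ a k i ≤ 2 ^ (minScale a k + D) := by
    refine h.trans ?_
    rw [pow_add, mul_comm ((2 : ℝ) ^ minScale a k)]
    gcongr
  exact (pow_le_pow_iff_right₀ (by norm_num)).1 h2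

/-- The rate of decay that belongs to the smoothness sequence `ι`: it also dominates the geometric
rate at which the scales grow, and it does not vanish. -/
def decay (d : ℕ) (ι : ℕ → ℝ) (l : ℕ) : ℝ≥0 := ‖ι l‖₊ + rate d ^ l

lemma summable_decay (hd : d ≠ 0) (hι : Summable ι) : Summable (decay d ι) :=
  (NNReal.summable_coe.1 hι.norm).add (NNReal.summable_geometric (rate_lt_one hd))

lemma decay_ne_zero (d : ℕ) (ι : ℕ → ℝ) (l : ℕ) : decay d ι l ≠ 0 :=
  (add_pos_of_nonneg_of_pos zero_le (pow_pos (rate_pos d) l)).ne'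

lemma card_symRect_le {b : Fin d → ℕ} {R : ℕ} (h : ∀ i, b i ≤ R) :
    (symRect b).card ≤ 2 ^ ((R + 1) * d) := by
  rw [card_symRect]
  calc ∏ i, 2 ^ (b i + 1) ≤ ∏ _i : Fin d, 2 ^ (R + 1) :=
        Finset.prod_le_prod' fun i _ => Nat.pow_le_pow_right (by norm_num) (by have := h i; omega)
    _ = _ := by simp [pow_mul]

lemma le_card_symRect {b : Fin d → ℕ} {R : ℕ} (h : ∀ i, R ≤ b i) :
    2 ^ (R * d) ≤ (symRect b).card := by
  rw [card_symRect]
  calc 2 ^ (R * d) = ∏ _i : Fin d, 2 ^ R := by simp [pow_mul]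
    _ ≤ _ := Finset.prod_le_prod' fun i _ => Nat.pow_le_pow_right (by norm_num)
      ((h i).trans (Nat.le_succ _))

lemma isRegularCubic_of_isCubic [Nonempty (Fin d)] (hd : d ≠ 0) (hc : 0 < c)
    (ha : IsDyadicScale a) (hA : IsJRW a 𝒜 c ι ε) (hreg : IsRegularWrt 𝒜 E) (hK : IsCubic E K)
    (hD : (K : ℝ) * (2 / c) ^ d ≤ 2 ^ D) :
    IsRegularCubic (minScale a) (D + 1) c⁻¹.toNNReal (2 ^ ((D + 1) * d)) (decay d ι) E where
  zero := by
    obtain ⟨j, hj⟩ := exists_eq_minScale a 0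
    rw [← hj, ha.zero]
  mono := ha.monotone_minScale
  growth k l := by
    refine (two_pow_le_of_growth hd
      (ha.minScale_growth (le_minScale_add hc hA hreg hK hD) k l)).trans ?_
    gcongr
    · norm_num
    · exact Nat.le_succ D
    · exact le_add_self
  nested := hreg.nested
  fat k t ht := by
    have hmem := hreg.mem k t ht
    refine ⟨?_, fun y hy => ?_⟩
    · have h1 : (2 : ℝ) ^ (minScale a k * d) ≤ c⁻¹ * (E t).card := by
        have h2 : ((2 ^ (minScale a k * d) : ℕ) : ℝ) ≤ (symRect (a k)).card := by
          exact_mod_cast le_card_symRect (minScale_le a k)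
        push_cast at h2
        have h3 := hA.size k _ hmem
        rw [le_inv_mul_iff₀ hc]
        exact (mul_le_mul_of_nonneg_left h2 hc.le).trans h3
      have h4 : (2 : ℝ≥0∞) ^ (minScale a k * d) ≤ (c⁻¹.toNNReal : ℝ≥0∞) * (E t).card := by
        have h5 : (2 : ℝ≥0) ^ (minScale a k * d) ≤ c⁻¹.toNNReal * (E t).card := by
          rw [← NNReal.coe_le_coe]
          push_cast
          rwa [Real.coe_toNNReal _ (inv_nonneg.2 hc.le)]
        exact_mod_cast h5
      have hq : (c⁻¹.toNNReal : ℝ≥0∞) ≠ 0 := by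
        have : 0 < c⁻¹.toNNReal := Real.toNNReal_pos.2 (inv_pos.2 hc)
        exact_mod_cast this.ne'
      calc ((E t).card : ℝ≥0∞)⁻¹
          = (c⁻¹.toNNReal : ℝ≥0∞) * ((c⁻¹.toNNReal : ℝ≥0∞) * (E t).card)⁻¹ := by
            rw [ENNReal.mul_inv (Or.inl hq) (Or.inl ENNReal.coe_ne_top), ← mul_assoc,
              ENNReal.mul_inv_cancel hq ENNReal.coe_ne_top, one_mul]
        _ ≤ _ := by gcongr
    · have h1 := mem_symRect.1 (hA.location k _ hmem hy)
      rw [mem_ball]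
      intro i
      have h2 : (2 : ℤ) ^ a k i ≤ 2 ^ (minScale a k + (D + 1)) :=
        pow_le_pow_right₀ (by norm_num)
          ((le_minScale_add hc hA hreg hK hD k i).trans (by omega))
      have := h1 i
      push_cast
      rw [abs_le]
      constructor <;> linarith
  thin κ k hκ t ht := by
    have hmem := hreg.mem k t ht
    have hub := le_minScale_add hc hA hreg hK hD k
    refine (hasThinBoundary_of_bdryCount (b := a κ) (hA.location k _ hmem) (minScale_le a κ)
      (fun i => (ha.monotone i hκ).trans (hub i)) hub).mono ?_
    obtain ⟨l, rfl⟩ := Nat.exists_eq_add_of_le hκ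
    rw [Nat.add_sub_cancel_left]
    set H := (symRect (a (κ + l))).card with hH
    have hH0 : 0 < H := (Nat.two_pow_pos _).trans_le (le_card_symRect (minScale_le a (κ + l)))
    have h1 := hA.smooth κ l _ hmem
    rw [div_le_iff₀ (by exact_mod_cast hH0)] at h1
    have h2 : (bdryCount (E t) (symRect (a κ)) : ℝ≥0∞) ≤ (‖ι l‖₊ : ℝ≥0∞) ^ 2 * H := by
      have h3 : (bdryCount (E t) (symRect (a κ)) : ℝ≥0) ≤ ‖ι l‖₊ ^ 2 * H := by
        rw [← NNReal.coe_le_coe]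
        push_cast
        rwa [Real.norm_eq_abs, sq_abs]
      exact_mod_cast h3
    calc _ ≤ (‖ι l‖₊ : ℝ≥0∞) ^ 2 * H := h2
      _ ≤ (decay d ι l : ℝ≥0∞) ^ 2 *
            ((2 ^ ((minScale a (κ + l) + D + 1) * d) : ℕ) : ℝ≥0∞) := by
          gcongr
          · exact_mod_cast (le_add_of_nonneg_right zero_le : ‖ι l‖₊ ≤ decay d ι l)
          · exact card_symRect_le hub
      _ = _ := by push_cast; ring

end Family

/-! ### Comparison with the discretized square functions -/

lemma mem_tripleAtom {b : Fin d → ℕ} {m x : Lat d} :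
    x ∈ tripleAtom b m ↔ ∀ i, 2 ^ b i * (m i - 1) ≤ x i ∧ x i < 2 ^ b i * (m i + 2) := by
  simp [tripleAtom]

/-- Each point lies in at most `3 ^ d` of the tripled atoms, and their centres are in the window of
the hull. -/
lemma discPiece_le_hull {a : ℕ → Fin d → ℕ} {s : ℕ → ℕ} {D : ℕ} (ha : ∀ k i, s k ≤ a k i)
    (haD : ∀ k i, a k i ≤ s k + D) (S : (Lat d → ℂ) → ℕ → Lat d → ℝ≥0∞) (f : Lat d → ℂ) (k : ℕ)
    (x : Lat d) : discPiece a (S f) k x ≤ 3 ^ d * hull s D S f k x := by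
  classical
  set q := atomIndex (a k) x with hq
  set I : Finset (Lat d) := Fintype.piFinset fun i => Finset.Icc (q i - 1) (q i + 1) with hI
  have hI3 : I.card = 3 ^ d := by
    rw [hI, Fintype.card_piFinset]
    simp only [Int.card_Icc]
    have : ∀ i, (q i + 1 + 1 - (q i - 1)).toNat = 3 := fun i => by omega
    simp [this]
  have hmemI : ∀ m, x ∈ tripleAtom (a k) m → m ∈ I := by
    intro m hm
    rw [hI, Fintype.mem_piFinset]
    intro i
    have h := mem_tripleAtom.1 hm i
    have hp : (0 : ℤ) < 2 ^ a k i := by positivity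
    have h1 : m i - 1 ≤ q i := (Int.le_ediv_iff_mul_le hp).2 (by linarith [h.1])
    have h2 : q i < m i + 2 := (Int.ediv_lt_iff_lt_mul hp).2 (by linarith [h.2])
    rw [Finset.mem_Icc]; constructor <;> omega
  have hterm : ∀ m, (tripleAtom (a k) m : Set (Lat d)).indicator
      (fun _ => shiftedPiece a (S f) k (atomCenter (a k) m)) x ≤ hull s D S f k x := by
    intro m
    by_cases hm : x ∈ tripleAtom (a k) m
    · rw [Set.indicator_of_mem (by exact_mod_cast hm)]
      refine iSup₂_le fun v hv => le_hull f k ?_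
      rw [mem_ball]
      intro i
      have h1 := mem_tripleAtom.1 hm i
      have h2 := mem_symRect.1 hv i
      have h3 := mem_ball.1 (corner_sub_mem_ball (s k) x) i
      have h4 : (2 : ℤ) ^ s k ≤ 2 ^ a k i := pow_le_pow_right₀ (by norm_num) (ha k i)
      have h5 : (2 : ℤ) ^ a k i ≤ 2 ^ (s k + D) := pow_le_pow_right₀ (by norm_num) (haD k i)
      have h6 : (0 : ℤ) ≤ 2 ^ a k i / 2 := by positivity
      have h7 : (2 : ℤ) ^ a k i / 2 ≤ 2 ^ a k i := Int.ediv_le_self _ (by positivity)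
      rw [abs_le, Pi.sub_apply] at h3
      rw [abs_le, Pi.sub_apply, Pi.add_apply, atomCenter]
      push_cast at h3 ⊢
      rw [pow_add _ _ 2]
      constructor <;> nlinarith [h1.1, h1.2, h2.1, h2.2, h3.1, h3.2]
    · rw [Set.indicator_of_notMem (by exact_mod_cast hm)]; exact zero_le
  rw [discPiece, tsum_eq_sum (s := I) fun m hm =>
    Set.indicator_of_notMem (fun h => hm (hmemI m (by exact_mod_cast h))) _]
  calc _ ≤ ∑ _m ∈ I, hull s D S f k x := Finset.sum_le_sum fun m _ => hterm m
    _ = _ := by rw [Finset.sum_const, hI3, nsmul_eq_mul]; push_cast; rfl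

lemma piece_le_hull {s : ℕ → ℕ} {D : ℕ} (S : (Lat d → ℂ) → ℕ → Lat d → ℝ≥0∞) (f : Lat d → ℂ)
    (k : ℕ) (x : Lat d) : S f k x ≤ 1 * hull s D S f k x := by
  rw [one_mul]
  refine le_hull f k ?_
  rw [← neg_sub]
  exact ball_mono (Nat.pow_le_pow_right (by norm_num) (by omega))
    (neg_mem_ball (corner_sub_mem_ball (s k) x))

lemma wInt_squareFn_le {p : ℝ} (hp : 0 ≤ p) (w : Lat d → ℝ≥0) {S T : ℕ → Lat d → ℝ≥0∞}
    {c : ℝ≥0∞} (h : ∀ k x, S k x ≤ c * T k x) :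
    wInt p w (squareFn S) ≤ c ^ p * wInt p w (squareFn T) := by
  rw [wInt, wInt, ← ENNReal.tsum_mul_left]
  refine ENNReal.tsum_le_tsum fun x => ?_
  rw [← mul_assoc, ← ENNReal.mul_rpow_of_nonneg _ _ hp]
  gcongr
  calc squareFn S x ≤ (∑' k, (c * T k x) ^ 2) ^ (1 / 2 : ℝ) := by
        rw [squareFn]; gcongr with k; exact h k x
    _ = (c ^ 2) ^ (1 / 2 : ℝ) * squareFn T x := by
        simp_rw [mul_pow]
        rw [ENNReal.tsum_mul_left, ENNReal.mul_rpow_of_nonneg _ _ (by norm_num), squareFn]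
    _ = _ := by rw [rpow_half_sq]

end LatticeSq

end

theorem mainTheorem2 (d : ℕ) (c : ℝ) (hc : 0 < c) (ι ε : ℕ → ℝ)
    (hι : Summable ι) (hε : Summable ε) (K : ℝ≥0)
    (p : ℝ) (hp : 1 < p) (N : ℝ≥0) :
    ∃ C : ℝ≥0,
      ∀ (a : ℕ → Fin d → ℕ) (𝒜 : ℕ → Set (Finset (LatticeSq.Lat d)))
        (E : ℕ → Finset (LatticeSq.Lat d)),
        LatticeSq.IsDyadicScale a →
        LatticeSq.IsJRW a 𝒜 c ι ε →
        LatticeSq.IsRegularWrt 𝒜 E →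
        LatticeSq.IsCubic E K →
        ∀ w : LatticeSq.Lat d → ℝ≥0, LatticeSq.IsApWeight p N w →
          ∀ f : LatticeSq.Lat d → ℂ,
            LatticeSq.wInt p w (LatticeSq.longSq a E f) ≤
                (C : ℝ≥0∞) * LatticeSq.wInt p w (fun n => ‖f n‖ₑ) ∧
            LatticeSq.wInt p w (LatticeSq.shortSq E f) ≤
                (C : ℝ≥0∞) * LatticeSq.wInt p w (fun n => ‖f n‖ₑ) ∧
            LatticeSq.wInt p w (LatticeSq.discLongSq a E f) ≤
                (C : ℝ≥0∞) * LatticeSq.wInt p w (fun n => ‖f n‖ₑ) ∧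
            LatticeSq.wInt p w (LatticeSq.discShortSq a E f) ≤
                (C : ℝ≥0∞) * LatticeSq.wInt p w (fun n => ‖f n‖ₑ) := by
  rcases Nat.eq_zero_or_pos d with rfl | hd
  -- In dimension zero no dyadic scale increases.
  · exact ⟨0, fun a 𝒜 E ha => (ha.strict 0).choose.elim0⟩
  have : Nonempty (Fin d) := ⟨⟨0, hd⟩⟩
  have hp0 : 0 < p := one_pos.trans hp
  -- The sides of each rectangle differ by a factor of at most `2 ^ D`.
  obtain ⟨D, hD⟩ : ∃ D : ℕ, (K : ℝ) * (2 / c) ^ d ≤ 2 ^ D :=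
    (pow_unbounded_of_one_lt _ one_lt_two).imp fun _ h => h.le
  obtain ⟨C, hC⟩ := LatticeSq.exists_wInt_hull_le d (D + 1)
    (LatticeSq.systemConst (D + 1) c⁻¹.toNNReal (2 ^ ((D + 1) * d)))
    (∑' l, LatticeSq.decay d ι l) N hp0
  refine ⟨(((3 : ℝ≥0) ^ d) ^ p) * C, fun a 𝒜 E ha hA hreg hK w hw f => ?_⟩
  have hfam := LatticeSq.isRegularCubic_of_isCubic hd.ne' hc ha hA hreg hK hD
  have hlo := LatticeSq.minScale_le a
  have hup : ∀ k i, a k i ≤ LatticeSq.minScale a k + (D + 1) := fun k i =>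
    (LatticeSq.le_minScale_add hc hA hreg hK hD k i).trans (by omega)
  have hB : ∑' l, (LatticeSq.decay d ι l : ℝ≥0∞) ≤ (∑' l, LatticeSq.decay d ι l : ℝ≥0) :=
    (ENNReal.coe_tsum (LatticeSq.summable_decay hd.ne' hι)).ge
  have hlong := hC _ _ _ (hfam.isPieceSystem_long hlo hup) (LatticeSq.decay_ne_zero d ι) hB w hw f
  have hshort := hC _ _ _ hfam.isPieceSystem_short (LatticeSq.decay_ne_zero d ι) hB w hw f
  have hcoe : (((((3 : ℝ≥0) ^ d) ^ p) * C : ℝ≥0) : ℝ≥0∞) = ((3 : ℝ≥0∞) ^ d) ^ p * C := by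
    rw [ENNReal.coe_mul, ENNReal.coe_rpow_of_nonneg _ hp0.le]; simp
  have h3 : (1 : ℝ≥0∞) ≤ 3 ^ d := one_le_pow₀ (by norm_num)
  have key : ∀ (S : ℕ → LatticeSq.Lat d → ℝ≥0∞) (T : ℕ → LatticeSq.Lat d → ℝ≥0∞) (b : ℝ≥0∞),
      b ≤ 3 ^ d → (∀ k x, S k x ≤ b * T k x) →
      LatticeSq.wInt p w (LatticeSq.squareFn T) ≤ C * LatticeSq.wInt p w (fun n => ‖f n‖ₑ) →
      LatticeSq.wInt p w (LatticeSq.squareFn S) ≤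
        ((((3 : ℝ≥0) ^ d) ^ p) * C : ℝ≥0) * LatticeSq.wInt p w (fun n => ‖f n‖ₑ) := by
    intro S T b hb hST hT
    rw [hcoe, mul_assoc]
    exact (LatticeSq.wInt_squareFn_le hp0.le w hST).trans
      (mul_le_mul' (ENNReal.rpow_le_rpow hb hp0.le) hT)
  exact ⟨key _ _ 1 h3 (LatticeSq.piece_le_hull (LatticeSq.longPiece a E) f) hlong,
    key _ _ 1 h3 (LatticeSq.piece_le_hull (LatticeSq.shortPiece E) f) hshort,
    key _ _ _ le_rfl (LatticeSq.discPiece_le_hull hlo hup (LatticeSq.longPiece a E) f) hlong,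
    key _ _ _ le_rfl (LatticeSq.discPiece_le_hull hlo hup (LatticeSq.shortPiece E) f) hshort⟩
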